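/- **Setting.** Let $\Omega$ be a Hausdorff space, $\mathcal B$ a $\sigma$-algebra on $\Omega$ containing the Borel sets, and $\mathcal M$ the set of finite, non-zero measures on $\mathcal B$ that are inner regular with respect to compact sets. For measures, $Q\le Q'$ means $Q(B)\le Q'(B)$ for all $B\in\mathcal B$. *Stable clustering base.* This is a triple $(\mathcal A,\mathcal Q,\perp)$ as follows. $\mathcal A\subset\mathcal B$ is a class of closed non-empty sets. $\perp$ is a symmetric relation on $\mathcal B$ such that (i) $B\perp B$ implies $B=\emptyset$; (ii) $A\subset A'$ and $A'\perp B$ imply $A\perp B$; (iii) if $A\in\mathcal A$ and $A\subset B_1\cup\dots\cup B_k$ with closed, pairwise $\perp$-related $B_1,\dots,B_k$, then $A\subset B_i$ for some $i$; (iv) (stability) if $A_1\subset A_2\subset\cdots$ are in $\mathcal A$, $B\in\mathcal B$ and $A_n\perp B$ for all $n$, then $\bigcup_nA_n\perp B$. $\mathcal Q=\{Q_A\}_{A\in\mathcal A}\subset\mathcal M$ consists of probability measures with $\operatorname{supp}Q_A=A$, and for $A\subset A'$ in $\mathcal A$ either $Q_{A'}(A)=0$ or $Q_A=Q_{A'}(\,\cdot\cap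 A)/Q_{A'}(A)$. A *base measure on* $A\in\mathcal A$ is a measure $\alpha Q_A$ with $\alpha>0$. *Forests.* For $\mathcal C\subset\mathcal B\setminus\{\emptyset\}$ let $\mathcal F_{\mathcal C}$ be the set of finite non-empty $F\subset\mathcal C$ such that any $A,A'\in F$ satisfy $A\perp A'$, $A\subset A'$ or $A'\subset A$; put $\mathcal F=\mathcal F_{\mathcal B\setminus\{\emptyset\}}$. The strict ancestors of $A\in F$ are the $A'\in F$ with $A'\supsetneq A$; a root has none; *direct siblings* are distinct nodes with the same strict ancestors, and their *parent* is a minimal strict ancestor. The structure $s(F)$ is the set of all nodes of $F$ that are roots or have a direct sibling. An isomorphism $\zeta:F\to F'$ is a bijection with $A\subset A'\iff\zeta(A)\subset\zeta(A')$. Write $F\le F'$ if there is an isomorphism $\zeta$ with $A\subset\zeta(A)$ for all $A\in F$ (it is then unique). Write $F=_PF'$ if there is an isomorphism $\zeta$ with $P(A\triangle\zeta(A))=0$ for all $A\in F$. If $s(F_1)\le s(F_2)\le\cdots$, put $\lim_ns(F_n)=\{\bigcup_n\zeta_n(A): A\in s(F_1)\}$, where $\zeta_n:s(F_1)\to s(F_n)$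 is the unique isomorphism with $A\subset\zeta_n(A)$. Let $\bar{\mathcal A}$ be the class of unions of increasing sequences in $\mathcal A$. *Isomonotone limits.* A measure $Q$ is *simple on* $F\in\mathcal F_{\mathcal A}$ if $Q=\sum_{A\in F}\alpha_AQ_A$ with all $\alpha_A>0$; its level at $A\in F$ is $\lambda_Q(A)=\bigl(\sum_{A'\in F,\,A'\supset A}\alpha_{A'}Q_{A'}(A)\bigr)Q_A$ (the representation is unique). Write $(Q_n,F_n)\uparrow P$ if each $Q_n$ is simple on $F_n\in\mathcal F_{\mathcal A}$, $Q_1\le Q_2\le\dots\le P$, $Q_n(B)\to P(B)$ for all $B\in\mathcal B$, and $s(F_1)\le s(F_2)\le\cdots$. Let $\bar{\mathcal S}(\mathcal A)$ be the set of $P\in\mathcal M$ that admit such a sequence. *Subadditivity and adaptedness.* For $P\in\mathcal M$ and $B\in\mathcal B$ let $\mathcal Q_P(B)$ be the set of base measures $\mathfrak b\le P$ on some $A\in\mathcal A$ with $B\subset A$. $\mathcal A$ is *$P$-subadditive* if for all base measures $\mathfrak a,\mathfrak a'\le P$ on $A,A'$ with $P(A\cap A')>0$ there is $\mathfrak b\in\mathcal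 Q_P(A\cup A')$ with $\mathfrak b\ge\mathfrak a$ or $\mathfrak b\ge\mathfrak a'$. A simple measure $Q$ on $F$ is *$P$-adapted* if for all direct siblings $A_1,A_2$ in $F$: (grounded) if $\mathcal Q_P(A_1\cup A_2)\ne\emptyset$ then $A_1,A_2$ have a parent in $F$; (fine) each $\mathfrak b\in\mathcal Q_P(A_1\cup A_2)$ satisfies $\mathfrak b\le\tilde{\mathfrak b}$ for some $\tilde{\mathfrak b}\in\mathcal Q_P(A_1\cup\dots\cup A_k)$, where $A_1,\dots,A_k$ are all the nodes with the same strict ancestors as $A_1$; (strictly motivated) there is $\alpha\in(0,1)$ such that no base measure $\mathfrak b$ with $\mathfrak b\ge\alpha\lambda_Q(A_1)$ or $\mathfrak b\ge\alpha\lambda_Q(A_2)$ lies in $\mathcal Q_P(A_1\cup A_2)$. A sequence $(Q_n,F_n)\uparrow P$ is *adapted* if every $Q_n$ is $P$-adapted. *Continuous clusterings.* Let $\mathcal Q\subset\mathcal P\subset\mathcal M$. A map $c:\mathcal P\to\mathcal F$ is a *continuous clustering* if 1. $c(P)=s(c(P))$ for all $P\in\mathcal P$; 2. $\alpha P\in\mathcal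 P$ and $c(\alpha P)=c(P)$ for all $P\in\mathcal P$, $\alpha>0$; 3. $c(Q_A)=\{A\}$ for all $A\in\mathcal A$; 4. if $k\ge1$ and $P_1,\dots,P_k\in\mathcal P$ have pairwise $\perp$-related supports, then $P_1+\dots+P_k\in\mathcal P$ and $c(P_1+\dots+P_k)=c(P_1)\cup\dots\cup c(P_k)$; 5. if $P\in\mathcal P$ and $\mathfrak a$ is a base measure with $\operatorname{supp}P\subset\operatorname{supp}\mathfrak a$, then $\mathfrak a+P\in\mathcal P$ and $c(\mathfrak a+P)=s(\{\operatorname{supp}\mathfrak a\}\cup c(P))$; 6. $c(P)=_P\lim_ns(F_n)$ for all $P\in\mathcal P$ and all adapted sequences $(Q_n,F_n)\uparrow P$. (Conditions 1–5 say that $c$ is an additive clustering; condition 6 is the continuity axiom.) **Theorem.** Let $(\mathcal A,\mathcal Q,\perp)$ be a stable clustering base and let $$\mathcal P_{\mathcal A}=\{P\in\bar{\mathcal S}(\mathcal A) : \mathcal A\text{ is }P\text{-subadditive and there is an adapted sequence }(Q_n,F_n)\uparrow P\}.$$ Then there exists a continuous clustering $c_{\mathcal A}:\mathcal P_{\mathcal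 A}\to\mathcal F_{\bar{\mathcal A}}$. Moreover, it is unique up to null sets: for every continuous clustering $c:\tilde{\mathcal P}\to\mathcal F$, $$c_{\mathcal A}(P)=_Pc(P)\qquad\text{for all }P\in\mathcal P_{\mathcal A}\cap\tilde{\mathcal P}.$$ -/

import Mathlib

open MeasureTheory Set Filter Topology
open scoped ENNReal NNReal

namespace Clustering

section Forests

variable {Ω : Type*}

/-- Strict ancestors of `A` in `F`. -/
def ancestors (F : Set (Set Ω)) (A : Set Ω) : Set (Set Ω) := {A' ∈ F | A ⊂ A'}

/-- `A` is a root of `F`: a maximal element with respect to inclusion. -/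
def IsRoot (F : Set (Set Ω)) (A : Set Ω) : Prop := A ∈ F ∧ ¬ ∃ A' ∈ F, A ⊂ A'

/-- Direct siblings: distinct nodes with the same strict ancestors. -/
def DirectSiblings (F : Set (Set Ω)) (A₁ A₂ : Set Ω) : Prop :=
  A₁ ∈ F ∧ A₂ ∈ F ∧ A₁ ≠ A₂ ∧ ancestors F A₁ = ancestors F A₂

/-- `A'` is a direct parent of `A` in `F`: a minimal element of the strict ancestors. -/
def IsDirectParent (F : Set (Set Ω)) (A' A : Set Ω) : Prop :=
  A' ∈ ancestors F A ∧ ¬ ∃ A'' ∈ ancestors F A, A'' ⊂ A'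

/-- The structure `s(F)` of a forest: the nodes that are roots or have a direct sibling. -/
def struct (F : Set (Set Ω)) : Set (Set Ω) :=
  {A ∈ F | IsRoot F A ∨ ∃ A', DirectSiblings F A A'}

/-- `F` is a finite, non-empty, `C`-valued `perp`-forest. -/
structure IsForest (perp : Set Ω → Set Ω → Prop) (C : Set (Set Ω)) (F : Set (Set Ω)) : Prop where
  finite : F.Finite
  nonempty : F.Nonempty
  subset : F ⊆ C
  forest : ∀ A ∈ F, ∀ A' ∈ F, perp A A' ∨ A ⊆ A' ∨ A' ⊆ A

/-- `ζ` is an isomorphism of forests from `F` to `F'`. -/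
def IsForestIso (ζ : Set Ω → Set Ω) (F F' : Set (Set Ω)) : Prop :=
  BijOn ζ F F' ∧ ∀ A ∈ F, ∀ A' ∈ F, (A ⊆ A' ↔ ζ A ⊆ ζ A')

/-- `ζ` is a forest relating map from `F` to `F'`. -/
def IsFRM (ζ : Set Ω → Set Ω) (F F' : Set (Set Ω)) : Prop :=
  IsForestIso ζ F F' ∧ ∀ A ∈ F, A ⊆ ζ A

/-- The relation `F ≤ F'` between finite forests. -/
def ForestLE (F F' : Set (Set Ω)) : Prop := ∃ ζ, IsFRM ζ F F'

/-- The limit forest `lim s(F n)` of an isomonotone sequence of forests: the sets `⋃ n, ζ n A`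
with `A ∈ s(F 0)`, where `ζ n` is the forest relating map from `s(F 0)` to `s(F n)` (which is
unique on `s(F 0)`). -/
def limForest (F : ℕ → Set (Set Ω)) : Set (Set Ω) :=
  {B | ∃ ζ : ℕ → Set Ω → Set Ω, (∀ n, IsFRM (ζ n) (struct (F 0)) (struct (F n))) ∧
    ∃ A ∈ struct (F 0), B = ⋃ n, ζ n A}

/-- The monotone closure of a class of sets. -/
def monotoneClosure (𝒜 : Set (Set Ω)) : Set (Set Ω) :=
  {B | ∃ A : ℕ → Set Ω, (∀ n, A n ∈ 𝒜) ∧ Monotone A ∧ B = ⋃ n, A n}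

end Forests

section Bases

variable {Ω : Type*} [TopologicalSpace Ω] [MeasurableSpace Ω]

/-- The finite, non-zero, inner regular measures on `Ω`. -/
def finMeasures (Ω : Type*) [TopologicalSpace Ω] [MeasurableSpace Ω] : Set (Measure Ω) :=
  {P | IsFiniteMeasure P ∧ P ≠ 0 ∧ P.InnerRegular}

/-- The non-empty measurable sets. -/
def nonemptyMeas (Ω : Type*) [MeasurableSpace Ω] : Set (Set Ω) :=
  {B | MeasurableSet B ∧ B.Nonempty}

/-- `perp` is an `𝒜`-separation relation. As a relation it matters only on measurable sets. -/
structure IsSeparation (𝒜 : Set (Set Ω)) (perp : Set Ω → Set Ω → Prop) : Prop where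
  isClosed : ∀ A ∈ 𝒜, IsClosed A
  nonempty : ∀ A ∈ 𝒜, A.Nonempty
  symm : ∀ A B, MeasurableSet A → MeasurableSet B → perp A B → perp B A
  reflexivity : ∀ B, MeasurableSet B → perp B B → B = ∅
  monotonicity : ∀ A A' B, MeasurableSet A → MeasurableSet A' → MeasurableSet B →
    A ⊆ A' → perp A' B → perp A B
  connectedness : ∀ A ∈ 𝒜, ∀ (k : ℕ) (B : Fin k → Set Ω), (∀ i, IsClosed (B i)) →
    (∀ i j, i ≠ j → perp (B i) (B j)) → A ⊆ ⋃ i, B i → ∃ i, A ⊆ B i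

/-- Stability of a separation relation. -/
def IsStable (𝒜 : Set (Set Ω)) (perp : Set Ω → Set Ω → Prop) : Prop :=
  ∀ A : ℕ → Set Ω, (∀ n, A n ∈ 𝒜) → Monotone A → ∀ B, MeasurableSet B →
    (∀ n, perp (A n) B) → perp (⋃ n, A n) B

/-- `(𝒜, (Q A)_{A ∈ 𝒜}, perp)` is a clustering base. Only the values `Q A` with `A ∈ 𝒜` matter. -/
structure IsClusteringBase (𝒜 : Set (Set Ω)) (Q : Set Ω → Measure Ω)
    (perp : Set Ω → Set Ω → Prop) : Prop where
  separation : IsSeparation 𝒜 perp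
  mem_finMeasures : ∀ A ∈ 𝒜, Q A ∈ finMeasures Ω
  prob : ∀ A ∈ 𝒜, IsProbabilityMeasure (Q A)
  flat : ∀ A ∈ 𝒜, ∀ A' ∈ 𝒜, A ⊆ A' →
    Q A' A = 0 ∨ Q A = (Q A' A)⁻¹ • (Q A').restrict A
  fitted : ∀ A ∈ 𝒜, (Q A).support = A

/-- `(𝒜, (Q A)_{A ∈ 𝒜}, perp)` is a stable clustering base. -/
structure IsStableClusteringBase (𝒜 : Set (Set Ω)) (Q : Set Ω → Measure Ω)
    (perp : Set Ω → Set Ω → Prop) : Prop where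
  base : IsClusteringBase 𝒜 Q perp
  stable : IsStable 𝒜 perp

/-- `a` is a base measure on the base set `A`. -/
def IsBaseMeasureOn (𝒜 : Set (Set Ω)) (Q : Set Ω → Measure Ω) (a : Measure Ω) (A : Set Ω) : Prop :=
  A ∈ 𝒜 ∧ ∃ α : ℝ≥0, 0 < α ∧ a = α • Q A

/-- `a` is a base measure. -/
def IsBaseMeasure (𝒜 : Set (Set Ω)) (Q : Set Ω → Measure Ω) (a : Measure Ω) : Prop :=
  ∃ A, IsBaseMeasureOn 𝒜 Q a A

/-- `Q' = ∑_{A ∈ F} α A • Q A` with positive coefficients, for an `𝒜`-valued finite forest `F`. -/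
def Represents (𝒜 : Set (Set Ω)) (Q : Set Ω → Measure Ω) (perp : Set Ω → Set Ω → Prop)
    (F : Set (Set Ω)) (α : Set Ω → ℝ≥0) (Q' : Measure Ω) : Prop :=
  IsForest perp 𝒜 F ∧ (∀ A ∈ F, 0 < α A) ∧ Q' = ∑ᶠ A ∈ F, α A • Q A

/-- `Q'` is a simple measure on the forest `F`. -/
def IsSimpleOn (𝒜 : Set (Set Ω)) (Q : Set Ω → Measure Ω) (perp : Set Ω → Set Ω → Prop)
    (Q' : Measure Ω) (F : Set (Set Ω)) : Prop :=
  ∃ α : Set Ω → ℝ≥0, Represents 𝒜 Q perp F α Q'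

/-- The level of `A` in the simple measure `∑_{A ∈ F} α A • Q A`. -/
noncomputable def level (Q : Set Ω → Measure Ω) (F : Set (Set Ω)) (α : Set Ω → ℝ≥0)
    (A : Set Ω) : Measure Ω :=
  (∑ᶠ A' ∈ {A' ∈ F | A ⊆ A'}, (α A' : ℝ≥0∞) * Q A' A) • Q A

/-- The base measures below `P` whose base set contains `B`. -/
def baseBelow (𝒜 : Set (Set Ω)) (Q : Set Ω → Measure Ω) (P : Measure Ω) (B : Set Ω) :
    Set (Measure Ω) :=
  {b | b ≤ P ∧ ∃ A, IsBaseMeasureOn 𝒜 Q b A ∧ B ⊆ A}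

/-- The clustering base is `P`-subadditive. -/
def IsSubadditive (𝒜 : Set (Set Ω)) (Q : Set Ω → Measure Ω) (P : Measure Ω) : Prop :=
  ∀ a a' A A', IsBaseMeasureOn 𝒜 Q a A → IsBaseMeasureOn 𝒜 Q a' A' → a ≤ P → a' ≤ P →
    0 < P (A ∩ A') → ∃ b ∈ baseBelow 𝒜 Q P (A ∪ A'), a ≤ b ∨ a' ≤ b

/-- The simple measure `Q'` on `F` is `P`-adapted: all direct siblings are `P`-grounded, `P`-fine
and strictly motivated. -/
def IsAdapted (𝒜 : Set (Set Ω)) (Q : Set Ω → Measure Ω) (perp : Set Ω → Set Ω → Prop)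
    (P Q' : Measure Ω) (F : Set (Set Ω)) : Prop :=
  ∃ α : Set Ω → ℝ≥0, Represents 𝒜 Q perp F α Q' ∧
    ∀ A₁ A₂, DirectSiblings F A₁ A₂ →
      ((baseBelow 𝒜 Q P (A₁ ∪ A₂)).Nonempty →
        ∃ A', IsDirectParent F A' A₁ ∧ IsDirectParent F A' A₂) ∧
      (∀ b ∈ baseBelow 𝒜 Q P (A₁ ∪ A₂),
        ∃ b' ∈ baseBelow 𝒜 Q P (⋃₀ {A ∈ F | ancestors F A = ancestors F A₁}), b ≤ b') ∧
      (∃ t : ℝ≥0, 0 < t ∧ t < 1 ∧ ∀ b, IsBaseMeasure 𝒜 Q b →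
        (t • level Q F α A₁ ≤ b ∨ t • level Q F α A₂ ≤ b) → b ∉ baseBelow 𝒜 Q P (A₁ ∪ A₂))

/-- Setwise monotone convergence `R n ↑ P` of measures. -/
def MonoConv (R : ℕ → Measure Ω) (P : Measure Ω) : Prop :=
  Monotone R ∧ (∀ n, R n ≤ P) ∧
    ∀ B, MeasurableSet B → Tendsto (fun n => R n B) atTop (𝓝 (P B))

/-- Isomonotone convergence `(R n, F n) ↑ P` of simple measures. -/
structure IsoMonoConv (𝒜 : Set (Set Ω)) (Q : Set Ω → Measure Ω) (perp : Set Ω → Set Ω → Prop)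
    (R : ℕ → Measure Ω) (F : ℕ → Set (Set Ω)) (P : Measure Ω) : Prop where
  simple : ∀ n, IsSimpleOn 𝒜 Q perp (R n) (F n)
  conv : MonoConv R P
  mono : ∀ n, ForestLE (struct (F n)) (struct (F (n + 1)))

/-- An adapted isomonotone sequence `(R n, F n) ↑ P`. -/
def AdaptedSeq (𝒜 : Set (Set Ω)) (Q : Set Ω → Measure Ω) (perp : Set Ω → Set Ω → Prop)
    (R : ℕ → Measure Ω) (F : ℕ → Set (Set Ω)) (P : Measure Ω) : Prop :=
  IsoMonoConv 𝒜 Q perp R F P ∧ ∀ n, IsAdapted 𝒜 Q perp P (R n) (F n)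

/-- The set of all isomonotone limits. -/
def isoLimits (𝒜 : Set (Set Ω)) (Q : Set Ω → Measure Ω) (perp : Set Ω → Set Ω → Prop) :
    Set (Measure Ω) :=
  {P | P ∈ finMeasures Ω ∧ ∃ R F, IsoMonoConv 𝒜 Q perp R F P}

/-- The set `𝒫_𝒜`. -/
def adaptedLimits (𝒜 : Set (Set Ω)) (Q : Set Ω → Measure Ω) (perp : Set Ω → Set Ω → Prop) :
    Set (Measure Ω) :=
  {P | P ∈ isoLimits 𝒜 Q perp ∧ IsSubadditive 𝒜 Q P ∧ ∃ R F, AdaptedSeq 𝒜 Q perp R F P}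

/-- `F₁ =_P F₂`: the forests are isomorphic through a map that moves each node only by a
`P`-null set. -/
def ForestEqAE (P : Measure Ω) (F₁ F₂ : Set (Set Ω)) : Prop :=
  ∃ ζ, IsForestIso ζ F₁ F₂ ∧ ∀ A ∈ F₁, P (symmDiff A (ζ A)) = 0

/-- `c` is an `𝒜`-clustering on `D`. The values of `c` outside `D` are irrelevant. -/
structure IsClustering (𝒜 : Set (Set Ω)) (Q : Set Ω → Measure Ω) (perp : Set Ω → Set Ω → Prop)
    (D : Set (Measure Ω)) (c : Measure Ω → Set (Set Ω)) : Prop where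
  domain : D ⊆ finMeasures Ω
  base_mem : ∀ A ∈ 𝒜, Q A ∈ D
  isForest : ∀ P ∈ D, IsForest perp (nonemptyMeas Ω) (c P)
  structured : ∀ P ∈ D, c P = struct (c P)
  scaleInvariance : ∀ P ∈ D, ∀ α : ℝ≥0, 0 < α → α • P ∈ D ∧ c (α • P) = c P
  baseMeasureClustering : ∀ A ∈ 𝒜, c (Q A) = {A}

/-- `c` is an additive clustering on `D`. -/
structure IsAdditiveClustering (𝒜 : Set (Set Ω)) (Q : Set Ω → Measure Ω)
    (perp : Set Ω → Set Ω → Prop) (D : Set (Measure Ω)) (c : Measure Ω → Set (Set Ω)) : Prop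
    extends IsClustering 𝒜 Q perp D c where
  disjointAdditivity : ∀ (k : ℕ) (P : Fin (k + 1) → Measure Ω), (∀ i, P i ∈ D) →
    (∀ i j, i ≠ j → perp (P i).support (P j).support) →
    ∑ i, P i ∈ D ∧ c (∑ i, P i) = ⋃ i, c (P i)
  baseAdditivity : ∀ P ∈ D, ∀ a, IsBaseMeasure 𝒜 Q a → P.support ⊆ a.support →
    a + P ∈ D ∧ c (a + P) = struct ({a.support} ∪ c P)

/-- `c` is a continuous clustering on `D`. -/
structure IsContinuousClustering (𝒜 : Set (Set Ω)) (Q : Set Ω → Measure Ω)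
    (perp : Set Ω → Set Ω → Prop) (D : Set (Measure Ω)) (c : Measure Ω → Set (Set Ω)) : Prop
    extends IsAdditiveClustering 𝒜 Q perp D c where
  continuity : ∀ P ∈ D, ∀ R F, AdaptedSeq 𝒜 Q perp R F P → ForestEqAE P (c P) (limForest F)

end Bases

end Clustering

set_option linter.unusedSectionVars false

/-! Uniqueness up to null sets is immediate once a continuous clustering on the adapted limits
exists: by continuity, any two of them agree at `P` with the limit forest of one adapted sequence.
The content is existence, which meets two obstacles.

The first is that the limit forest must not depend on the adapted sequence (`AdaptedSeq.aeMatch`).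
The levels of two siblings form an `IsSplit`: a base measure below `P` around both sides dominates
neither level after multiplication by some `t < 1`. By subadditivity, a base measure below `P` that
meets both sides is bounded by `t • a₁` on the first side (`IsSplit.apply_le`). If every node of a
simple measure that meets the first side also met the second, the same bound would hold for the
whole measure, which is impossible close to `P ≥ a₁`. So any other adapted sequence eventually has
nodes meeting only one side, these lie below two siblings, and the part `N` of `A₁` that the growing
sibling never covers satisfies `P N ≤ t * P N`, hence is null. Groundedness plays this role for
roots. Passing from one sequence to the other and back turns almost sure inclusions into equalities,
because in a structured forest a node that is not a root has a sibling of positive mass, so almost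
sure inclusion of nodes is inclusion (`IsLimitForest.subset_of_ae_le`).

The second obstacle is that the additivity axioms are exact equalities of forests, while limits
determine values only up to null sets. The choices must therefore be coherent. The adapted limits
are stable under scaling, under adding a base measure around the support, under separated sums and
under restriction to separated pieces, and the admissible values (`IsCandidate`) transform
accordingly. The support of an adapted limit splits uniquely into finitely many connected parts, and
a disconnected measure receives the union of the values of its parts. Scaling and adding base
measures generate an equivalence relation through a confluent relation (`step_or_step`). Each class
gets one representative, which contains no removable base measure if the class permits this, and the
values in the class are read off from the representative. If the representative is disconnected, its
value comes from its own parts. This recursion ends because the number of nodes, an invariant of the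
measure, drops when passing to parts. That the values so obtained are admissible is
`isCandidate_clusters`, and the axioms follow from it and from the coherence of the choices. -/

namespace Clustering

/-! ### Combinatorics of laminar families: siblings, structure, forest relating maps. -/

section Combinatorics

variable {Ω : Type*}

/-- A finite family of non-empty sets that are pairwise disjoint or nested. -/
structure IsLaminar (F : Set (Set Ω)) : Prop where
  finite : F.Finite
  nonempty : ∀ A ∈ F, A.Nonempty
  nested : ∀ A ∈ F, ∀ B ∈ F, Disjoint A B ∨ A ⊆ B ∨ B ⊆ A

/-- The nodes of a forest that have a direct sibling. -/
def lower (F : Set (Set Ω)) : Set (Set Ω) := {A ∈ F | ∃ A', DirectSiblings F A A'}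

variable {F F' F'' : Set (Set Ω)} {A A' B B' : Set Ω} {ζ ξ : Set Ω → Set Ω}

theorem mem_ancestors : B ∈ ancestors F A ↔ B ∈ F ∧ A ⊂ B := Iff.rfl

theorem DirectSiblings.symm (h : DirectSiblings F A B) : DirectSiblings F B A :=
  ⟨h.2.1, h.1, h.2.2.1.symm, h.2.2.2.symm⟩

theorem DirectSiblings.ssubset_of_ssubset (h : DirectSiblings F A B) {C : Set Ω} (hC : C ∈ F)
    (hAC : A ⊂ C) : B ⊂ C := by
  have : C ∈ ancestors F A := ⟨hC, hAC⟩
  rw [h.2.2.2] at this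
  exact this.2

theorem DirectSiblings.not_subset (h : DirectSiblings F A B) : ¬ A ⊆ B := fun hs =>
  (h.ssubset_of_ssubset h.2.1 (hs.ssubset_of_ne h.2.2.1)).ne rfl

theorem DirectSiblings.disjoint (hF : IsLaminar F) (h : DirectSiblings F A B) : Disjoint A B := by
  rcases hF.nested A h.1 B h.2.1 with h1 | h1 | h1
  · exact h1
  · exact absurd h1 h.not_subset
  · exact absurd h1 h.symm.not_subset

theorem lower_subset : lower F ⊆ F := fun _ h => h.1

theorem struct_subset : struct F ⊆ F := fun _ h => h.1

theorem lower_subset_struct : lower F ⊆ struct F := fun _ h => ⟨h.1, Or.inr h.2⟩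

theorem DirectSiblings.mem_lower (h : DirectSiblings F A B) : A ∈ lower F := ⟨h.1, B, h⟩

theorem IsLaminar.mono (hF : IsLaminar F) (h : F' ⊆ F) : IsLaminar F' :=
  ⟨hF.finite.subset h, fun A hA => hF.nonempty A (h hA),
    fun A hA B hB => hF.nested A (h hA) B (h hB)⟩

theorem IsLaminar.struct (hF : IsLaminar F) : IsLaminar (struct F) := hF.mono struct_subset

theorem IsLaminar.subset_or_subset (hF : IsLaminar F) (hA : A ∈ F) (hB : B ∈ F) {C : Set Ω}
    (hC : C.Nonempty) (hCA : C ⊆ A) (hCB : C ⊆ B) : A ⊆ B ∨ B ⊆ A := by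
  rcases hF.nested A hA B hB with h | h
  · obtain ⟨x, hx⟩ := hC
    exact absurd (hCB hx) (disjoint_left.1 h (hCA hx))
  · exact h

/-- The largest node of a laminar family that contains `A` but not `B`. -/
theorem IsLaminar.exists_largest (hF : IsLaminar F) (hA : A ∈ F) (h : ¬ B ⊆ A) :
    ∃ D ∈ F, A ⊆ D ∧ ¬ B ⊆ D ∧ ∀ E ∈ F, A ⊆ E → ¬ B ⊆ E → E ⊆ D := by
  obtain ⟨D, hD⟩ := (hF.finite.subset (sep_subset F fun D => A ⊆ D ∧ ¬ B ⊆ D)).exists_maximal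
    ⟨A, hA, Subset.rfl, h⟩
  refine ⟨D, hD.1.1, hD.1.2.1, hD.1.2.2, fun E hE hAE hBE => ?_⟩
  rcases hF.subset_or_subset hD.1.1 hE (hF.nonempty A hA) hD.1.2.1 hAE with h1 | h1
  · exact hD.2 ⟨hE, hAE, hBE⟩ h1
  · exact h1

/-- Two disjoint nodes lie below two direct siblings. -/
theorem IsLaminar.exists_directSiblings (hF : IsLaminar F) (hA : A ∈ F) (hB : B ∈ F)
    (h : Disjoint A B) : ∃ D E, DirectSiblings F D E ∧ A ⊆ D ∧ B ⊆ E := by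
  have nAB : ¬ A ⊆ B := fun hs => (hF.nonempty A hA).ne_empty
    (disjoint_self.1 (h.mono_right hs))
  have nBA : ¬ B ⊆ A := fun hs => (hF.nonempty B hB).ne_empty
    (disjoint_self.1 (h.mono_left hs))
  -- The strict ancestors of the largest node containing `A` but not `B` are the nodes containing
  -- both, a description symmetric in `A` and `B`. The two largest nodes are therefore siblings.
  have key : ∀ {A B : Set Ω}, A ∈ F → B ∈ F → ¬ B ⊆ A → ∃ D ∈ F, A ⊆ D ∧ ¬ B ⊆ D ∧
      ancestors F D = {E ∈ F | A ⊆ E ∧ B ⊆ E} := by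
    intro A B hA hB nBA
    obtain ⟨D, hD, hAD, hBD, hmax⟩ := hF.exists_largest hA nBA
    refine ⟨D, hD, hAD, hBD, ?_⟩
    ext E
    simp only [mem_ancestors, mem_ofPred_eq]
    refine and_congr_right fun hE => ⟨fun hDE => ⟨hAD.trans hDE.subset, ?_⟩, fun hE' => ?_⟩
    · by_contra hBE
      exact hDE.not_subset (hmax E hE (hAD.trans hDE.subset) hBE)
    · rcases hF.subset_or_subset hD hE (hF.nonempty A hA) hAD hE'.1 with h1 | h1
      · exact h1.ssubset_of_ne fun h2 => hBD (h2 ▸ hE'.2)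
      · exact absurd (hE'.2.trans h1) hBD
  obtain ⟨D, hD, hAD, hBD, hDa⟩ := key hA hB nBA
  obtain ⟨E, hE, hBE, hAE, hEa⟩ := key hB hA nAB
  refine ⟨D, E, ⟨hD, hE, fun hDE => hAE (hDE ▸ hAD), ?_⟩, hAD, hBE⟩
  rw [hDa, hEa]
  ext; simp only [mem_ofPred_eq]; tauto

theorem IsRoot.mem_struct (h : IsRoot F A) : A ∈ struct F := ⟨h.1, Or.inl h⟩

theorem isRoot_iff : IsRoot F A ↔ A ∈ F ∧ ancestors F A = ∅ := by
  simp only [IsRoot, eq_empty_iff_forall_notMem, mem_ancestors, not_exists]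

theorem IsRoot.directSiblings (hA : IsRoot F A) (hB : IsRoot F B) (h : A ≠ B) :
    DirectSiblings F A B :=
  ⟨hA.1, hB.1, h, by rw [(isRoot_iff.1 hA).2, (isRoot_iff.1 hB).2]⟩

theorem IsLaminar.exists_root (hF : IsLaminar F) (hA : A ∈ F) : ∃ B, IsRoot F B ∧ A ⊆ B := by
  obtain ⟨D, hAD, hD⟩ := hF.finite.exists_le_maximal hA
  exact ⟨D, ⟨hD.1, fun ⟨E, hE, hDE⟩ => hDE.not_subset (hD.2 hE hDE.subset)⟩, hAD⟩

theorem mem_struct_iff : A ∈ struct F ↔ IsRoot F A ∨ A ∈ lower F := by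
  constructor
  · rintro ⟨hA, h | h⟩
    · exact Or.inl h
    · exact Or.inr ⟨hA, h⟩
  · rintro (h | h)
    · exact h.mem_struct
    · exact lower_subset_struct h

theorem DirectSiblings.of_subset (h : DirectSiblings F A B) (hs : F' ⊆ F) (hA : A ∈ F')
    (hB : B ∈ F') : DirectSiblings F' A B := by
  refine ⟨hA, hB, h.2.2.1, ?_⟩
  ext E
  simp only [mem_ancestors]
  exact and_congr_right fun hE => ⟨fun hAE => h.ssubset_of_ssubset (hs hE) hAE,
    fun hBE => h.symm.ssubset_of_ssubset (hs hE) hBE⟩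

/-- Dropping nodes could only create siblings. But siblings of the structure are disjoint, so they
lie below siblings of `F`; these belong to the structure too, and a strict inclusion would place
both nodes below one of them. -/
theorem directSiblings_struct_iff (hF : IsLaminar F) :
    DirectSiblings (struct F) A B ↔ DirectSiblings F A B := by
  constructor
  · intro h
    obtain ⟨D, E, hDE, hAD, hBE⟩ := hF.exists_directSiblings h.1.1 h.2.1.1 (h.disjoint hF.struct)
    have hdis := hDE.disjoint hF
    have aux : ∀ {A B D E : Set Ω}, DirectSiblings (Clustering.struct F) A B →
        DirectSiblings F D E → A ⊆ D → B ⊆ E → Disjoint D E → A = D := by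
      intro A B D E h hDE hAD hBE hdis
      by_contra hne
      have := h.ssubset_of_ssubset (lower_subset_struct hDE.mem_lower)
        (hAD.ssubset_of_ne hne)
      exact (hF.nonempty B h.2.1.1).ne_empty
        (disjoint_self.1 (hdis.mono this.subset hBE))
    rw [aux h hDE hAD hBE hdis, aux h.symm hDE.symm hBE hAD hdis.symm]
    exact hDE
  · intro h
    exact h.of_subset struct_subset (lower_subset_struct h.mem_lower)
      (lower_subset_struct h.symm.mem_lower)

theorem lower_struct (hF : IsLaminar F) : lower (struct F) = lower F := by
  ext A
  constructor
  · rintro ⟨hA, B, hB⟩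
    exact ((directSiblings_struct_iff hF).1 hB).mem_lower
  · rintro ⟨hA, B, hB⟩
    exact ((directSiblings_struct_iff hF).2 hB).mem_lower

theorem isRoot_struct_iff (hF : IsLaminar F) : IsRoot (struct F) A ↔ IsRoot F A := by
  constructor
  · intro h
    obtain ⟨B, hB, hAB⟩ := hF.exists_root h.1.1
    rcases hAB.eq_or_ssubset with h1 | h1
    · exact h1 ▸ hB
    · exact absurd ⟨B, hB.mem_struct, h1⟩ h.2
  · intro h
    exact ⟨h.mem_struct, fun ⟨B, hB, hAB⟩ => h.2 ⟨B, hB.1, hAB⟩⟩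

theorem struct_struct (hF : IsLaminar F) : struct (struct F) = struct F := by
  ext A
  rw [mem_struct_iff, mem_struct_iff, lower_struct hF, isRoot_struct_iff hF]

theorem lower_lower : lower (lower F) = lower F := by
  refine lower_subset.antisymm ?_
  rintro A ⟨hA, B, hB⟩
  exact (hB.of_subset lower_subset hB.mem_lower hB.symm.mem_lower).mem_lower

/-! ### Adding a root -/

theorem ancestors_insert (hF : ∀ B ∈ F, B ⊆ A) (hB : B ∈ F) (hBA : B ≠ A) :
    ancestors (insert A F) B = insert A (ancestors F B) := by
  ext E
  simp only [mem_ancestors, mem_insert_iff]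
  constructor
  · rintro ⟨h | h, h'⟩
    · exact Or.inl h
    · exact Or.inr ⟨h, h'⟩
  · rintro (h | h)
    · exact ⟨Or.inl h, h ▸ (hF B hB).ssubset_of_ne hBA⟩
    · exact ⟨Or.inr h.1, h.2⟩

theorem isRoot_insert (hF : ∀ B ∈ F, B ⊆ A) : IsRoot (insert A F) A := by
  refine ⟨mem_insert _ _, ?_⟩
  rintro ⟨B, hB | hB, h⟩
  · exact h.ne hB.symm
  · exact h.not_subset (hF B hB)

theorem notMem_lower (hF : ∀ B ∈ F, B ⊆ A) : A ∉ lower F := by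
  rintro ⟨hA, B, hB⟩
  exact hB.symm.not_subset (hF B hB.2.1)

theorem directSiblings_insert_iff (hF : ∀ B ∈ F, B ⊆ A) {B C : Set Ω} :
    DirectSiblings (insert A F) B C ↔ DirectSiblings F B C := by
  have hsub : ∀ B ∈ insert A F, B ⊆ A := by
    rintro B (rfl | hB)
    · exact Subset.rfl
    · exact hF B hB
  constructor
  · intro h
    have hBA : B ≠ A := by
      rintro rfl
      exact notMem_lower hsub h.mem_lower
    have hCA : C ≠ A := by
      rintro rfl
      exact notMem_lower hsub h.symm.mem_lower
    exact h.of_subset (subset_insert _ _) (mem_of_mem_insert_of_ne h.1 hBA)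
      (mem_of_mem_insert_of_ne h.2.1 hCA)
  · intro h
    have hBA : B ≠ A := by
      rintro rfl
      exact notMem_lower hF h.mem_lower
    have hCA : C ≠ A := by
      rintro rfl
      exact notMem_lower hF h.symm.mem_lower
    refine ⟨Or.inr h.1, Or.inr h.2.1, h.2.2.1, ?_⟩
    rw [ancestors_insert hF h.1 hBA, ancestors_insert hF h.2.1 hCA, h.2.2.2]

theorem lower_insert (hF : ∀ B ∈ F, B ⊆ A) : lower (insert A F) = lower F := by
  ext B
  constructor
  · rintro ⟨-, C, h⟩
    exact ((directSiblings_insert_iff hF).1 h).mem_lower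
  · rintro ⟨-, C, h⟩
    exact ((directSiblings_insert_iff hF).2 h).mem_lower

/-- Under a new common root, a single former root loses its status and drops out, while several
former roots are siblings and stay. So `lower F` is exactly what remains visible below `A`. -/
theorem struct_insert (hF : ∀ B ∈ F, B ⊆ A) : struct (insert A F) = insert A (lower F) := by
  ext B
  rw [mem_struct_iff, lower_insert hF, mem_insert_iff]
  refine or_congr_left' fun _ => ⟨fun h => ?_, fun h => by rw [h]; exact isRoot_insert hF⟩
  rcases h.1 with h1 | h1
  · exact h1
  · by_contra hne
    exact h.2 ⟨A, mem_insert _ _, (hF B h1).ssubset_of_ne hne⟩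

/-! ### Isomorphisms -/

theorem IsForestIso.ssubset_iff (h : IsForestIso ζ F F') (hA : A ∈ F) (hB : B ∈ F) :
    ζ A ⊂ ζ B ↔ A ⊂ B := by
  rw [ssubset_iff_subset_not_subset, ssubset_iff_subset_not_subset, ← h.2 A hA B hB,
    ← h.2 B hB A hA]

theorem IsForestIso.directSiblings (h : IsForestIso ζ F F') (hs : DirectSiblings F A B) :
    DirectSiblings F' (ζ A) (ζ B) := by
  refine ⟨h.1.mapsTo hs.1, h.1.mapsTo hs.2.1, fun he => hs.2.2.1 (h.1.injOn hs.1 hs.2.1 he), ?_⟩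
  ext E
  simp only [mem_ancestors]
  refine and_congr_right fun hE => ?_
  obtain ⟨C, hC, rfl⟩ := h.1.surjOn hE
  rw [h.ssubset_iff hs.1 hC, h.ssubset_iff hs.2.1 hC]
  exact ⟨hs.ssubset_of_ssubset hC, hs.symm.ssubset_of_ssubset hC⟩

theorem IsForestIso.isRoot (h : IsForestIso ζ F F') (hA : IsRoot F A) : IsRoot F' (ζ A) := by
  refine ⟨h.1.mapsTo hA.1, ?_⟩
  rintro ⟨E, hE, hAE⟩
  obtain ⟨C, hC, rfl⟩ := h.1.surjOn hE
  exact hA.2 ⟨C, hC, (h.ssubset_iff hA.1 hC).1 hAE⟩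

theorem IsForestIso.comp (h : IsForestIso ζ F F') (h' : IsForestIso ξ F' F'') :
    IsForestIso (ξ ∘ ζ) F F'' :=
  ⟨h'.1.comp h.1, fun A hA B hB => (h.2 A hA B hB).trans
    (h'.2 _ (h.1.mapsTo hA) _ (h.1.mapsTo hB))⟩

theorem IsForestIso.exists_inverse (h : IsForestIso ζ F F') :
    ∃ ξ, IsForestIso ξ F' F ∧ (∀ A ∈ F', ζ (ξ A) = A) ∧ ∀ A ∈ F, ξ (ζ A) = A := by
  classical
  have hinv : InvOn (Function.invFunOn ζ F) ζ F F' := h.1.invOn_invFunOn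
  have hb : BijOn (Function.invFunOn ζ F) F' F := h.1.symm hinv.symm
  refine ⟨Function.invFunOn ζ F, ⟨hb, fun A hA B hB => ?_⟩, hinv.2, hinv.1⟩
  rw [h.2 _ (hb.mapsTo hA) _ (hb.mapsTo hB), hinv.2 hA, hinv.2 hB]

theorem IsForestIso.bijOn_lower (h : IsForestIso ζ F F') : BijOn ζ (lower F) (lower F') := by
  refine ⟨fun A hA => ?_, h.1.injOn.mono lower_subset, ?_⟩
  · obtain ⟨hA, B, hB⟩ := hA
    exact (h.directSiblings hB).mem_lower
  · rintro A ⟨hA, B, hB⟩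
    obtain ⟨ξ, hξ, h1, h2⟩ := h.exists_inverse
    exact ⟨ξ A, (hξ.directSiblings hB).mem_lower, h1 A hA⟩

theorem IsForestIso.struct_eq (h : IsForestIso ζ F F') (hF : struct F = F) : struct F' = F' := by
  refine struct_subset.antisymm fun A hA => ?_
  obtain ⟨C, hC, rfl⟩ := h.1.surjOn hA
  rw [← hF, mem_struct_iff] at hC
  rcases hC with hC | hC
  · exact (h.isRoot hC).mem_struct
  · exact lower_subset_struct (h.bijOn_lower.mapsTo hC)

theorem IsFRM.comp (h : IsFRM ζ F F') (h' : IsFRM ξ F' F'') : IsFRM (ξ ∘ ζ) F F'' :=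
  ⟨h.1.comp h'.1, fun A hA => (h.2 A hA).trans (h'.2 _ (h.1.1.mapsTo hA))⟩

theorem IsFRM.id (F : Set (Set Ω)) : IsFRM id F F :=
  ⟨⟨bijOn_id F, fun _ _ _ _ => Iff.rfl⟩, fun _ _ => Subset.rfl⟩

/-- A forest relating map is unique. -/
theorem IsFRM.eqOn (hF : IsLaminar F) (hF' : IsLaminar F') (h : IsFRM ζ F F')
    (h' : IsFRM ξ F F') : EqOn ζ ξ F := by
  -- The number of nodes below an image is determined by its preimage. Two images of one node both
  -- contain it, so they are nested, and a strict inclusion would change this number.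
  have card : ∀ {ζ}, IsFRM ζ F F' → ∀ A ∈ F,
      {D ∈ F' | D ⊆ ζ A}.ncard = {D ∈ F | D ⊆ A}.ncard := by
    intro ζ h A hA
    have : {D ∈ F' | D ⊆ ζ A} = ζ '' {D ∈ F | D ⊆ A} := by
      ext E
      constructor
      · rintro ⟨hE, hEA⟩
        obtain ⟨C, hC, rfl⟩ := h.1.1.surjOn hE
        exact ⟨C, ⟨hC, (h.1.2 C hC A hA).2 hEA⟩, rfl⟩
      · rintro ⟨C, ⟨hC, hCA⟩, rfl⟩
        exact ⟨h.1.1.mapsTo hC, (h.1.2 C hC A hA).1 hCA⟩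
    rw [this, InjOn.ncard_image (h.1.1.injOn.mono (sep_subset _ _))]
  have key : ∀ {ζ ξ}, IsFRM ζ F F' → IsFRM ξ F F' → ∀ A ∈ F, ζ A ⊆ ξ A → ζ A = ξ A := by
    intro ζ ξ h h' A hA hs
    by_contra hne
    have hlt : {D ∈ F' | D ⊆ ζ A} ⊂ {D ∈ F' | D ⊆ ξ A} := by
      refine ⟨fun D hD => ⟨hD.1, hD.2.trans hs⟩, fun hsub => ?_⟩
      exact hne (hs.antisymm (hsub ⟨h'.1.1.mapsTo hA, Subset.rfl⟩).2)
    have := ncard_lt_ncard hlt (hF'.finite.subset (sep_subset _ _))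
    rw [card h A hA, card h' A hA] at this
    exact this.ne rfl
  intro A hA
  rcases hF'.subset_or_subset (h.1.1.mapsTo hA) (h'.1.1.mapsTo hA) (hF.nonempty A hA)
    (h.2 A hA) (h'.2 A hA) with h1 | h1
  · exact key h h' A hA h1
  · exact (key h' h A hA h1).symm

/-- Limits of isomonotone sequences are computed by any sequence of forest relating maps. -/
theorem limForest_eq {F : ℕ → Set (Set Ω)} (hF : ∀ n, IsLaminar (F n)) {Z : ℕ → Set Ω → Set Ω}
    (hZ : ∀ n, IsFRM (Z n) (struct (F 0)) (struct (F n))) :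
    limForest F = (fun A => ⋃ n, Z n A) '' struct (F 0) := by
  ext B
  constructor
  · rintro ⟨ζ, hζ, A, hA, rfl⟩
    exact ⟨A, hA, iUnion_congr fun n => (hZ n).eqOn (hF 0).struct (hF n).struct (hζ n) hA⟩
  · rintro ⟨A, hA, rfl⟩
    exact ⟨Z, hZ, A, hA, rfl⟩

/-- Compatible forest relating maps along an isomonotone sequence. -/
theorem exists_chain {F : ℕ → Set (Set Ω)}
    (h : ∀ n, ForestLE (struct (F n)) (struct (F (n + 1)))) :
    ∃ Z : ℕ → Set Ω → Set Ω, (∀ n, IsFRM (Z n) (struct (F 0)) (struct (F n))) ∧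
      (∀ A, Z 0 A = A) ∧ ∀ A ∈ struct (F 0), Monotone fun n => Z n A := by
  choose ξ hξ using h
  let Z : ℕ → Set Ω → Set Ω := fun n => Nat.rec id (fun n z => ξ n ∘ z) n
  have hZ : ∀ n, IsFRM (Z n) (struct (F 0)) (struct (F n)) := by
    intro n
    induction n with
    | zero => exact IsFRM.id _
    | succ n ih => exact ih.comp (hξ n)
  exact ⟨Z, hZ, fun A => rfl, fun A hA => monotone_nat_of_le_succ fun n =>
    (hξ n).2 _ ((hZ n).1.1.mapsTo hA)⟩

open Classical in
/-- A forest relating map extends to forests with an added common root. -/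
theorem IsFRM.insert (hF : IsLaminar F) (hF' : IsLaminar F') (h : IsFRM ζ (struct F) (struct F'))
    (hA : ∀ B ∈ F, B ⊆ A) (hA' : ∀ B ∈ F', B ⊆ A) :
    IsFRM (fun X => if X = A then A else ζ X) (struct (insert A F)) (struct (insert A F')) := by
  rw [struct_insert hA, struct_insert hA']
  have hb : BijOn ζ (lower F) (lower F') := by
    simpa only [lower_struct hF, lower_struct hF'] using h.1.bijOn_lower
  have hne : ∀ B ∈ lower F, B ≠ A := fun B hB he => notMem_lower hA (he ▸ hB)
  have hne' : ∀ B ∈ lower F, ζ B ≠ A := fun B hB he => notMem_lower hA' (he ▸ hb.mapsTo hB)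
  have e1 : ∀ B ∈ lower F, (if B = A then A else ζ B) = ζ B := fun B hB => if_neg (hne B hB)
  have hsub : ∀ B ∈ lower F, B ⊆ A := fun B hB => hA B hB.1
  have hsub' : ∀ B ∈ lower F, ζ B ⊆ A := fun B hB => hA' _ (hb.mapsTo hB).1
  refine ⟨⟨⟨?_, ?_, ?_⟩, ?_⟩, ?_⟩
  · rintro B (rfl | hB)
    · simp
    · simp only [e1 B hB]
      exact Or.inr (hb.mapsTo hB)
  · rintro B (rfl | hB) C (rfl | hC) he
    · rfl
    · simp only [if_true, e1 C hC] at he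
      exact absurd he.symm (hne' C hC)
    · simp only [if_true, e1 B hB] at he
      exact absurd he (hne' B hB)
    · simp only [e1 B hB, e1 C hC] at he
      exact hb.injOn hB hC he
  · rintro B (rfl | hB)
    · exact ⟨B, mem_insert _ _, by simp⟩
    · obtain ⟨C, hC, rfl⟩ := hb.surjOn hB
      exact ⟨C, Or.inr hC, e1 C hC⟩
  · rintro B (rfl | hB) C (rfl | hC)
    · simp
    · simp only [if_true, e1 C hC]
      exact ⟨fun h => absurd ((hsub C hC).antisymm h) (hne C hC),
        fun h => absurd ((hsub' C hC).antisymm h) (hne' C hC)⟩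
    · simp only [if_true, e1 B hB]
      exact ⟨fun _ => hsub' B hB, fun _ => hsub B hB⟩
    · simp only [e1 B hB, e1 C hC]
      exact h.1.2 B (lower_subset_struct hB) C (lower_subset_struct hC)
  · rintro B (rfl | hB)
    · simp
    · simp only [e1 B hB]
      exact h.2 B (lower_subset_struct hB)

end Combinatorics

/-! ### Clustering bases, simple measures and their levels. -/

section Measures

variable {Ω : Type*} [TopologicalSpace Ω] [MeasurableSpace Ω]
  {𝒜 : Set (Set Ω)} {Q : Set Ω → Measure Ω} {perp : Set Ω → Set Ω → Prop}
  {F : Set (Set Ω)} {α : Set Ω → ℝ≥0} {P R a b : Measure Ω} {A B C D E : Set Ω}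

theorem support_nnreal_smul {t : ℝ≥0} (ht : 0 < t) (μ : Measure Ω) :
    (t • μ).support = μ.support := by
  refine Subset.antisymm ?_ ?_
  · refine Measure.AbsolutelyContinuous.support_mono ?_
    intro s hs
    simp [hs]
  · refine Measure.AbsolutelyContinuous.support_mono ?_
    intro s hs
    have : (t : ℝ≥0∞) * μ s = 0 := by simpa using hs
    rcases mul_eq_zero.1 this with h | h
    · exact absurd h (by simpa using ht.ne')
    · exact h

theorem absolutelyContinuous_of_nnreal_smul_le {t : ℝ≥0} (ht : 0 < t) {μ ν : Measure Ω}
    (h : t • μ ≤ ν) : μ ≪ ν := by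
  intro s hs
  have h1 : (t • μ) s = 0 := le_antisymm ((h s).trans hs.le) zero_le
  have : (t : ℝ≥0∞) * μ s = 0 := by simpa using h1
  rcases mul_eq_zero.1 this with h | h
  · exact absurd h (by simpa using ht.ne')
  · exact h

variable [OpensMeasurableSpace Ω]

theorem IsSeparation.measurableSet (h : IsSeparation 𝒜 perp) (hA : A ∈ 𝒜) : MeasurableSet A :=
  (h.isClosed A hA).measurableSet

theorem IsSeparation.disjoint (h : IsSeparation 𝒜 perp) (hA : MeasurableSet A)
    (hB : MeasurableSet B) (hp : perp A B) : Disjoint A B := by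
  have hAB := hA.inter hB
  have h1 : perp (A ∩ B) B := h.monotonicity _ _ _ hAB hA hB inter_subset_left hp
  have h2 : perp (A ∩ B) (A ∩ B) := h.monotonicity _ _ _ hAB hB hAB inter_subset_right
    (h.symm _ _ hAB hB h1)
  rw [disjoint_iff_inter_eq_empty]
  exact h.reflexivity _ hAB h2

theorem IsSeparation.perp_mono (h : IsSeparation 𝒜 perp) (hA : MeasurableSet A)
    (hB : MeasurableSet B) (hC : MeasurableSet C) (hD : MeasurableSet D) (hAC : A ⊆ C)
    (hBD : B ⊆ D) (hp : perp C D) : perp A B := by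
  have h1 : perp A D := h.monotonicity _ _ _ hA hC hD hAC hp
  exact h.symm _ _ hB hA (h.monotonicity _ _ _ hB hD hA hBD (h.symm _ _ hA hD h1))

theorem IsSeparation.isLaminar (h : IsSeparation 𝒜 perp) {𝒞 : Set (Set Ω)}
    (hC : 𝒞 ⊆ nonemptyMeas Ω) (hF : IsForest perp 𝒞 F) : IsLaminar F :=
  ⟨hF.finite, fun _ hA => (hC (hF.subset hA)).2, fun _ hA _ hB =>
    (hF.forest _ hA _ hB).imp_left (h.disjoint (hC (hF.subset hA)).1 (hC (hF.subset hB)).1)⟩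

theorem IsSeparation.subset_nonemptyMeas (h : IsSeparation 𝒜 perp) : 𝒜 ⊆ nonemptyMeas Ω :=
  fun A hA => ⟨h.measurableSet hA, h.nonempty A hA⟩

theorem IsSeparation.monotoneClosure_subset (h : IsSeparation 𝒜 perp) :
    monotoneClosure 𝒜 ⊆ nonemptyMeas Ω := by
  rintro B ⟨A, hA, -, rfl⟩
  exact ⟨MeasurableSet.iUnion fun n => h.measurableSet (hA n),
    (h.nonempty _ (hA 0)).mono (subset_iUnion A 0)⟩

theorem subset_monotoneClosure : 𝒜 ⊆ monotoneClosure 𝒜 := fun A hA =>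
  ⟨fun _ => A, fun _ => hA, monotone_const, (iUnion_const A).symm⟩

namespace IsClusteringBase

theorem measurableSet (hb : IsClusteringBase 𝒜 Q perp) (hA : A ∈ 𝒜) : MeasurableSet A :=
  hb.separation.measurableSet hA

theorem apply_compl (hb : IsClusteringBase 𝒜 Q perp) (hA : A ∈ 𝒜) : Q A Aᶜ = 0 := by
  have := (hb.mem_finMeasures A hA).2.2
  have h := Measure.measure_compl_support_of_innerRegular (μ := Q A)
  rwa [hb.fitted A hA] at h

theorem apply_self (hb : IsClusteringBase 𝒜 Q perp) (hA : A ∈ 𝒜) : Q A A = 1 := by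
  have := hb.prob A hA
  exact (prob_compl_eq_zero_iff (hb.measurableSet hA)).1 (hb.apply_compl hA)

theorem apply_le_one (hb : IsClusteringBase 𝒜 Q perp) (hA : A ∈ 𝒜) (B : Set Ω) :
    Q A B ≤ 1 := by
  have := hb.prob A hA
  exact prob_le_one

theorem apply_inter_self (hb : IsClusteringBase 𝒜 Q perp) (hA : A ∈ 𝒜) (B : Set Ω) :
    Q A (B ∩ A) = Q A B := by
  refine measure_congr ?_
  have : ∀ᵐ x ∂(Q A), x ∈ A := by
    rw [ae_iff]; exact hb.apply_compl hA
  filter_upwards [this] with x hx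
  exact propext ⟨fun h => h.1, fun h => ⟨h, hx⟩⟩

/-- Flatness without its case distinction: if `Q E A = 0`, both sides vanish. -/
theorem restrict_eq (hb : IsClusteringBase 𝒜 Q perp) (hA : A ∈ 𝒜) (hE : E ∈ 𝒜) (h : A ⊆ E) :
    (Q E).restrict A = Q E A • Q A := by
  rcases hb.flat A hA E hE h with h0 | h0
  · rw [h0, zero_smul, Measure.restrict_eq_zero, h0]
  · by_cases h1 : Q E A = 0
    · rw [h1, zero_smul, Measure.restrict_eq_zero, h1]
    · have h2 : Q E A ≠ ∞ := ((hb.apply_le_one hE A).trans_lt ENNReal.one_lt_top).ne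
      rw [h0, smul_smul, ENNReal.mul_inv_cancel h1 h2, one_smul]

theorem apply_inter (hb : IsClusteringBase 𝒜 Q perp) (hA : A ∈ 𝒜) (hE : E ∈ 𝒜) (h : A ⊆ E)
    (B : Set Ω) : Q E (B ∩ A) = Q E A * Q A B := by
  have := congrArg (fun μ : Measure Ω => μ B) (hb.restrict_eq hA hE h)
  rwa [Measure.restrict_apply' (hb.measurableSet hA)] at this

theorem support_base (hb : IsClusteringBase 𝒜 Q perp) (ha : IsBaseMeasureOn 𝒜 Q a A) :
    a.support = A := by
  obtain ⟨hA, t, ht, rfl⟩ := ha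
  rw [support_nnreal_smul ht, hb.fitted A hA]

theorem subset_support (hb : IsClusteringBase 𝒜 Q perp) (hA : A ∈ 𝒜) (h : Q A ≪ P) :
    A ⊆ P.support := by
  have := h.support_mono
  rwa [hb.fitted A hA] at this

theorem base_subset_support (hb : IsClusteringBase 𝒜 Q perp) (ha : IsBaseMeasureOn 𝒜 Q a A)
    (h : a ≤ P) : A ⊆ P.support := by
  rw [← hb.support_base ha]
  exact Measure.support_mono h

theorem base_subset_of_le (hb : IsClusteringBase 𝒜 Q perp) (ha : IsBaseMeasureOn 𝒜 Q a A)
    (hb' : IsBaseMeasureOn 𝒜 Q b B) (h : a ≤ b) : A ⊆ B := by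
  rw [← hb.support_base hb']
  exact hb.base_subset_support ha h

theorem isLaminar (hb : IsClusteringBase 𝒜 Q perp) (hF : IsForest perp 𝒜 F) : IsLaminar F :=
  hb.separation.isLaminar hb.separation.subset_nonemptyMeas hF

end IsClusteringBase

/-- Comparison of base measures on nested base sets. -/
theorem nnreal_smul_le_of_subset {s c : ℝ≥0} (hb : IsClusteringBase 𝒜 Q perp) (hA : A ∈ 𝒜)
    (hE : E ∈ 𝒜) (h : A ⊆ E) (hs : (s : ℝ≥0∞) ≤ c * Q E A) : s • Q A ≤ c • Q E := by
  refine Measure.le_iff.2 fun B _ => ?_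
  simp only [Measure.smul_apply, ENNReal.smul_def, smul_eq_mul]
  calc (s : ℝ≥0∞) * Q A B ≤ c * Q E A * Q A B := by gcongr
    _ = c * Q E (B ∩ A) := by rw [hb.apply_inter hA hE h, mul_assoc]
    _ ≤ c * Q E B := by gcongr; exact inter_subset_left

/-! ### Simple measures and their levels -/

theorem Represents.apply (h : Represents 𝒜 Q perp F α R) (B : Set Ω) :
    R B = ∑ A ∈ h.1.finite.toFinset, (α A : ℝ≥0∞) * Q A B := by
  have he := h.2.2
  rw [finsum_mem_eq_finite_toFinset_sum _ h.1.finite] at he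
  conv_lhs => rw [he]
  rw [Measure.finsetSum_apply]
  simp only [Measure.smul_apply, ENNReal.smul_def, smul_eq_mul]

open Classical in
theorem Represents.level_apply (hb : IsClusteringBase 𝒜 Q perp) (h : Represents 𝒜 Q perp F α R)
    (hA : A ∈ F) (B : Set Ω) : level Q F α A B =
      ∑ E ∈ h.1.finite.toFinset, if A ⊆ E then (α E : ℝ≥0∞) * Q E (B ∩ A) else 0 := by
  have hf : {E ∈ F | A ⊆ E}.Finite := h.1.finite.subset (sep_subset _ _)
  rw [level, finsum_mem_eq_finite_toFinset_sum _ hf, Measure.smul_apply, smul_eq_mul,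
    Finset.sum_mul, ← Finset.sum_filter]
  have : hf.toFinset = h.1.finite.toFinset.filter (A ⊆ ·) := by
    ext E; simp
  rw [this]
  refine Finset.sum_congr rfl fun E hE => ?_
  simp only [Finset.mem_filter, Finite.mem_toFinset] at hE
  rw [hb.apply_inter (h.1.subset hA) (h.1.subset hE.1) hE.2, mul_assoc]

theorem Represents.level_le (hb : IsClusteringBase 𝒜 Q perp) (h : Represents 𝒜 Q perp F α R)
    (hA : A ∈ F) : level Q F α A ≤ R := by
  refine Measure.le_iff.2 fun B _ => ?_
  rw [h.level_apply hb hA, h.apply]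
  refine Finset.sum_le_sum fun E _ => ?_
  split_ifs
  · gcongr; exact inter_subset_left
  · exact zero_le

theorem Represents.exists_level_eq (hb : IsClusteringBase 𝒜 Q perp)
    (h : Represents 𝒜 Q perp F α R) (hA : A ∈ F) :
    ∃ l : ℝ≥0, 0 < l ∧ (l : ℝ≥0∞) = ∑ᶠ E ∈ {E ∈ F | A ⊆ E}, (α E : ℝ≥0∞) * Q E A ∧
      level Q F α A = l • Q A := by
  have hf : {E ∈ F | A ⊆ E}.Finite := h.1.finite.subset (sep_subset _ _)
  have hfin : ∑ᶠ E ∈ {E ∈ F | A ⊆ E}, (α E : ℝ≥0∞) * Q E A ≠ ∞ := by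
    rw [finsum_mem_eq_finite_toFinset_sum _ hf]
    refine (ENNReal.sum_lt_top.2 fun E hE => ?_).ne
    have hE : E ∈ F ∧ A ⊆ E := by simpa using hE
    exact ENNReal.mul_lt_top ENNReal.coe_lt_top
      ((hb.apply_le_one (h.1.subset hE.1) A).trans_lt ENNReal.one_lt_top)
  refine ⟨(∑ᶠ E ∈ {E ∈ F | A ⊆ E}, (α E : ℝ≥0∞) * Q E A).toNNReal, ?_,
    ENNReal.coe_toNNReal hfin, ?_⟩
  · refine ENNReal.toNNReal_pos ?_ hfin
    rw [finsum_mem_eq_finite_toFinset_sum _ hf]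
    intro h0
    rw [Finset.sum_eq_zero_iff] at h0
    have := h0 A (by simpa using hA)
    rw [hb.apply_self (h.1.subset hA), mul_one] at this
    exact (h.2.1 A hA).ne' (by simpa using this)
  · rw [level, ← ENNReal.coe_toNNReal hfin]
    rfl

theorem Represents.level_isBaseMeasureOn (hb : IsClusteringBase 𝒜 Q perp)
    (h : Represents 𝒜 Q perp F α R) (hA : A ∈ F) :
    IsBaseMeasureOn 𝒜 Q (level Q F α A) A := by
  obtain ⟨l, hl, -, he⟩ := h.exists_level_eq hb hA
  exact ⟨h.1.subset hA, l, hl, he⟩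

/-- The part of a node that belongs to no smaller node. -/
def core (F : Set (Set Ω)) (D : Set Ω) : Set Ω := D \ ⋃₀ {E ∈ F | E ⊂ D}

theorem Represents.measurableSet_core (hb : IsClusteringBase 𝒜 Q perp)
    (h : Represents 𝒜 Q perp F α R) (hD : D ∈ F) : MeasurableSet (core F D) := by
  refine (hb.measurableSet (h.1.subset hD)).diff ?_
  exact MeasurableSet.sUnion (h.1.finite.subset (sep_subset _ _)).countable
    fun E hE => hb.measurableSet (h.1.subset hE.1)

/-- Nodes that do not contain `D` are disjoint from it or strictly inside it, so they miss its core.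
Only the terms that make up the level remain, which reduces estimates of simple measures to base
measures. -/
theorem Represents.apply_core (hb : IsClusteringBase 𝒜 Q perp)
    (h : Represents 𝒜 Q perp F α R) (hD : D ∈ F) (hB : B ⊆ core F D) :
    R B = level Q F α D B := by
  rw [h.level_apply hb hD, h.apply]
  refine Finset.sum_congr rfl fun E hE => ?_
  have hE : E ∈ F := by simpa using hE
  split_ifs with hDE
  · rw [inter_eq_left.2 (hB.trans sdiff_subset)]
  · have hdis : B ∩ E = ∅ := by
      rcases (hb.isLaminar h.1).nested D hD E hE with h1 | h1 | h1
      · exact disjoint_iff_inter_eq_empty.1 (h1.mono_left (hB.trans sdiff_subset))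
      · exact absurd h1 hDE
      · ext x
        simp only [mem_inter_iff, mem_empty_iff_false, iff_false, not_and]
        intro hx hxE
        exact (hB hx).2 ⟨E, ⟨hE, h1.ssubset_of_not_subset hDE⟩, hxE⟩
    rw [← hb.apply_inter_self (h.1.subset hE), hdis, measure_empty, mul_zero]

/-- A bound on all nodes gives a bound for a simple measure. -/
theorem Represents.apply_le (hb : IsClusteringBase 𝒜 Q perp) (h : Represents 𝒜 Q perp F α R)
    (hB : MeasurableSet B) (μ : Measure Ω)
    (hle : ∀ D ∈ F, ∀ C, MeasurableSet C → C ⊆ B ∩ core F D → R C ≤ μ C) : R B ≤ μ B := by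
  have hlam := hb.isLaminar h.1
  have hdisj : PairwiseDisjoint (h.1.finite.toFinset : Set (Set Ω)) fun D => B ∩ core F D := by
    intro D hD E hE hne
    have hD : D ∈ F := by simpa using hD
    have hE : E ∈ F := by simpa using hE
    refine disjoint_left.2 ?_
    rintro x ⟨-, hxD⟩ ⟨-, hxE⟩
    rcases hlam.nested D hD E hE with h1 | h1 | h1
    · exact disjoint_left.1 h1 hxD.1 hxE.1
    · exact hxE.2 ⟨D, ⟨hD, h1.ssubset_of_ne hne⟩, hxD.1⟩
    · exact hxD.2 ⟨E, ⟨hE, h1.ssubset_of_ne hne.symm⟩, hxE.1⟩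
  have hmeas : ∀ D ∈ h.1.finite.toFinset, MeasurableSet (B ∩ core F D) := fun D hD =>
    hB.inter (h.measurableSet_core hb (by simpa using hD))
  -- Every point charged by `R` lies in some node, hence in the core of a minimal node containing
  -- it.
  have hcover : R B = R (⋃ D ∈ h.1.finite.toFinset, B ∩ core F D) := by
    refine le_antisymm ?_ (measure_mono (iUnion₂_subset fun D _ => inter_subset_left))
    refine (measure_le_inter_add_sdiff R B (⋃₀ F)).trans ?_
    have h0 : R (B \ ⋃₀ F) = 0 := by
      rw [h.apply, Finset.sum_eq_zero]
      intro E hE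
      have hE : E ∈ F := by simpa using hE
      rw [measure_mono_null _ (hb.apply_compl (h.1.subset hE)), mul_zero]
      exact fun x hx hxE => hx.2 ⟨E, hE, hxE⟩
    rw [h0, add_zero]
    refine measure_mono ?_
    rintro x ⟨hxB, E, hE, hxE⟩
    obtain ⟨D, hD⟩ := (h.1.finite.subset (sep_subset F (x ∈ ·))).exists_minimal ⟨E, hE, hxE⟩
    refine mem_iUnion₂.2 ⟨D, by simpa using hD.1.1, hxB, hD.1.2, ?_⟩
    rintro ⟨G, ⟨hG, hGD⟩, hxG⟩
    exact hGD.not_subset (hD.2 ⟨hG, hxG⟩ hGD.subset)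
  rw [hcover, measure_biUnion_finset hdisj hmeas]
  calc ∑ D ∈ h.1.finite.toFinset, R (B ∩ core F D)
      ≤ ∑ D ∈ h.1.finite.toFinset, μ (B ∩ core F D) :=
        Finset.sum_le_sum fun D hD => hle D (by simpa using hD) _ (hmeas D hD) Subset.rfl
    _ = μ (⋃ D ∈ h.1.finite.toFinset, B ∩ core F D) :=
        (measure_biUnion_finset hdisj hmeas).symm
    _ ≤ μ B := measure_mono (iUnion₂_subset fun D _ => inter_subset_left)

end Measures

/-! ### Limit forests and their rigidity modulo null sets. -/

section Limits

variable {Ω : Type*} [TopologicalSpace Ω] [MeasurableSpace Ω]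
  {𝒜 : Set (Set Ω)} {Q : Set Ω → Measure Ω} {perp : Set Ω → Set Ω → Prop}
  {P : Measure Ω} {A B : Set Ω}

/-- `B` is an increasing union of base sets whose base measures are absolutely continuous with
respect to `P`. -/
def IsLimitNode (𝒜 : Set (Set Ω)) (Q : Set Ω → Measure Ω) (P : Measure Ω) (B : Set Ω) : Prop :=
  ∃ A : ℕ → Set Ω, (∀ n, A n ∈ 𝒜) ∧ Monotone A ∧ B = ⋃ n, A n ∧ ∀ n, Q (A n) ≪ P

/-- A structured forest of limit nodes. -/
structure IsLimitForest (𝒜 : Set (Set Ω)) (Q : Set Ω → Measure Ω) (perp : Set Ω → Set Ω → Prop)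
    (P : Measure Ω) (F : Set (Set Ω)) : Prop where
  isForest : IsForest perp (monotoneClosure 𝒜) F
  struct_eq : struct F = F
  node : ∀ B ∈ F, IsLimitNode 𝒜 Q P B

/-- Every node of one forest agrees almost everywhere with a node of the other. -/
def AEMatch (P : Measure Ω) (F F' : Set (Set Ω)) : Prop :=
  (∀ B ∈ F, ∃ B' ∈ F', B =ᵐ[P] B') ∧ ∀ B' ∈ F', ∃ B ∈ F, B' =ᵐ[P] B

theorem AEMatch.symm {F F' : Set (Set Ω)} (h : AEMatch P F F') : AEMatch P F' F := ⟨h.2, h.1⟩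

theorem AEMatch.trans {F F' F'' : Set (Set Ω)} (h : AEMatch P F F') (h' : AEMatch P F' F'') :
    AEMatch P F F'' := by
  constructor
  · intro B hB
    obtain ⟨C, hC, hBC⟩ := h.1 B hB
    obtain ⟨D, hD, hCD⟩ := h'.1 C hC
    exact ⟨D, hD, hBC.trans hCD⟩
  · intro B hB
    obtain ⟨C, hC, hBC⟩ := h'.2 B hB
    obtain ⟨D, hD, hCD⟩ := h.2 C hC
    exact ⟨D, hD, hBC.trans hCD⟩

theorem AEMatch.refl (P : Measure Ω) (F : Set (Set Ω)) : AEMatch P F F :=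
  ⟨fun B hB => ⟨B, hB, .rfl⟩, fun B hB => ⟨B, hB, .rfl⟩⟩

theorem ForestEqAE.aeMatch {F F' : Set (Set Ω)} (h : ForestEqAE P F F') : AEMatch P F F' := by
  obtain ⟨ζ, hζ, h0⟩ := h
  refine ⟨fun B hB => ⟨ζ B, hζ.1.mapsTo hB, measure_symmDiff_eq_zero_iff.1 (h0 B hB)⟩, ?_⟩
  intro B' hB'
  obtain ⟨B, hB, rfl⟩ := hζ.1.surjOn hB'
  exact ⟨B, hB, (measure_symmDiff_eq_zero_iff.1 (h0 B hB)).symm⟩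

theorem ForestEqAE.symm {F F' : Set (Set Ω)} (h : ForestEqAE P F F') : ForestEqAE P F' F := by
  obtain ⟨ζ, hζ, h0⟩ := h
  obtain ⟨ξ, hξ, h1, -⟩ := hζ.exists_inverse
  refine ⟨ξ, hξ, fun A hA => ?_⟩
  have := h0 _ (hξ.1.mapsTo hA)
  rwa [h1 A hA, symmDiff_comm] at this

theorem ForestEqAE.trans {F F' F'' : Set (Set Ω)} (h : ForestEqAE P F F')
    (h' : ForestEqAE P F' F'') : ForestEqAE P F F'' := by
  obtain ⟨ζ, hζ, h0⟩ := h
  obtain ⟨ξ, hξ, h1⟩ := h'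
  refine ⟨ξ ∘ ζ, hζ.comp hξ, fun A hA => ?_⟩
  rw [measure_symmDiff_eq_zero_iff]
  exact (measure_symmDiff_eq_zero_iff.1 (h0 A hA)).trans
    (measure_symmDiff_eq_zero_iff.1 (h1 _ (hζ.1.mapsTo hA)))

theorem IsLimitNode.mem_monotoneClosure (h : IsLimitNode 𝒜 Q P B) : B ∈ monotoneClosure 𝒜 := by
  obtain ⟨A, hA, hm, rfl, -⟩ := h
  exact ⟨A, hA, hm, rfl⟩

theorem IsLimitNode.mono {P' : Measure Ω} (h : IsLimitNode 𝒜 Q P B) (hP : P ≪ P') :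
    IsLimitNode 𝒜 Q P' B := by
  obtain ⟨A, hA, hm, rfl, hac⟩ := h
  exact ⟨A, hA, hm, rfl, fun n => (hac n).trans hP⟩

variable [OpensMeasurableSpace Ω]

theorem IsLimitNode.measure_ne_zero (hb : IsClusteringBase 𝒜 Q perp)
    (h : IsLimitNode 𝒜 Q P B) : P B ≠ 0 := by
  obtain ⟨A, hA, hm, rfl, hac⟩ := h
  intro h0
  have := hac 0 (measure_mono_null (subset_iUnion A 0) h0)
  rw [hb.apply_self (hA 0)] at this
  exact one_ne_zero this

theorem IsLimitNode.subset_support (hb : IsClusteringBase 𝒜 Q perp)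
    (h : IsLimitNode 𝒜 Q P B) : B ⊆ P.support := by
  obtain ⟨A, hA, hm, rfl, hac⟩ := h
  exact iUnion_subset fun n => hb.subset_support (hA n) (hac n)

namespace IsLimitForest

variable {F F' : Set (Set Ω)}

theorem isLaminar (hb : IsClusteringBase 𝒜 Q perp) (h : IsLimitForest 𝒜 Q perp P F) :
    IsLaminar F :=
  hb.separation.isLaminar hb.separation.monotoneClosure_subset h.isForest

theorem subset_support (hb : IsClusteringBase 𝒜 Q perp) (h : IsLimitForest 𝒜 Q perp P F) :
    ∀ B ∈ F, B ⊆ P.support := fun B hB => (h.node B hB).subset_support hb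

/-- In a limit forest almost sure inclusion of nodes is inclusion. -/
theorem subset_of_ae_le (hb : IsClusteringBase 𝒜 Q perp) (h : IsLimitForest 𝒜 Q perp P F)
    (hA : A ∈ F) (hB : B ∈ F) (hAB : A ≤ᵐ[P] B) : A ⊆ B := by
  have hlam := h.isLaminar hb
  rw [ae_le_set] at hAB
  rcases hlam.nested A hA B hB with h1 | h1 | h1
  · rw [h1.sdiff_eq_left] at hAB
    exact absurd hAB ((h.node A hA).measure_ne_zero hb)
  · exact h1
  · rcases h1.eq_or_ssubset with h2 | h2
    · exact h2.ge
    · have hB' := hB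
      rw [← h.struct_eq, mem_struct_iff] at hB'
      rcases hB' with hB' | ⟨-, C, hC⟩
      · exact absurd ⟨A, hA, h2⟩ hB'.2
      -- As `B` is not a root, it has a sibling `C`. This sits in `A \ B` and has positive mass.
      · have h3 : C ⊆ A \ B := subset_sdiff.2
          ⟨(hC.ssubset_of_ssubset hA h2).subset, (hC.disjoint hlam).symm⟩
        exact absurd (measure_mono_null h3 hAB) ((h.node C hC.2.1).measure_ne_zero hb)

theorem eq_of_ae_eq (hb : IsClusteringBase 𝒜 Q perp) (h : IsLimitForest 𝒜 Q perp P F)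
    (hA : A ∈ F) (hB : B ∈ F) (hAB : A =ᵐ[P] B) : A = B :=
  (h.subset_of_ae_le hb hA hB hAB.le).antisymm (h.subset_of_ae_le hb hB hA hAB.symm.le)

/-- By rigidity, an almost sure matching of nodes is automatically bijective and preserves the
order, so no isomorphism has to be carried along when forests are compared. -/
theorem forestEqAE (hb : IsClusteringBase 𝒜 Q perp) (h : IsLimitForest 𝒜 Q perp P F)
    (h' : IsLimitForest 𝒜 Q perp P F') (hm : AEMatch P F F') : ForestEqAE P F F' := by
  classical
  choose! ζ hζ hζe using hm.1
  refine ⟨ζ, ⟨⟨hζ, ?_, ?_⟩, ?_⟩, fun A hA => measure_symmDiff_eq_zero_iff.2 (hζe A hA)⟩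
  · intro A hA B hB hAB
    exact h.eq_of_ae_eq hb hA hB ((hζe A hA).trans (hAB ▸ (hζe B hB).symm))
  · intro B hB
    obtain ⟨A, hA, hAB⟩ := hm.2 B hB
    exact ⟨A, hA, (h'.eq_of_ae_eq hb hB (hζ A hA) (hAB.trans (hζe A hA))).symm⟩
  · intro A hA B hB
    constructor
    · intro hAB
      refine h'.subset_of_ae_le hb (hζ A hA) (hζ B hB) ?_
      exact (hζe A hA).symm.le.trans (hAB.eventuallyLE.trans (hζe B hB).le)
    · intro hAB
      refine h.subset_of_ae_le hb hA hB ?_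
      exact (hζe A hA).le.trans (hAB.eventuallyLE.trans (hζe B hB).symm.le)

theorem aeMatch_lower (hb : IsClusteringBase 𝒜 Q perp) (h : IsLimitForest 𝒜 Q perp P F)
    (h' : IsLimitForest 𝒜 Q perp P F') (hm : AEMatch P F F') :
    AEMatch P (lower F) (lower F') := by
  obtain ⟨ζ, hζ, h0⟩ := h.forestEqAE hb h' hm
  refine ⟨fun B hB => ⟨ζ B, hζ.bijOn_lower.mapsTo hB,
    measure_symmDiff_eq_zero_iff.1 (h0 B hB.1)⟩, fun B' hB' => ?_⟩
  obtain ⟨B, hB, rfl⟩ := hζ.bijOn_lower.surjOn hB'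
  exact ⟨B, hB, (measure_symmDiff_eq_zero_iff.1 (h0 B hB.1)).symm⟩

end IsLimitForest

theorem IsSimpleOn.isForest {R : Measure Ω} {F : Set (Set Ω)} (h : IsSimpleOn 𝒜 Q perp R F) :
    IsForest perp 𝒜 F := by
  obtain ⟨α, h⟩ := h
  exact h.1

theorem Represents.smul_le {F : Set (Set Ω)} {α : Set Ω → ℝ≥0} {R : Measure Ω}
    (h : Represents 𝒜 Q perp F α R) (hA : A ∈ F) : α A • Q A ≤ R := by
  refine Measure.le_iff.2 fun B _ => ?_
  rw [h.apply B, Measure.smul_apply, ENNReal.smul_def, smul_eq_mul]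
  exact Finset.single_le_sum (f := fun A => (α A : ℝ≥0∞) * Q A B) (fun _ _ => zero_le)
    (by simpa using hA)

theorem IsSimpleOn.absolutelyContinuous {R : Measure Ω} {F : Set (Set Ω)}
    (h : IsSimpleOn 𝒜 Q perp R F) (hA : A ∈ F) : Q A ≪ R := by
  obtain ⟨α, h⟩ := h
  exact absolutelyContinuous_of_nnreal_smul_le (h.2.1 A hA) (h.smul_le hA)

namespace IsoMonoConv

variable {R : ℕ → Measure Ω} {F : ℕ → Set (Set Ω)}

theorem isLaminar (hb : IsClusteringBase 𝒜 Q perp) (h : IsoMonoConv 𝒜 Q perp R F P) (n : ℕ) :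
    IsLaminar (F n) := hb.isLaminar (h.simple n).isForest

theorem absolutelyContinuous (h : IsoMonoConv 𝒜 Q perp R F P) {n : ℕ} (hA : A ∈ F n) :
    Q A ≪ P := ((h.simple n).absolutelyContinuous hA).trans (h.conv.2.1 n).absolutelyContinuous

/-- The nodes of the limit forest are limits of increasing chains of nodes, with the same order
relations. -/
theorem exists_chain (hs : IsStableClusteringBase 𝒜 Q perp) (h : IsoMonoConv 𝒜 Q perp R F P) :
    ∃ Z : ℕ → Set Ω → Set Ω, (∀ n, IsFRM (Z n) (struct (F 0)) (struct (F n))) ∧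
      (∀ A ∈ struct (F 0), Monotone fun n => Z n A) ∧
      IsForestIso (fun A => ⋃ n, Z n A) (struct (F 0)) (limForest F) ∧
      (∀ A ∈ struct (F 0), ∀ B ∈ struct (F 0), Disjoint A B →
        perp (⋃ n, Z n A) (⋃ n, Z n B)) := by
  have hb := hs.base
  obtain ⟨Z, hZ, -, hmono⟩ := Clustering.exists_chain h.mono
  have hlam := h.isLaminar hb
  have hmem : ∀ n, ∀ A ∈ struct (F 0), Z n A ∈ F n := fun n A hA => ((hZ n).1.1.mapsTo hA).1
  have hmeas : ∀ n, ∀ A ∈ struct (F 0), MeasurableSet (Z n A) := fun n A hA =>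
    hb.measurableSet ((h.simple n).isForest.subset (hmem n A hA))
  have hperp : ∀ A ∈ struct (F 0), ∀ B ∈ struct (F 0), Disjoint A B →
      perp (⋃ n, Z n A) (⋃ n, Z n B) := by
    intro A hA B hB hAB
    have hnot : ∀ {A B : Set Ω}, A ∈ struct (F 0) → B ∈ struct (F 0) → Disjoint A B →
        ∀ n, ¬ Z n A ⊆ Z n B := by
      intro A B hA hB hAB n hn
      rw [← (hZ n).1.2 A hA B hB] at hn
      exact ((hlam 0).nonempty A hA.1).ne_empty (disjoint_self.1 (hAB.mono_right hn))
    -- Both nodes are enlarged to the common index `max n m`, where the forest property applies.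
    have h1 : ∀ n m, perp (Z n A) (Z m B) := by
      intro n m
      have h2 := hmem (max n m)
      rcases (h.simple (max n m)).isForest.forest _ (h2 A hA) _ (h2 B hB) with h3 | h3 | h3
      · exact hb.separation.perp_mono (hmeas _ A hA) (hmeas _ B hB) (hmeas _ A hA)
          (hmeas _ B hB) (hmono A hA (le_max_left n m)) (hmono B hB (le_max_right n m)) h3
      · exact absurd h3 (hnot hA hB hAB _)
      · exact absurd h3 (hnot hB hA hAB.symm _)
    -- Stability handles one increasing union at a time, so it is applied in each argument in turn.
    have h2 : ∀ m, perp (⋃ n, Z n A) (Z m B) := fun m =>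
      hs.stable _ (fun n => (h.simple n).isForest.subset (hmem n A hA)) (hmono A hA) _
        (hmeas m B hB) fun n => h1 n m
    have hU : MeasurableSet (⋃ n, Z n A) := MeasurableSet.iUnion fun n => hmeas n A hA
    have hV : MeasurableSet (⋃ n, Z n B) := MeasurableSet.iUnion fun n => hmeas n B hB
    exact hb.separation.symm _ _ hV hU <|
      hs.stable _ (fun n => (h.simple n).isForest.subset (hmem n B hB)) (hmono B hB) _ hU
        fun m => hb.separation.symm _ _ hU (hmeas m B hB) (h2 m)
  refine ⟨Z, hZ, hmono, ?_, hperp⟩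
  have hdisj : ∀ A ∈ struct (F 0), ∀ B ∈ struct (F 0), Disjoint A B →
      Disjoint (⋃ n, Z n A) (⋃ n, Z n B) := fun A hA B hB hAB =>
    hb.separation.disjoint (MeasurableSet.iUnion fun n => hmeas n A hA)
      (MeasurableSet.iUnion fun n => hmeas n B hB) (hperp A hA B hB hAB)
  have hne : ∀ A ∈ struct (F 0), (⋃ n, Z n A).Nonempty := fun A hA =>
    ((hlam 0).nonempty _ (hmem 0 A hA)).mono (subset_iUnion (fun n => Z n A) 0)
  have hsub : ∀ A ∈ struct (F 0), ∀ B ∈ struct (F 0),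
      (A ⊆ B ↔ (⋃ n, Z n A) ⊆ ⋃ n, Z n B) := by
    intro A hA B hB
    constructor
    · exact fun hAB => iUnion_mono fun n => ((hZ n).1.2 A hA B hB).1 hAB
    · intro hAB
      rcases (hlam 0).nested A hA.1 B hB.1 with h1 | h1 | h1
      · exact absurd (disjoint_self.1 ((hdisj A hA B hB h1).mono_right hAB)) (hne A hA).ne_empty
      · exact h1
      · rcases h1.eq_or_ssubset with h2 | h2
        · exact h2.ge
        -- The limit sets of `B ⊂ A` cannot coincide: a sibling `C` of `B` lies in `A`, and the
        -- limits of `B` and `C` remain disjoint.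
        · have hB' := hB
          rw [mem_struct_iff] at hB'
          rcases hB' with hB' | ⟨-, C, hC⟩
          · exact absurd ⟨A, hA.1, h2⟩ hB'.2
          · have hC' := lower_subset_struct hC.symm.mem_lower
            have hCA := (hC.ssubset_of_ssubset hA.1 h2).subset
            have h3 : (⋃ n, Z n C) ⊆ ⋃ n, Z n B :=
              (iUnion_mono fun n => ((hZ n).1.2 C hC' A hA).1 hCA).trans hAB
            exact absurd (disjoint_self.1
              ((hdisj C hC' B hB (hC.disjoint (hlam 0)).symm).mono_right h3)) (hne C hC').ne_empty
  rw [limForest_eq hlam hZ]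
  refine ⟨⟨fun A hA => mem_image_of_mem _ hA, ?_, surjOn_image _ _⟩, hsub⟩
  intro A hA B hB hAB
  exact ((hsub A hA B hB).2 hAB.le).antisymm ((hsub B hB A hA).2 hAB.ge)

theorem isLimitForest (hs : IsStableClusteringBase 𝒜 Q perp) (h : IsoMonoConv 𝒜 Q perp R F P) :
    IsLimitForest 𝒜 Q perp P (limForest F) := by
  have hlam := h.isLaminar hs.base
  obtain ⟨Z, hZ, hmono, hiso, hperp⟩ := h.exists_chain hs
  have hmem : ∀ n, ∀ A ∈ struct (F 0), Z n A ∈ F n := fun n A hA => ((hZ n).1.1.mapsTo hA).1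
  have hnode : ∀ B ∈ limForest F, IsLimitNode 𝒜 Q P B := by
    intro B hB
    obtain ⟨A, hA, rfl⟩ := hiso.1.surjOn hB
    exact ⟨fun n => Z n A, fun n => (h.simple n).isForest.subset (hmem n A hA), hmono A hA, rfl,
      fun n => h.absolutelyContinuous (hmem n A hA)⟩
  refine ⟨⟨?_, ?_, fun B hB => (hnode B hB).mem_monotoneClosure, ?_⟩,
    hiso.struct_eq (struct_struct (hlam 0)), hnode⟩
  · rw [← hiso.1.image_eq]
    exact (hlam 0).struct.finite.image _
  · obtain ⟨A, hA⟩ := (h.simple 0).isForest.nonempty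
    obtain ⟨B, hB, -⟩ := (hlam 0).exists_root hA
    exact ⟨_, hiso.1.mapsTo hB.mem_struct⟩
  · intro A' hA' B' hB'
    obtain ⟨A, hA, rfl⟩ := hiso.1.surjOn hA'
    obtain ⟨B, hB, rfl⟩ := hiso.1.surjOn hB'
    rcases (hlam 0).nested A hA.1 B hB.1 with h1 | h1 | h1
    · exact Or.inl (hperp A hA B hB h1)
    · exact Or.inr (Or.inl ((hiso.2 A hA B hB).1 h1))
    · exact Or.inr (Or.inr ((hiso.2 B hB A hA).1 h1))

end IsoMonoConv

end Limits

/-! ### Independence of the limit forest from the adapted sequence. -/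

section Uniqueness

variable {Ω : Type*} [TopologicalSpace Ω] [MeasurableSpace Ω] [OpensMeasurableSpace Ω]
  {𝒜 : Set (Set Ω)} {Q : Set Ω → Measure Ω} {perp : Set Ω → Set Ω → Prop}
  {P R a b d a₁ a₂ : Measure Ω} {A B D E G H A₁ A₂ E₁ E₂ : Set Ω} {F : Set (Set Ω)}
  {α : Set Ω → ℝ≥0} {t : ℝ≥0}

/-- Two base measures below `P` such that no base measure below `P` whose base set contains both
base sets exceeds a fixed fraction of one of them. -/
structure IsSplit (𝒜 : Set (Set Ω)) (Q : Set Ω → Measure Ω) (P : Measure Ω) (A₁ A₂ : Set Ω)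
    (a₁ a₂ : Measure Ω) (t : ℝ≥0) : Prop where
  base₁ : IsBaseMeasureOn 𝒜 Q a₁ A₁
  base₂ : IsBaseMeasureOn 𝒜 Q a₂ A₂
  le₁ : a₁ ≤ P
  le₂ : a₂ ≤ P
  lt_one : t < 1
  not_le₁ : ∀ b E, IsBaseMeasureOn 𝒜 Q b E → A₁ ⊆ E → A₂ ⊆ E → b ≤ P → ¬ t • a₁ ≤ b
  not_le₂ : ∀ b E, IsBaseMeasureOn 𝒜 Q b E → A₁ ⊆ E → A₂ ⊆ E → b ≤ P → ¬ t • a₂ ≤ b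

theorem IsSplit.symm (h : IsSplit 𝒜 Q P A₁ A₂ a₁ a₂ t) : IsSplit 𝒜 Q P A₂ A₁ a₂ a₁ t :=
  ⟨h.base₂, h.base₁, h.le₂, h.le₁, h.lt_one, fun b E hE h1 h2 => h.not_le₂ b E hE h2 h1,
    fun b E hE h1 h2 => h.not_le₁ b E hE h2 h1⟩

theorem nnreal_smul_le_self {t : ℝ≥0} (ht : t < 1) (μ : Measure Ω) : t • μ ≤ μ := by
  refine Measure.le_iff.2 fun B _ => ?_
  rw [Measure.smul_apply, ENNReal.smul_def, smul_eq_mul]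
  exact mul_le_of_le_one_left' (by exact_mod_cast ht.le)

theorem IsSubadditive.exists_base (hsub : IsSubadditive 𝒜 Q P) (ha : IsBaseMeasureOn 𝒜 Q a A)
    (hb : IsBaseMeasureOn 𝒜 Q b B) (haP : a ≤ P) (hbP : b ≤ P) (h : P (A ∩ B) ≠ 0) :
    ∃ d D, IsBaseMeasureOn 𝒜 Q d D ∧ d ≤ P ∧ A ⊆ D ∧ B ⊆ D ∧ (a ≤ d ∨ b ≤ d) := by
  obtain ⟨d, ⟨hdP, D, hD, hAB⟩, hd⟩ := hsub a b A B ha hb haP hbP (pos_iff_ne_zero.2 h)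
  exact ⟨d, D, hD, hdP, subset_union_left.trans hAB, subset_union_right.trans hAB, hd⟩

/-- The conditions on direct siblings in an adapted simple measure. -/
structure IsAdaptedRep (𝒜 : Set (Set Ω)) (Q : Set Ω → Measure Ω) (perp : Set Ω → Set Ω → Prop)
    (P R : Measure Ω) (F : Set (Set Ω)) (α : Set Ω → ℝ≥0) : Prop where
  rep : Represents 𝒜 Q perp F α R
  grounded : ∀ A₁ A₂, DirectSiblings F A₁ A₂ → (baseBelow 𝒜 Q P (A₁ ∪ A₂)).Nonempty →
    ∃ A', IsDirectParent F A' A₁ ∧ IsDirectParent F A' A₂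
  fine : ∀ A₁ A₂, DirectSiblings F A₁ A₂ → ∀ b ∈ baseBelow 𝒜 Q P (A₁ ∪ A₂),
    ∃ b' ∈ baseBelow 𝒜 Q P (⋃₀ {A ∈ F | ancestors F A = ancestors F A₁}), b ≤ b'
  motivated : ∀ A₁ A₂, DirectSiblings F A₁ A₂ → ∃ t : ℝ≥0, 0 < t ∧ t < 1 ∧
    ∀ b, IsBaseMeasure 𝒜 Q b → (t • level Q F α A₁ ≤ b ∨ t • level Q F α A₂ ≤ b) →
      b ∉ baseBelow 𝒜 Q P (A₁ ∪ A₂)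

theorem isAdapted_iff : IsAdapted 𝒜 Q perp P R F ↔ ∃ α, IsAdaptedRep 𝒜 Q perp P R F α := by
  constructor
  · rintro ⟨α, h, h'⟩
    exact ⟨α, h, fun A₁ A₂ hs => (h' A₁ A₂ hs).1, fun A₁ A₂ hs => (h' A₁ A₂ hs).2.1,
      fun A₁ A₂ hs => (h' A₁ A₂ hs).2.2⟩
  · rintro ⟨α, h⟩
    exact ⟨α, h.rep, fun A₁ A₂ hs =>
      ⟨h.grounded A₁ A₂ hs, h.fine A₁ A₂ hs, h.motivated A₁ A₂ hs⟩⟩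

/-- Levels are base measures below `R ≤ P`, and strict motivation is precisely the splitting
condition for them. -/
theorem IsAdaptedRep.exists_isSplit (hb : IsClusteringBase 𝒜 Q perp)
    (h : IsAdaptedRep 𝒜 Q perp P R F α) (hRP : R ≤ P) (hs : DirectSiblings F A₁ A₂) :
    ∃ t, IsSplit 𝒜 Q P A₁ A₂ (level Q F α A₁) (level Q F α A₂) t := by
  obtain ⟨t, -, ht, hm⟩ := h.motivated A₁ A₂ hs
  exact ⟨t, h.rep.level_isBaseMeasureOn hb hs.1, h.rep.level_isBaseMeasureOn hb hs.2.1,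
    (h.rep.level_le hb hs.1).trans hRP, (h.rep.level_le hb hs.2.1).trans hRP, ht,
    fun b E hE h1 h2 hbP hle => hm b ⟨E, hE⟩ (Or.inl hle) ⟨hbP, E, hE, union_subset h1 h2⟩,
    fun b E hE h1 h2 hbP hle => hm b ⟨E, hE⟩ (Or.inr hle) ⟨hbP, E, hE, union_subset h1 h2⟩⟩

/-- A base measure above one side of a split does not meet the other side. -/
theorem IsSplit.measure_inter_eq_zero (hb : IsClusteringBase 𝒜 Q perp)
    (hsub : IsSubadditive 𝒜 Q P) (h : IsSplit 𝒜 Q P A₁ A₂ a₁ a₂ t)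
    (hE : IsBaseMeasureOn 𝒜 Q b E) (hbP : b ≤ P) (hle : a₁ ≤ b) : P (E ∩ A₂) = 0 := by
  by_contra h0
  have h1 : A₁ ⊆ E := hb.base_subset_of_le h.base₁ hE hle
  obtain ⟨d, D, hD, hdP, hED, hAD, hd⟩ := hsub.exists_base hE h.base₂ hbP h.le₂ h0
  rcases hd with hd | hd
  · exact h.not_le₁ d D hD (h1.trans hED) hAD hdP
      ((nnreal_smul_le_self h.lt_one a₁).trans (hle.trans hd))
  · exact h.not_le₂ d D hD (h1.trans hED) hAD hdP ((nnreal_smul_le_self h.lt_one a₂).trans hd)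

/-- A base measure meeting two siblings is dominated by a base measure around all siblings. -/
theorem IsAdaptedRep.exists_base_of_meets (hb : IsClusteringBase 𝒜 Q perp)
    (hsub : IsSubadditive 𝒜 Q P) (h : IsAdaptedRep 𝒜 Q perp P R F α) (hRP : R ≤ P)
    (hs : DirectSiblings F G H) (ha : IsBaseMeasureOn 𝒜 Q a A) (haP : a ≤ P)
    (hG : P (A ∩ G) ≠ 0) (hH : P (A ∩ H) ≠ 0) :
    ∃ b E, IsBaseMeasureOn 𝒜 Q b E ∧ b ≤ P ∧ a ≤ b ∧
      ∀ X ∈ F, ancestors F X = ancestors F G → X ⊆ E := by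
  obtain ⟨t, hsp⟩ := h.exists_isSplit hb hRP hs
  obtain ⟨d, D, hD, hdP, hAD, hGD, hd⟩ := hsub.exists_base ha hsp.base₁ haP hsp.le₁ hG
  have hHD : P (D ∩ H) ≠ 0 := fun h0 => hH
    (measure_mono_null (inter_subset_inter_left H hAD) h0)
  rcases hd with hd | hd
  · obtain ⟨e, E, hE, heP, hDE, hHE, he⟩ := hsub.exists_base hD hsp.base₂ hdP hsp.le₂ hHD
    rcases he with he | he
    · obtain ⟨b, ⟨hbP, B, hB, hBs⟩, hle⟩ := h.fine G H hs e
        ⟨heP, E, hE, union_subset (hGD.trans hDE) hHE⟩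
      exact ⟨b, B, hB, hbP, (hd.trans he).trans hle, fun X hX hXG =>
        (subset_sUnion_of_mem (show X ∈ {A ∈ F | ancestors F A = ancestors F G} from
          ⟨hX, hXG⟩)).trans hBs⟩
    · exact absurd ((nnreal_smul_le_self hsp.lt_one _).trans he)
        (hsp.not_le₂ e E hE (hGD.trans hDE) hHE heP)
  · exact absurd (hsp.measure_inter_eq_zero hb hsub hD hdP hd) hHD

/-- A base measure that meets both sides of a split is small on them. -/
theorem IsSplit.apply_le (hb : IsClusteringBase 𝒜 Q perp)
    (hsub : IsSubadditive 𝒜 Q P) (h : IsSplit 𝒜 Q P A₁ A₂ a₁ a₂ t)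
    (hD : IsBaseMeasureOn 𝒜 Q d D) (hdP : d ≤ P) (h1 : P (D ∩ A₁) ≠ 0) (h2 : P (D ∩ A₂) ≠ 0)
    (hB : B ⊆ A₁) : d B ≤ (t • a₁) B := by
  obtain ⟨b, E, hE, hbP, hDE, hAE, hle⟩ := hsub.exists_base hD h.base₁ hdP h.le₁ h1
  have hEA : P (E ∩ A₂) ≠ 0 := fun h0 => h2 (measure_mono_null (inter_subset_inter_left A₂ hDE) h0)
  rcases hle with hle | hle
  · obtain ⟨e, C, hC, heP, hEC, hAC, hle'⟩ := hsub.exists_base hE h.base₂ hbP h.le₂ hEA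
    rcases hle' with hle' | hle'
    · have hA₁C := hAE.trans hEC
      have hnot := h.not_le₁ e C hC hA₁C hAC heP
      obtain ⟨hC𝒜, γ, hγ, rfl⟩ := hC
      obtain ⟨hA𝒜, l, hl, rfl⟩ := h.base₁
      -- On `A₁` both measures are multiples of `Q A₁`, so failure of domination amounts to a
      -- comparison of two numbers.
      have hlt : (γ : ℝ≥0∞) * Q C A₁ ≤ t * l := by
        by_contra hcon
        refine hnot ?_
        rw [smul_smul]
        refine nnreal_smul_le_of_subset hb hA𝒜 hC𝒜 hA₁C ?_
        push_cast
        exact (not_le.1 hcon).le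
      calc d B ≤ (γ • Q C) B := (hle.trans hle') B
        _ = γ * Q C (B ∩ A₁) := by
          rw [inter_eq_left.2 hB, Measure.smul_apply, ENNReal.smul_def, smul_eq_mul]
        _ = γ * Q C A₁ * Q A₁ B := by rw [hb.apply_inter hA𝒜 hC𝒜 hA₁C, mul_assoc]
        _ ≤ t * l * Q A₁ B := by gcongr
        _ = (t • l • Q A₁) B := by
          simp only [Measure.smul_apply, ENNReal.smul_def, smul_eq_mul, mul_assoc]
    · exact absurd ((nnreal_smul_le_self h.lt_one _).trans hle')
        (h.not_le₂ e C hC (hAE.trans hEC) hAC heP)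
  · exact absurd (h.measure_inter_eq_zero hb hsub hE hbP hle) hEA

/-- A simple measure close to `P` on one side of a split has a node that meets only this side. -/
theorem IsSplit.exists_node (hb : IsClusteringBase 𝒜 Q perp)
    (hsub : IsSubadditive 𝒜 Q P) (h : IsSplit 𝒜 Q P A₁ A₂ a₁ a₂ t)
    (hR : Represents 𝒜 Q perp F α R) (hRP : R ≤ P) (hlt : (t • a₁) A₁ < R A₁) :
    ∃ D ∈ F, P (D ∩ A₁) ≠ 0 ∧ P (D ∩ A₂) = 0 := by
  by_contra! hcon
  refine hlt.not_ge (hR.apply_le hb (hb.measurableSet h.base₁.1) _ fun D hD C _ hCD => ?_)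
  have hCA : C ⊆ A₁ := hCD.trans inter_subset_left
  have hCc : C ⊆ core F D := hCD.trans inter_subset_right
  by_cases h1 : P (D ∩ A₁) = 0
  · have : R C ≤ 0 := (hRP C).trans ((measure_mono (subset_inter (hCc.trans sdiff_subset)
      hCA)).trans h1.le)
    exact this.trans zero_le
  · rw [hR.apply_core hb hD hCc]
    exact h.apply_le hb hsub (hR.level_isBaseMeasureOn hb hD) ((hR.level_le hb hD).trans hRP)
      h1 (hcon D hD h1) hCA

/-- Once `E₁` and `E₂` meet the two sides, every node that charges `A₁` outside `E₁` must also meet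
`A₂`, so the bound for base measures meeting both sides applies to it. -/
theorem IsSplit.apply_le_of_siblings (hb : IsClusteringBase 𝒜 Q perp)
    (hsub : IsSubadditive 𝒜 Q P) (h : IsSplit 𝒜 Q P A₁ A₂ a₁ a₂ t)
    (hR : IsAdaptedRep 𝒜 Q perp P R F α) (hRP : R ≤ P) (hs : DirectSiblings F E₁ E₂)
    (h1 : P (E₁ ∩ A₁) ≠ 0) (h2 : P (E₂ ∩ A₂) ≠ 0) (hB : MeasurableSet B) (hBA : B ⊆ A₁ \ E₁) :
    R B ≤ (t • a₁) B := by
  have hlam := hb.isLaminar hR.rep.1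
  have key : ∀ D ∈ F, P (D ∩ B) ≠ 0 → P (D ∩ A₂) ≠ 0 := by
    intro D hD hDB
    have hmono : ∀ {X}, E₂ ⊆ X → P (X ∩ A₂) ≠ 0 := fun hX h0 =>
      h2 (measure_mono_null (inter_subset_inter_left A₂ hX) h0)
    have hnsub : ¬ D ⊆ E₁ := fun hDE => hDB <| by
      have : D ∩ B = ∅ := by
        ext x
        simp only [mem_inter_iff, mem_empty_iff_false, iff_false, not_and]
        exact fun hxD hxB => (hBA hxB).2 (hDE hxD)
      rw [this, measure_empty]
    rcases hlam.nested D hD E₁ hs.1 with h3 | h3 | h3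
    -- Here `D` and `E₁` lie below siblings `G`, `H`, both of which `A₁` meets. Fineness gives a
    -- base measure above `a₁` around all siblings of `G`, hence around `E₂`; it would meet `A₂`,
    -- which a base measure above one side of a split cannot.
    · exfalso
      obtain ⟨G, H, hGH, hDG, hEH⟩ := hlam.exists_directSiblings hD hs.1 h3
      have hG : P (A₁ ∩ G) ≠ 0 := fun h0 => hDB (measure_mono_null
        (show D ∩ B ⊆ A₁ ∩ G from fun x hx => ⟨(hBA hx.2).1, hDG hx.1⟩) h0)
      have hH : P (A₁ ∩ H) ≠ 0 := fun h0 => h1 (measure_mono_null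
        (show E₁ ∩ A₁ ⊆ A₁ ∩ H from fun x hx => ⟨hx.2, hEH hx.1⟩) h0)
      obtain ⟨b, E, hE, hbP, hab, hX⟩ := hR.exists_base_of_meets hb hsub hRP hGH h.base₁ h.le₁ hG hH
      have hE₂ : E₂ ⊆ E := by
        rcases hEH.eq_or_ssubset with h4 | h4
        · exact hX E₂ hs.2.1 (by rw [hGH.2.2.2, ← h4, hs.2.2.2])
        · exact (hs.ssubset_of_ssubset hGH.2.1 h4).subset.trans (hX H hGH.2.1 hGH.2.2.2.symm)
      exact hmono hE₂ (h.measure_inter_eq_zero hb hsub hE hbP hab)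
    · exact absurd h3 hnsub
    · exact hmono (hs.ssubset_of_ssubset hD (h3.ssubset_of_not_subset hnsub)).subset
  refine hR.rep.apply_le hb hB _ fun D hD C _ hCD => ?_
  have hCB : C ⊆ B := hCD.trans inter_subset_left
  have hCc : C ⊆ core F D := hCD.trans inter_subset_right
  by_cases h1 : P (D ∩ B) = 0
  · have : R C ≤ 0 := (hRP C).trans ((measure_mono (subset_inter (hCc.trans sdiff_subset)
      hCB)).trans h1.le)
    exact this.trans zero_le
  · rw [hR.rep.apply_core hb hD hCc]
    refine h.apply_le hb hsub (hR.rep.level_isBaseMeasureOn hb hD)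
      ((hR.rep.level_le hb hD).trans hRP) ?_ (key D hD h1) (hCB.trans (hBA.trans sdiff_subset))
    exact fun h0 => h1 (measure_mono_null
      (inter_subset_inter_right D (hBA.trans sdiff_subset)) h0)

variable {R : ℕ → Measure Ω} {F : ℕ → Set (Set Ω)}

/-- The mass of `a₁` on `A₁` is positive and finite, so multiplying it by `t < 1` brings it strictly
below `P A₁`. -/
theorem IsSplit.eventually_lt (hb : IsClusteringBase 𝒜 Q perp)
    (h : IsSplit 𝒜 Q P A₁ A₂ a₁ a₂ t) (hconv : MonoConv R P) :
    ∀ᶠ m in atTop, (t • a₁) A₁ < R m A₁ := by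
  have hA := hb.measurableSet h.base₁.1
  refine (hconv.2.2 A₁ hA).eventually (lt_mem_nhds ?_)
  refine lt_of_lt_of_le ?_ (h.le₁ A₁)
  obtain ⟨hA𝒜, l, hl, rfl⟩ := h.base₁
  simp only [Measure.smul_apply, ENNReal.smul_def, smul_eq_mul, hb.apply_self hA𝒜, mul_one]
  have := mul_lt_mul_of_pos_right h.lt_one hl
  rw [one_mul] at this
  exact_mod_cast this

/-- The two sides of a split lie almost surely in two sibling nodes of any adapted limit. -/
theorem AdaptedSeq.exists_siblings (hs : IsStableClusteringBase 𝒜 Q perp)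
    (hP : IsFiniteMeasure P) (hsub : IsSubadditive 𝒜 Q P) (hR : AdaptedSeq 𝒜 Q perp R F P)
    (h : IsSplit 𝒜 Q P A₁ A₂ a₁ a₂ t) :
    ∃ B₁ B₂, DirectSiblings (limForest F) B₁ B₂ ∧ A₁ ≤ᵐ[P] B₁ ∧ A₂ ≤ᵐ[P] B₂ := by
  have hb := hs.base
  obtain ⟨hiso, had⟩ := hR
  have hlam := hiso.isLaminar hb
  have hRP := hiso.conv.2.1
  choose α hα using fun n => isAdapted_iff.1 (had n)
  obtain ⟨m, hm1, hm2⟩ := ((h.eventually_lt hb hiso.conv).and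
    (h.symm.eventually_lt hb hiso.conv)).exists
  obtain ⟨D₁, hD₁, h11, h12⟩ := h.exists_node hb hsub (hα m).rep (hRP m) hm1
  obtain ⟨D₂, hD₂, h22, h21⟩ := h.symm.exists_node hb hsub (hα m).rep (hRP m) hm2
  -- Each node meets only its own side of the split, so neither contains the other.
  have hdis : Disjoint D₁ D₂ := by
    rcases (hlam m).nested D₁ hD₁ D₂ hD₂ with h3 | h3 | h3
    · exact h3
    · exact absurd (measure_mono_null (inter_subset_inter_left A₁ h3) h21) h11
    · exact absurd (measure_mono_null (inter_subset_inter_left A₂ h3) h12) h22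
  obtain ⟨E₁, E₂, hE, hDE₁, hDE₂⟩ := (hlam m).exists_directSiblings hD₁ hD₂ hdis
  obtain ⟨Z, hZ, hmono, hlim, -⟩ := hiso.exists_chain hs
  obtain ⟨I₁, hI₁, rfl⟩ := (hZ m).1.1.surjOn (lower_subset_struct hE.mem_lower)
  obtain ⟨I₂, hI₂, rfl⟩ := (hZ m).1.1.surjOn (lower_subset_struct hE.symm.mem_lower)
  have hI : DirectSiblings (struct (F 0)) I₁ I₂ := by
    obtain ⟨ξ, hξ, -, hinv⟩ := (hZ m).1.exists_inverse
    have := hξ.directSiblings ((directSiblings_struct_iff (hlam m)).2 hE)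
    rwa [hinv I₁ hI₁, hinv I₂ hI₂] at this
  have hIk : ∀ k, DirectSiblings (F k) (Z k I₁) (Z k I₂) := fun k =>
    (directSiblings_struct_iff (hlam k)).1 ((hZ k).1.directSiblings hI)
  have hmeas : ∀ k, ∀ I ∈ struct (F 0), MeasurableSet (Z k I) := fun k I hI =>
    hb.measurableSet ((hiso.simple k).isForest.subset ((hZ k).1.1.mapsTo hI).1)
  have key : ∀ {A₁ A₂ : Set Ω} {a₁ a₂ : Measure Ω} {I₁ I₂ : Set Ω},
      IsSplit 𝒜 Q P A₁ A₂ a₁ a₂ t → I₁ ∈ struct (F 0) → I₂ ∈ struct (F 0) →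
      (∀ k, DirectSiblings (F k) (Z k I₁) (Z k I₂)) → P (Z m I₁ ∩ A₁) ≠ 0 →
      P (Z m I₂ ∩ A₂) ≠ 0 → A₁ ≤ᵐ[P] (⋃ n, Z n I₁ : Set Ω) := by
    intro A₁ A₂ a₁ a₂ I₁ I₂ h hI₁ hI₂ hIk h1 h2
    rw [ae_le_set]
    set N := A₁ \ ⋃ n, Z n I₁ with hN
    have hNm : MeasurableSet N :=
      (hb.measurableSet h.base₁.1).diff (MeasurableSet.iUnion fun k => hmeas k I₁ hI₁)
    have hle : ∀ k, m ≤ k → R k N ≤ (t • a₁) N := by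
      intro k hk
      refine h.apply_le_of_siblings hb hsub (hα k) (hRP k) (hIk k) ?_ ?_ hNm ?_
      · exact fun h0 => h1 (measure_mono_null (inter_subset_inter_left A₁ (hmono I₁ hI₁ hk)) h0)
      · exact fun h0 => h2 (measure_mono_null (inter_subset_inter_left A₂ (hmono I₂ hI₂ hk)) h0)
      · exact sdiff_subset_sdiff_right (subset_iUnion (fun n => Z n I₁) k)
    have hPN : P N ≤ (t • a₁) N :=
      le_of_tendsto (hiso.conv.2.2 N hNm) (eventually_atTop.2 ⟨m, hle⟩)
    -- Since `t < 1` and `P` is finite, this inequality forces `P N = 0`.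
    have hPN' : P N ≤ t * P N := by
      refine hPN.trans ?_
      rw [Measure.smul_apply, ENNReal.smul_def, smul_eq_mul]
      exact mul_le_mul_right (h.le₁ N) _
    by_contra h0
    have : (t : ℝ≥0∞) * P N < 1 * P N :=
      ENNReal.mul_lt_mul_left h0 (measure_ne_top P N) (by exact_mod_cast h.lt_one)
    rw [one_mul] at this
    exact this.not_ge hPN'
  have hm1' : P (Z m I₁ ∩ A₁) ≠ 0 := fun h0 =>
    h11 (measure_mono_null (inter_subset_inter_left A₁ hDE₁) h0)
  have hm2' : P (Z m I₂ ∩ A₂) ≠ 0 := fun h0 =>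
    h22 (measure_mono_null (inter_subset_inter_left A₂ hDE₂) h0)
  exact ⟨_, _, hlim.directSiblings hI, key h hI₁ hI₂ hIk hm1' hm2',
    key h.symm hI₂ hI₁ (fun k => (hIk k).symm) hm2' hm1'⟩

/-- A base measure below `P` lives almost surely on a single root of any adapted limit. -/
theorem AdaptedSeq.exists_root (hs : IsStableClusteringBase 𝒜 Q perp)
    (hsub : IsSubadditive 𝒜 Q P) (hR : AdaptedSeq 𝒜 Q perp R F P)
    (ha : IsBaseMeasureOn 𝒜 Q a A) (haP : a ≤ P) :
    ∃ B, IsRoot (limForest F) B ∧ A ≤ᵐ[P] B := by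
  have hb := hs.base
  obtain ⟨hiso, had⟩ := hR
  have hlam := hiso.isLaminar hb
  have hRP := hiso.conv.2.1
  have hAm := hb.measurableSet ha.1
  choose α hα using fun n => isAdapted_iff.1 (had n)
  have hPA : P A ≠ 0 := by
    obtain ⟨hA, l, hl, rfl⟩ := ha
    intro h0
    have := absolutelyContinuous_of_nnreal_smul_le hl haP h0
    rw [hb.apply_self hA] at this
    exact one_ne_zero this
  have huniq : ∀ k, ∀ G, IsRoot (F k) G → ∀ H, IsRoot (F k) H → P (A ∩ G) ≠ 0 → P (A ∩ H) ≠ 0 →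
      G = H := by
    intro k G hG H hH h1 h2
    by_contra hne
    have hGH := hG.directSiblings hH hne
    obtain ⟨b, E, hE, hbP, -, hX⟩ := (hα k).exists_base_of_meets hb hsub (hRP k) hGH ha haP h1 h2
    -- Groundedness would give the root `G` a parent.
    obtain ⟨A', hA', -⟩ := (hα k).grounded G H hGH ⟨b, hbP, E, hE, union_subset
      (hX G hGH.1 rfl) (hX H hGH.2.1 hGH.2.2.2.symm)⟩
    exact hG.2 ⟨A', hA'.1.1, hA'.1.2⟩
  have hzero : ∀ k, ∀ B ⊆ A, (∀ G, IsRoot (F k) G → P (A ∩ G ∩ B) = 0) → R k B = 0 := by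
    intro k B hBA hG
    rw [(hα k).rep.apply, Finset.sum_eq_zero]
    intro E hE
    have hE : E ∈ F k := by simpa using hE
    obtain ⟨G, hGr, hEG⟩ := (hlam k).exists_root hE
    have h0 : P (B ∩ E) = 0 := measure_mono_null
      (show B ∩ E ⊆ A ∩ G ∩ B from fun x hx => ⟨⟨hBA hx.1, hEG hx.2⟩, hx.1⟩) (hG G hGr)
    rw [← hb.apply_inter_self ((hiso.simple k).isForest.subset hE),
      hiso.absolutelyContinuous hE h0, mul_zero]
  obtain ⟨m, hm⟩ : ∃ m, R m A ≠ 0 :=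
    ((hiso.conv.2.2 A hAm).eventually_ne hPA).exists
  obtain ⟨G, hG, hAG⟩ : ∃ G, IsRoot (F m) G ∧ P (A ∩ G) ≠ 0 := by
    by_contra! hcon
    exact hm (hzero m A Subset.rfl fun G hG => measure_mono_null inter_subset_left (hcon G hG))
  obtain ⟨Z, hZ, hmono, hlim, -⟩ := hiso.exists_chain hs
  obtain ⟨I, hI, rfl⟩ := (hZ m).1.1.surjOn hG.mem_struct
  have hIr : IsRoot (struct (F 0)) I := by
    obtain ⟨ξ, hξ, -, hinv⟩ := (hZ m).1.exists_inverse
    have := hξ.isRoot ((isRoot_struct_iff (hlam m)).2 hG)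
    rwa [hinv I hI] at this
  refine ⟨_, hlim.isRoot hIr, ?_⟩
  rw [ae_le_set]
  set N := A \ ⋃ n, Z n I with hN
  have hNm : MeasurableSet N := hAm.diff (MeasurableSet.iUnion fun k =>
    hb.measurableSet ((hiso.simple k).isForest.subset ((hZ k).1.1.mapsTo hI).1))
  have hle : ∀ k, m ≤ k → R k N = 0 := by
    intro k hk
    have hr : IsRoot (F k) (Z k I) := (isRoot_struct_iff (hlam k)).1 ((hZ k).1.isRoot hIr)
    refine hzero k N sdiff_subset fun H hH => ?_
    by_contra h0
    have h1 : P (A ∩ H) ≠ 0 := fun h => h0 (measure_mono_null inter_subset_left h)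
    have h2 : P (A ∩ Z k I) ≠ 0 := fun h => hAG
      (measure_mono_null (inter_subset_inter_right A (hmono I hI hk)) h)
    have := huniq k H hH _ hr h1 h2
    subst this
    refine h0 ?_
    have : A ∩ Z k I ∩ N = ∅ := by
      ext x
      simp only [mem_inter_iff, mem_empty_iff_false, iff_false, not_and]
      exact fun hx hxN => hxN.2 (mem_iUnion.2 ⟨k, hx.2⟩)
    rw [this, measure_empty]
  exact tendsto_nhds_unique (hiso.conv.2.2 N hNm) (tendsto_const_nhds.congr'
    (eventually_atTop.2 ⟨m, fun k hk => (hle k hk).symm⟩))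

variable {R' : ℕ → Measure Ω} {F' : ℕ → Set (Set Ω)}

/-- Pigeonhole: the target node may depend on the approximation index, but one target recurs
infinitely often and then receives the whole increasing union. -/
theorem exists_frequently_eq {β : Type*} {T : Set β} (hT : T.Finite) {f : ℕ → β}
    (hf : ∀ n, f n ∈ T) : ∃ S, ∀ n, ∃ k, n ≤ k ∧ f k = S := by
  by_contra! hcon
  have : ∀ᶠ k in atTop, ∀ S ∈ T, f k ≠ S := (eventually_all_finite hT).2 fun S _ => by
    obtain ⟨n, hn⟩ := hcon S
    exact eventually_atTop.2 ⟨n, hn⟩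
  obtain ⟨k, hk⟩ := this.exists
  exact hk _ (hf k) rfl

theorem iUnion_ae_le {Z : ℕ → Set Ω} {S : Set Ω} (h : ∀ n, Z n ≤ᵐ[P] S) :
    (⋃ n, Z n : Set Ω) ≤ᵐ[P] S := by
  rw [ae_le_set, iUnion_sdiff, measure_iUnion_null_iff]
  exact fun n => ae_le_set.1 (h n)

/-- Sibling nodes of one adapted limit lie almost surely in sibling nodes of the other. -/
theorem AdaptedSeq.exists_siblings_of_siblings (hs : IsStableClusteringBase 𝒜 Q perp)
    (hP : IsFiniteMeasure P) (hsub : IsSubadditive 𝒜 Q P) (hR : AdaptedSeq 𝒜 Q perp R F P)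
    (hR' : AdaptedSeq 𝒜 Q perp R' F' P) {C₁ C₂ : Set Ω}
    (hC : DirectSiblings (limForest F) C₁ C₂) :
    ∃ B₁ B₂, DirectSiblings (limForest F') B₁ B₂ ∧ C₁ ≤ᵐ[P] B₁ ∧ C₂ ≤ᵐ[P] B₂ := by
  have hb := hs.base
  have hlam := hR.1.isLaminar hb
  obtain ⟨Z, hZ, hmono, hlim, -⟩ := hR.1.exists_chain hs
  obtain ⟨I₁, hI₁, rfl⟩ := hlim.1.surjOn hC.1
  obtain ⟨I₂, hI₂, rfl⟩ := hlim.1.surjOn hC.2.1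
  have hI : DirectSiblings (struct (F 0)) I₁ I₂ := by
    obtain ⟨ξ, hξ, -, hinv⟩ := hlim.exists_inverse
    have := hξ.directSiblings hC
    rwa [hinv I₁ hI₁, hinv I₂ hI₂] at this
  have hIk : ∀ k, DirectSiblings (F k) (Z k I₁) (Z k I₂) := fun k =>
    (directSiblings_struct_iff (hlam k)).1 ((hZ k).1.directSiblings hI)
  have hex : ∀ n, ∃ B : Set Ω × Set Ω, DirectSiblings (limForest F') B.1 B.2 ∧
      Z n I₁ ≤ᵐ[P] B.1 ∧ Z n I₂ ≤ᵐ[P] B.2 := by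
    intro n
    obtain ⟨α, hα⟩ := isAdapted_iff.1 (hR.2 n)
    obtain ⟨t, ht⟩ := hα.exists_isSplit hb (hR.1.conv.2.1 n) (hIk n)
    obtain ⟨B₁, B₂, h⟩ := hR'.exists_siblings hs hP hsub ht
    exact ⟨(B₁, B₂), h⟩
  choose B hB hB1 hB2 using hex
  have hfin : (limForest F' ×ˢ limForest F').Finite :=
    (hR'.1.isLimitForest hs).isForest.finite.prod (hR'.1.isLimitForest hs).isForest.finite
  obtain ⟨S, hge⟩ := exists_frequently_eq hfin (f := B) fun n => ⟨(hB n).1, (hB n).2.1⟩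
  refine ⟨S.1, S.2, ?_, ?_, ?_⟩
  · obtain ⟨k, -, rfl⟩ := hge 0
    exact hB k
  · refine iUnion_ae_le fun n => ?_
    obtain ⟨k, hk, rfl⟩ := hge n
    exact (hmono I₁ hI₁ hk).eventuallyLE.trans (hB1 k)
  · refine iUnion_ae_le fun n => ?_
    obtain ⟨k, hk, rfl⟩ := hge n
    exact (hmono I₂ hI₂ hk).eventuallyLE.trans (hB2 k)

/-- The level of each approximating node is a base measure below `P`, so it selects a root of the
other limit. Finiteness of that limit lets a single root serve for all indices. -/
theorem AdaptedSeq.exists_root_of_root (hs : IsStableClusteringBase 𝒜 Q perp)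
    (hsub : IsSubadditive 𝒜 Q P) (hR : AdaptedSeq 𝒜 Q perp R F P)
    (hR' : AdaptedSeq 𝒜 Q perp R' F' P) {C : Set Ω} (hC : C ∈ limForest F) :
    ∃ B, IsRoot (limForest F') B ∧ C ≤ᵐ[P] B := by
  have hb := hs.base
  obtain ⟨Z, hZ, hmono, hlim, -⟩ := hR.1.exists_chain hs
  obtain ⟨I, hI, rfl⟩ := hlim.1.surjOn hC
  have hex : ∀ n, ∃ B, IsRoot (limForest F') B ∧ Z n I ≤ᵐ[P] B := by
    intro n
    obtain ⟨α, hα⟩ := hR.1.simple n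
    have hm := ((hZ n).1.1.mapsTo hI).1
    exact hR'.exists_root hs hsub (hα.level_isBaseMeasureOn hb hm)
      ((hα.level_le hb hm).trans (hR.1.conv.2.1 n))
  choose B hB hB1 using hex
  obtain ⟨S, hge⟩ := exists_frequently_eq (hR'.1.isLimitForest hs).isForest.finite (f := B)
    fun n => (hB n).1
  refine ⟨S, ?_, ?_⟩
  · obtain ⟨k, -, rfl⟩ := hge 0
    exact hB k
  · refine iUnion_ae_le fun n => ?_
    obtain ⟨k, hk, rfl⟩ := hge n
    exact (hmono I hI hk).eventuallyLE.trans (hB1 k)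

/-- Any two adapted sequences with the same limit have almost surely the same limit forest. -/
theorem AdaptedSeq.aeMatch (hs : IsStableClusteringBase 𝒜 Q perp)
    (hP : IsFiniteMeasure P) (hsub : IsSubadditive 𝒜 Q P) (hR : AdaptedSeq 𝒜 Q perp R F P)
    (hR' : AdaptedSeq 𝒜 Q perp R' F' P) : AEMatch P (limForest F) (limForest F') := by
  have hb := hs.base
  have key : ∀ {R R' : ℕ → Measure Ω} {F F' : ℕ → Set (Set Ω)}, AdaptedSeq 𝒜 Q perp R F P →
      AdaptedSeq 𝒜 Q perp R' F' P → ∀ B ∈ limForest F, ∃ B' ∈ limForest F', B =ᵐ[P] B' := by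
    intro R R' F F' hR hR' B hB
    have hL := hR.1.isLimitForest hs
    have hlam := hL.isLaminar hb
    have hB' := hB
    rw [← hL.struct_eq, mem_struct_iff] at hB'
    rcases hB' with hr | ⟨-, C, hC⟩
    · obtain ⟨D, hD, hBD⟩ := hR.exists_root_of_root hs hsub hR' hB
      obtain ⟨E, hE, hDE⟩ := hR'.exists_root_of_root hs hsub hR hD.1
      -- The round trip ends in a root containing the root `B`, so all the inclusions are almost
      -- sure equalities.
      have h1 : B ⊆ E := hL.subset_of_ae_le hb hB hE.1 (hBD.trans hDE)
      rcases h1.eq_or_ssubset with h2 | h2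
      · subst h2
        exact ⟨D, hD.1, hBD.antisymm hDE⟩
      · exact absurd ⟨E, hE.1, h2⟩ hr.2
    · obtain ⟨D₁, D₂, hD, h1, h2⟩ := hR.exists_siblings_of_siblings hs hP hsub hR' hC
      obtain ⟨E₁, E₂, hE, h3, h4⟩ := hR'.exists_siblings_of_siblings hs hP hsub hR hD
      have h5 : B ⊆ E₁ := hL.subset_of_ae_le hb hB hE.1 (h1.trans h3)
      have h6 : C ⊆ E₂ := hL.subset_of_ae_le hb hC.2.1 hE.2.1 (h2.trans h4)
      rcases h5.eq_or_ssubset with h7 | h7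
      · subst h7
        exact ⟨D₁, hD.1, h1.antisymm h3⟩
      -- If `E₁` were a strict ancestor of `B`, it would also contain the sibling `C`, which lies in
      -- the disjoint node `E₂`.
      · have h8 := (hC.ssubset_of_ssubset hE.1 h7).subset
        exact absurd (disjoint_self.1 ((hE.disjoint hlam).mono h8 h6))
          (hlam.nonempty C hC.2.1).ne_empty
  exact ⟨key hR hR', key hR' hR⟩

end Uniqueness

/-! ### Stability of adapted limits under scaling and under adding a base measure. -/

section Closure

variable {Ω : Type*} [TopologicalSpace Ω] [MeasurableSpace Ω] [OpensMeasurableSpace Ω]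
  {𝒜 : Set (Set Ω)} {Q : Set Ω → Measure Ω} {perp : Set Ω → Set Ω → Prop}
  {P R a b : Measure Ω} {A B E : Set Ω} {F : Set (Set Ω)}
  {α : Set Ω → ℝ≥0} {t : ℝ≥0}

/-! ### Scaling -/

theorem nnreal_smul_mono {μ ν : Measure Ω} (t : ℝ≥0) (h : μ ≤ ν) : t • μ ≤ t • ν := by
  refine Measure.le_iff.2 fun B _ => ?_
  simp only [Measure.smul_apply, ENNReal.smul_def, smul_eq_mul]
  exact mul_le_mul_right (h B) _

theorem inv_smul_le_iff_le_smul {μ ν : Measure Ω} (ht : 0 < t) : t⁻¹ • μ ≤ ν ↔ μ ≤ t • ν := by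
  constructor
  · intro h
    have := nnreal_smul_mono t h
    rwa [smul_inv_smul₀ ht.ne'] at this
  · intro h
    have := nnreal_smul_mono t⁻¹ h
    rwa [inv_smul_smul₀ ht.ne'] at this

theorem IsBaseMeasureOn.smul (h : IsBaseMeasureOn 𝒜 Q a A) (ht : 0 < t) :
    IsBaseMeasureOn 𝒜 Q (t • a) A := by
  obtain ⟨hA, s, hs, rfl⟩ := h
  exact ⟨hA, t * s, mul_pos ht hs, by rw [smul_smul]⟩

theorem finMeasures.smul (h : P ∈ finMeasures Ω) (ht : 0 < t) : t • P ∈ finMeasures Ω := by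
  obtain ⟨h1, h2, h3⟩ := h
  refine ⟨inferInstance, fun h0 => h2 ?_, inferInstance⟩
  have := congrArg (t⁻¹ • ·) h0
  simpa [inv_smul_smul₀ ht.ne'] using this

theorem mem_baseBelow_smul_iff (ht : 0 < t) :
    b ∈ baseBelow 𝒜 Q (t • P) B ↔ t⁻¹ • b ∈ baseBelow 𝒜 Q P B := by
  constructor
  · rintro ⟨hb, E, hE, hBE⟩
    exact ⟨(inv_smul_le_iff_le_smul ht).2 hb, E, hE.smul (inv_pos.2 ht), hBE⟩
  · rintro ⟨hb, E, hE, hBE⟩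
    refine ⟨(inv_smul_le_iff_le_smul ht).1 hb, E, ?_, hBE⟩
    have := hE.smul ht
    rwa [smul_inv_smul₀ ht.ne'] at this

theorem IsSubadditive.smul (h : IsSubadditive 𝒜 Q P) (ht : 0 < t) :
    IsSubadditive 𝒜 Q (t • P) := by
  intro a a' A A' ha ha' hle hle' hpos
  have hpos' : 0 < P (A ∩ A') := by
    refine pos_iff_ne_zero.2 fun h0 => hpos.ne' ?_
    simp [h0]
  obtain ⟨b, hb, hor⟩ := h _ _ A A' (ha.smul (inv_pos.2 ht)) (ha'.smul (inv_pos.2 ht))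
    ((inv_smul_le_iff_le_smul ht).2 hle) ((inv_smul_le_iff_le_smul ht).2 hle') hpos'
  refine ⟨t • b, (mem_baseBelow_smul_iff ht).2 ?_, ?_⟩
  · rwa [inv_smul_smul₀ ht.ne']
  · exact hor.imp (inv_smul_le_iff_le_smul ht).1 (inv_smul_le_iff_le_smul ht).1

theorem Represents.smul (h : Represents 𝒜 Q perp F α R) (ht : 0 < t) :
    Represents 𝒜 Q perp F (fun A => t * α A) (t • R) := by
  obtain ⟨h1, h2, rfl⟩ := h
  refine ⟨h1, fun A hA => mul_pos ht (h2 A hA), ?_⟩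
  rw [finsum_mem_eq_finite_toFinset_sum _ h1.finite,
    finsum_mem_eq_finite_toFinset_sum _ h1.finite, Finset.smul_sum]
  exact Finset.sum_congr rfl fun A _ => by rw [smul_smul]

theorem level_smul (hF : F.Finite) :
    level Q F (fun A => t * α A) A = t • level Q F α A := by
  have hf : {E ∈ F | A ⊆ E}.Finite := hF.subset (sep_subset _ _)
  rw [level, level, finsum_mem_eq_finite_toFinset_sum _ hf,
    finsum_mem_eq_finite_toFinset_sum _ hf]
  refine Measure.ext fun B _ => ?_
  simp only [Measure.smul_apply, ENNReal.smul_def, smul_eq_mul]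
  rw [← mul_assoc, Finset.mul_sum]
  congr 1
  exact Finset.sum_congr rfl fun E _ => by push_cast; rw [mul_assoc]

theorem IsAdaptedRep.smul (h : IsAdaptedRep 𝒜 Q perp P R F α) (ht : 0 < t) :
    IsAdaptedRep 𝒜 Q perp (t • P) (t • R) F (fun A => t * α A) := by
  refine ⟨h.rep.smul ht, fun A₁ A₂ hs ⟨b, hb⟩ => ?_, fun A₁ A₂ hs b hb => ?_,
    fun A₁ A₂ hs => ?_⟩
  · exact h.grounded A₁ A₂ hs ⟨_, (mem_baseBelow_smul_iff ht).1 hb⟩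
  · obtain ⟨b', hb', hle⟩ := h.fine A₁ A₂ hs _ ((mem_baseBelow_smul_iff ht).1 hb)
    refine ⟨t • b', (mem_baseBelow_smul_iff ht).2 ?_, (inv_smul_le_iff_le_smul ht).1 hle⟩
    rwa [inv_smul_smul₀ ht.ne']
  · obtain ⟨s, hs0, hs1, hm⟩ := h.motivated A₁ A₂ hs
    refine ⟨s, hs0, hs1, fun b ⟨E, hE⟩ hor hmem => ?_⟩
    refine hm (t⁻¹ • b) ⟨E, hE.smul (inv_pos.2 ht)⟩ ?_ ((mem_baseBelow_smul_iff ht).1 hmem)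
    have aux : ∀ X, s • level Q F (fun A => t * α A) X ≤ b → s • level Q F α X ≤ t⁻¹ • b := by
      intro X hX
      rw [level_smul h.rep.1.finite, smul_comm] at hX
      have := nnreal_smul_mono t⁻¹ hX
      rwa [inv_smul_smul₀ ht.ne'] at this
    exact hor.imp (aux _) (aux _)

theorem MonoConv.smul {R : ℕ → Measure Ω} (h : MonoConv R P) (t : ℝ≥0) :
    MonoConv (fun n => t • R n) (t • P) := by
  refine ⟨fun n m hnm => nnreal_smul_mono t (h.1 hnm), fun n => nnreal_smul_mono t (h.2.1 n),
    fun B hB => ?_⟩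
  simp only [Measure.smul_apply, ENNReal.smul_def, smul_eq_mul]
  exact ENNReal.Tendsto.const_mul (h.2.2 B hB) (Or.inr ENNReal.coe_ne_top)

theorem AdaptedSeq.smul {R : ℕ → Measure Ω} {F : ℕ → Set (Set Ω)}
    (h : AdaptedSeq 𝒜 Q perp R F P) (ht : 0 < t) :
    AdaptedSeq 𝒜 Q perp (fun n => t • R n) F (t • P) := by
  refine ⟨⟨fun n => ?_, h.1.conv.smul t, h.1.mono⟩, fun n => ?_⟩
  · obtain ⟨α, hα⟩ := h.1.simple n
    exact ⟨_, hα.smul ht⟩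
  · obtain ⟨α, hα⟩ := isAdapted_iff.1 (h.2 n)
    exact isAdapted_iff.2 ⟨_, hα.smul ht⟩

theorem mem_adaptedLimits_iff : P ∈ adaptedLimits 𝒜 Q perp ↔ P ∈ finMeasures Ω ∧
    IsSubadditive 𝒜 Q P ∧ ∃ R F, AdaptedSeq 𝒜 Q perp R F P :=
  ⟨fun h => ⟨h.1.1, h.2⟩, fun ⟨h1, h2, R, F, h⟩ => ⟨⟨h1, R, F, h.1⟩, h2, R, F, h⟩⟩

theorem adaptedLimits.smul (h : P ∈ adaptedLimits 𝒜 Q perp) (ht : 0 < t) :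
    t • P ∈ adaptedLimits 𝒜 Q perp := by
  rw [mem_adaptedLimits_iff] at h ⊢
  obtain ⟨h1, h2, R, F, h3⟩ := h
  exact ⟨finMeasures.smul h1 ht, h2.smul ht, _, _, h3.smul ht⟩

/-! ### Base measures -/

theorem adaptedSeq_base (hA : A ∈ 𝒜) :
    AdaptedSeq 𝒜 Q perp (fun _ => Q A) (fun _ => {A}) (Q A) := by
  have hrep : Represents 𝒜 Q perp {A} (fun _ => 1) (Q A) := by
    refine ⟨⟨finite_singleton A, singleton_nonempty A, singleton_subset_iff.2 hA, ?_⟩,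
      fun _ _ => one_pos, ?_⟩
    · rintro B rfl C rfl
      exact Or.inr (Or.inl Subset.rfl)
    · rw [finsum_mem_singleton, one_smul]
  refine ⟨⟨fun _ => ⟨_, hrep⟩, ⟨monotone_const, fun _ => le_rfl, fun B _ => tendsto_const_nhds⟩,
    fun _ => ⟨_, IsFRM.id _⟩⟩, fun _ => ⟨_, hrep, ?_⟩⟩
  rintro B C ⟨rfl, rfl, hne, -⟩
  exact absurd rfl hne

theorem struct_singleton : struct ({A} : Set (Set Ω)) = {A} := by
  refine struct_subset.antisymm ?_
  rintro B rfl
  refine IsRoot.mem_struct ⟨rfl, ?_⟩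
  rintro ⟨C, rfl, h⟩
  exact h.ne rfl

theorem limForest_singleton (hb : IsClusteringBase 𝒜 Q perp) (hA : A ∈ 𝒜) :
    limForest (fun _ => ({A} : Set (Set Ω))) = {A} := by
  rw [limForest_eq (fun n => (adaptedSeq_base hA).1.isLaminar hb n) (Z := fun _ => id)
    fun n => IsFRM.id _]
  simp [struct_singleton, iUnion_const]

theorem base_mem_adaptedLimits (hb : IsClusteringBase 𝒜 Q perp) (hA : A ∈ 𝒜) :
    Q A ∈ adaptedLimits 𝒜 Q perp := by
  refine mem_adaptedLimits_iff.2 ⟨hb.mem_finMeasures A hA, ?_, _, _, adaptedSeq_base hA⟩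
  intro a a' B B' ha ha' hle hle' _
  have h1 := hb.base_subset_support ha hle
  have h2 := hb.base_subset_support ha' hle'
  rw [hb.fitted A hA] at h1 h2
  exact ⟨Q A, ⟨le_rfl, A, ⟨hA, 1, one_pos, (one_smul _ _).symm⟩, union_subset h1 h2⟩, Or.inl hle⟩

/-! ### Adding a base measure -/

section AddBase

variable {β : ℝ≥0}

/-- The level on `E` of the base measure `β • Q A`. -/
noncomputable def baseLevel (Q : Set Ω → Measure Ω) (β : ℝ≥0) (A E : Set Ω) : ℝ≥0 :=
  β * (Q A E).toNNReal

theorem coe_baseLevel (hb : IsClusteringBase 𝒜 Q perp) (hA : A ∈ 𝒜) (E : Set Ω) :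
    (baseLevel Q β A E : ℝ≥0∞) = β * Q A E := by
  rw [baseLevel, ENNReal.coe_mul, ENNReal.coe_toNNReal
    ((hb.apply_le_one hA E).trans_lt ENNReal.one_lt_top).ne]

theorem baseLevel_smul_le (hb : IsClusteringBase 𝒜 Q perp) (hA : A ∈ 𝒜) (hE : E ∈ 𝒜)
    (hEA : E ⊆ A) : baseLevel Q β A E • Q E ≤ β • Q A :=
  nnreal_smul_le_of_subset hb hE hA hEA (coe_baseLevel hb hA E).le

theorem coe_baseLevel_mul (hb : IsClusteringBase 𝒜 Q perp) (hA : A ∈ 𝒜) (hE : E ∈ 𝒜)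
    (hEA : E ⊆ A) (hBE : B ⊆ E) :
    (baseLevel Q β A E : ℝ≥0∞) * Q E B = baseLevel Q β A B := by
  rw [coe_baseLevel hb hA, coe_baseLevel hb hA, mul_assoc, ← hb.apply_inter hE hA hEA,
    inter_eq_left.2 hBE]

/-- A base measure below `β • Q A + P` is below `β • Q A` or exceeds it by a base measure
below `P`. -/
theorem base_le_add_cases (hb : IsClusteringBase 𝒜 Q perp) (hA : A ∈ 𝒜) (hE : E ∈ 𝒜)
    (hEA : E ⊆ A) {γ : ℝ≥0} (h : γ • Q E ≤ β • Q A + P) :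
    γ ≤ baseLevel Q β A E ∨ ∃ δ, 0 < δ ∧ γ = baseLevel Q β A E + δ ∧ δ • Q E ≤ P := by
  rcases le_or_gt γ (baseLevel Q β A E) with h1 | h1
  · exact Or.inl h1
  · refine Or.inr ⟨γ - baseLevel Q β A E, tsub_pos_of_lt h1, (add_tsub_cancel_of_le h1.le).symm,
      Measure.le_iff.2 fun B _ => ?_⟩
    -- On `E` the measure `β • Q A` equals `q • Q E`. This finite amount can be cancelled from the
    -- inequality, and the excess `δ` is left below `P`.
    set q := baseLevel Q β A E with hq
    set δ := γ - q with hδ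
    have hγ : γ = q + δ := (add_tsub_cancel_of_le h1.le).symm
    have h2 := h (B ∩ E)
    rw [Measure.add_apply] at h2
    simp only [Measure.smul_apply, ENNReal.smul_def, smul_eq_mul] at h2 ⊢
    rw [hb.apply_inter_self hE, hb.apply_inter hE hA hEA, ← mul_assoc, ← coe_baseLevel hb hA,
      ← hq, hγ, ENNReal.coe_add, add_mul] at h2
    have hfin : (q : ℝ≥0∞) * Q E B ≠ ∞ := ENNReal.mul_ne_top ENNReal.coe_ne_top
      ((hb.apply_le_one hE B).trans_lt ENNReal.one_lt_top).ne
    exact ((ENNReal.add_le_add_iff_left hfin).1 h2).trans (measure_mono inter_subset_left)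

theorem add_base_le (hb : IsClusteringBase 𝒜 Q perp) (hA : A ∈ 𝒜) (hE : E ∈ 𝒜)
    (hEA : E ⊆ A) {δ : ℝ≥0} (h : δ • Q E ≤ P) :
    (baseLevel Q β A E + δ) • Q E ≤ β • Q A + P := by
  rw [add_smul]
  exact add_le_add (baseLevel_smul_le hb hA hE hEA) h

theorem support_add_base (hb : IsClusteringBase 𝒜 Q perp) (hA : A ∈ 𝒜) (hβ : 0 < β)
    (hP : P.support ⊆ A) : (β • Q A + P).support = A := by
  rw [Measure.support_add, support_nnreal_smul hβ, hb.fitted A hA, union_eq_left.2 hP]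

/-- Dominating a base measure below `β • Q A + P` around a larger set. -/
theorem exists_base_add (hb : IsClusteringBase 𝒜 Q perp) (hA : A ∈ 𝒜)
    (hP : P.support ⊆ A) (hE : E ∈ 𝒜) {γ δ : ℝ≥0}
    (hγ : γ = baseLevel Q β A E + δ) {S : Set Ω} (h : ∃ b' ∈ baseBelow 𝒜 Q P S, δ • Q E ≤ b')
    (hδ : 0 < δ) : ∃ b' ∈ baseBelow 𝒜 Q (β • Q A + P) S, γ • Q E ≤ b' := by
  obtain ⟨b', ⟨hbP, E', hE', hSE'⟩, hle⟩ := h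
  have hEE' : E ⊆ E' := hb.base_subset_of_le ⟨hE, δ, hδ, rfl⟩ hE' hle
  have hE'A : E' ⊆ A := (hb.base_subset_support hE' hbP).trans hP
  obtain ⟨hE'𝒜, ε, hε, rfl⟩ := hE'
  refine ⟨(baseLevel Q β A E' + ε) • Q E', ⟨add_base_le hb hA hE'𝒜 hE'A hbP, E',
    ⟨hE'𝒜, _, by positivity, rfl⟩, hSE'⟩, ?_⟩
  rw [hγ, add_smul, add_smul]
  refine add_le_add (nnreal_smul_le_of_subset hb hE hE'𝒜 hEE' ?_) hle
  rw [coe_baseLevel_mul hb hA hE'𝒜 hE'A hEE']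

/-- If one of the two base measures stays below `β • Q A`, that measure is the bound. Otherwise the
excesses of both lie below `P`, subadditivity of `P` applies to them, and its output is lifted again
by the level of `β • Q A`. -/
theorem IsSubadditive.add_base (hb : IsClusteringBase 𝒜 Q perp) (hA : A ∈ 𝒜) (hβ : 0 < β)
    (hP : P.support ⊆ A) (hsub : IsSubadditive 𝒜 Q P) : IsSubadditive 𝒜 Q (β • Q A + P) := by
  intro a₁ a₂ E₁ E₂ ha₁ ha₂ hle₁ hle₂ hpos
  have hs := support_add_base hb hA hβ hP
  have h1 : E₁ ⊆ A := hs ▸ hb.base_subset_support ha₁ hle₁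
  have h2 : E₂ ⊆ A := hs ▸ hb.base_subset_support ha₂ hle₂
  have hbase : β • Q A ∈ baseBelow 𝒜 Q (β • Q A + P) (E₁ ∪ E₂) :=
    ⟨Measure.le_add_right le_rfl, A, ⟨hA, β, hβ, rfl⟩, union_subset h1 h2⟩
  obtain ⟨hE₁, γ₁, hγ₁, rfl⟩ := ha₁
  obtain ⟨hE₂, γ₂, hγ₂, rfl⟩ := ha₂
  have small : ∀ {E} {γ : ℝ≥0}, E ∈ 𝒜 → E ⊆ A → γ ≤ baseLevel Q β A E → γ • Q E ≤ β • Q A :=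
    fun hE hEA hγ => nnreal_smul_le_of_subset hb hE hA hEA
      ((ENNReal.coe_le_coe.2 hγ).trans (coe_baseLevel hb hA _).le)
  rcases base_le_add_cases hb hA hE₁ h1 hle₁ with h3 | ⟨δ₁, hδ₁, he₁, hd₁⟩
  · exact ⟨_, hbase, Or.inl (small hE₁ h1 h3)⟩
  rcases base_le_add_cases hb hA hE₂ h2 hle₂ with h3 | ⟨δ₂, hδ₂, he₂, hd₂⟩
  · exact ⟨_, hbase, Or.inr (small hE₂ h2 h3)⟩
  have hpos' : 0 < P (E₁ ∩ E₂) := by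
    refine pos_iff_ne_zero.2 fun h0 => hpos.ne' ?_
    have h4 : Q E₁ (E₁ ∩ E₂) = 0 := absolutelyContinuous_of_nnreal_smul_le hδ₁ hd₁ h0
    have h5 : Q A (E₁ ∩ E₂) = 0 := by
      have := hb.apply_inter hE₁ hA h1 (E₁ ∩ E₂)
      rwa [inter_eq_left.2 inter_subset_left, h4, mul_zero] at this
    simp [h0, h5]
  obtain ⟨b', hb', hor⟩ := hsub _ _ E₁ E₂ ⟨hE₁, δ₁, hδ₁, rfl⟩ ⟨hE₂, δ₂, hδ₂, rfl⟩ hd₁ hd₂ hpos'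
  rcases hor with hor | hor
  · obtain ⟨c, hc, hle⟩ := exists_base_add hb hA hP hE₁ he₁ ⟨b', hb', hor⟩ hδ₁
    exact ⟨c, hc, Or.inl hle⟩
  · obtain ⟨c, hc, hle⟩ := exists_base_add hb hA hP hE₂ he₂ ⟨b', hb', hor⟩ hδ₂
    exact ⟨c, hc, Or.inr hle⟩

open Classical in
/-- The coefficients of `β • Q A + R`. -/
noncomputable def addCoeff (F : Set (Set Ω)) (α : Set Ω → ℝ≥0) (β : ℝ≥0) (A X : Set Ω) : ℝ≥0 :=
  (if X ∈ F then α X else 0) + if X = A then β else 0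

theorem Represents.node_subset (hb : IsClusteringBase 𝒜 Q perp)
    (h : Represents 𝒜 Q perp F α R) (hRP : R ≤ P) : ∀ B ∈ F, B ⊆ P.support := fun B hB =>
  hb.base_subset_support ⟨h.1.subset hB, α B, h.2.1 B hB, rfl⟩ ((h.smul_le hB).trans hRP)

theorem sum_addCoeff {M : Type*} [AddCommMonoid M] [Module ℝ≥0 M] (hF : F.Finite)
    (f : Set Ω → M) : ∑ X ∈ (hF.insert A).toFinset, addCoeff F α β A X • f X =
      β • f A + ∑ X ∈ hF.toFinset, α X • f X := by
  classical
  simp only [addCoeff, add_smul, Finset.sum_add_distrib]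
  rw [add_comm]
  congr 1
  · rw [Finset.sum_eq_single A]
    · rw [if_pos rfl]
    · intro B _ hB
      rw [if_neg hB, zero_smul]
    · intro h
      simp at h
  · have h1 : ∑ X ∈ hF.toFinset, α X • f X =
        ∑ X ∈ hF.toFinset, (if X ∈ F then α X else 0) • f X :=
      Finset.sum_congr rfl fun X hX => by rw [if_pos (by simpa using hX)]
    rw [h1]
    refine (Finset.sum_subset (fun X hX => ?_) fun X _ hX => ?_).symm
    · have hX : X ∈ F := by simpa using hX
      simp [hX]
    · rw [if_neg (by simpa using hX), zero_smul]

theorem Represents.add_base (hA : A ∈ 𝒜) (hβ : 0 < β)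
    (hFA : ∀ B ∈ F, B ⊆ A) (h : Represents 𝒜 Q perp F α R) :
    Represents 𝒜 Q perp (insert A F) (addCoeff F α β A) (β • Q A + R) := by
  refine ⟨⟨h.1.finite.insert A, insert_nonempty A F, insert_subset hA h.1.subset, ?_⟩, ?_, ?_⟩
  · rintro B (rfl | hB) C (rfl | hC)
    · exact Or.inr (Or.inl Subset.rfl)
    · exact Or.inr (Or.inr (hFA C hC))
    · exact Or.inr (Or.inl (hFA B hB))
    · exact h.1.forest B hB C hC
  · rintro B (rfl | hB)
    · simp only [addCoeff, if_true]
      positivity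
    · simp only [addCoeff, if_pos hB]
      exact add_pos_of_pos_of_nonneg (h.2.1 B hB) zero_le
  · obtain ⟨h1, h2, rfl⟩ := h
    rw [finsum_mem_eq_finite_toFinset_sum _ (h1.finite.insert A), sum_addCoeff h1.finite,
      finsum_mem_eq_finite_toFinset_sum _ h1.finite]

theorem level_add_base (hb : IsClusteringBase 𝒜 Q perp) (hA : A ∈ 𝒜)
    (hβ : 0 < β) (hFA : ∀ B ∈ F, B ⊆ A) (h : Represents 𝒜 Q perp F α R) (hB : B ∈ F) :
    level Q (insert A F) (addCoeff F α β A) B = baseLevel Q β A B • Q B + level Q F α B := by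
  classical
  refine Measure.ext fun S _ => ?_
  rw [Measure.add_apply, h.level_apply hb hB,
    (h.add_base hA hβ hFA).level_apply hb (mem_insert_of_mem A hB)]
  have h1 := sum_addCoeff (A := A) (α := α) (β := β) h.1.finite
    fun E => if B ⊆ E then Q E (S ∩ B) else 0
  simp only [ENNReal.smul_def, smul_eq_mul, mul_ite, mul_zero] at h1
  rw [h1, if_pos (hFA B hB), hb.apply_inter (h.1.subset hB) hA (hFA B hB)]
  simp only [Measure.smul_apply, ENNReal.smul_def, smul_eq_mul]
  rw [coe_baseLevel hb hA, mul_assoc]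

theorem IsLaminar.exists_directParent (hF : IsLaminar F) {A₁ A₂ : Set Ω}
    (hs : DirectSiblings F A₁ A₂) (hne : (ancestors F A₁).Nonempty) :
    ∃ A', IsDirectParent F A' A₁ ∧ IsDirectParent F A' A₂ := by
  have hfin : (ancestors F A₁).Finite := hF.finite.subset fun _ h => h.1
  obtain ⟨D, hD⟩ := hfin.exists_minimal hne
  have : IsDirectParent F D A₁ := ⟨hD.1, fun ⟨E, hE, hED⟩ => hED.not_subset (hD.2 hE hED.subset)⟩
  refine ⟨D, this, ?_⟩
  rwa [IsDirectParent, ← hs.2.2.2]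

/-- Adding `β • Q A` raises a level from `l` to `q + l`. A base measure reaching `t' * (q + l)` must
still exceed `q` by at least `s * l` so that the old motivation applies; `(s * l + q) / (q + l)` is
the smallest such factor. -/
theorem exists_motivating_factor {s l q : ℝ≥0} (hl : 0 < l) (hs : s < 1) :
    ∃ t < 1, ∀ t', t ≤ t' → s * l + q ≤ t' * (q + l) := by
  have hpos : 0 < q + l := by positivity
  refine ⟨(s * l + q) / (q + l), ?_, fun t' ht' => ?_⟩
  · rw [div_lt_one hpos, add_comm]
    have := mul_lt_mul_of_pos_right hs hl
    rw [one_mul] at this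
    gcongr
  · rwa [div_le_iff₀ hpos] at ht'

/-- Siblings of the enlarged forest are the old ones. Groundedness is automatic because of the new
root, and the other conditions reduce to those for `P` by splitting each base measure into its level
in `β • Q A` and its excess. -/
theorem IsAdaptedRep.add_base (hb : IsClusteringBase 𝒜 Q perp) (hA : A ∈ 𝒜) (hβ : 0 < β)
    (hP : P.support ⊆ A) (h : IsAdaptedRep 𝒜 Q perp P R F α) (hRP : R ≤ P) :
    IsAdaptedRep 𝒜 Q perp (β • Q A + P) (β • Q A + R) (insert A F) (addCoeff F α β A) := by
  have hFA : ∀ B ∈ F, B ⊆ A := fun B hB => (h.rep.node_subset hb hRP B hB).trans hP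
  have hsupp := support_add_base hb hA hβ hP
  have hne : ∀ {A₁ A₂}, DirectSiblings F A₁ A₂ → A₁ ≠ A := by
    rintro A₁ A₂ hs rfl
    exact notMem_lower hFA hs.mem_lower
  have hrep := h.rep.add_base hA hβ hFA
  refine ⟨hrep, fun A₁ A₂ hs' hn => ?_, fun A₁ A₂ hs' b hbb => ?_, fun A₁ A₂ hs' => ?_⟩
  · have hs := (directSiblings_insert_iff hFA).1 hs'
    refine (hb.isLaminar hrep.1).exists_directParent hs' ?_
    rw [ancestors_insert hFA hs.1 (hne hs)]
    exact insert_nonempty _ _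
  · have hs := (directSiblings_insert_iff hFA).1 hs'
    obtain ⟨hbP, E, hE, hAE⟩ := hbb
    have hEA : E ⊆ A := hsupp ▸ hb.base_subset_support hE hbP
    have hset : {X ∈ insert A F | ancestors (insert A F) X = ancestors (insert A F) A₁} ⊆
        {X ∈ F | ancestors F X = ancestors F A₁} := by
      rintro X ⟨hX, hXe⟩
      by_cases hX1 : X = A₁
      · subst hX1
        exact ⟨hs.1, rfl⟩
      · have := (directSiblings_insert_iff hFA).1 ⟨hX, hs'.1, hX1, hXe⟩
        exact ⟨this.1, this.2.2.2⟩
    have hU := sUnion_subset_sUnion hset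
    have hUA : ⋃₀ {X ∈ F | ancestors F X = ancestors F A₁} ⊆ A :=
      sUnion_subset fun X hX => hFA X hX.1
    obtain ⟨hE𝒜, γ, hγ, rfl⟩ := hE
    rcases base_le_add_cases hb hA hE𝒜 hEA hbP with h3 | ⟨δ, hδ, he, hd⟩
    · exact ⟨β • Q A, ⟨Measure.le_add_right le_rfl, A, ⟨hA, β, hβ, rfl⟩, hU.trans hUA⟩,
        nnreal_smul_le_of_subset hb hE𝒜 hA hEA
          ((ENNReal.coe_le_coe.2 h3).trans (coe_baseLevel hb hA _).le)⟩
    · obtain ⟨c, ⟨hc, C, hC, hUC⟩, hle⟩ := exists_base_add hb hA hP hE𝒜 he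
        (h.fine A₁ A₂ hs _ ⟨hd, E, ⟨hE𝒜, δ, hδ, rfl⟩, hAE⟩) hδ
      exact ⟨c, ⟨hc, C, hC, hU.trans hUC⟩, hle⟩
  · have hs := (directSiblings_insert_iff hFA).1 hs'
    obtain ⟨s, hs0, hs1, hm⟩ := h.motivated A₁ A₂ hs
    obtain ⟨l₁, hl₁, -, hle₁⟩ := h.rep.exists_level_eq hb hs.1
    obtain ⟨l₂, hl₂, -, hle₂⟩ := h.rep.exists_level_eq hb hs.2.1
    obtain ⟨t₁, ht₁, hmt₁⟩ := exists_motivating_factor (q := baseLevel Q β A A₁) hl₁ hs1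
    obtain ⟨t₂, ht₂, hmt₂⟩ := exists_motivating_factor (q := baseLevel Q β A A₂) hl₂ hs1
    have h12 : (1 / 2 : ℝ≥0) < 1 := by
      rw [div_lt_one (by norm_num)]; norm_num
    -- The two thresholds may be zero when nothing forces otherwise in their statement; `1 / 2`
    -- guarantees a positive factor.
    refine ⟨max (1 / 2) (max t₁ t₂), lt_max_of_lt_left (by positivity),
      max_lt h12 (max_lt ht₁ ht₂), ?_⟩
    rintro b ⟨E', hE'⟩ hor ⟨hbP, E, hE, hAE⟩
    have hEA : E ⊆ A := hsupp ▸ hb.base_subset_support hE hbP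
    obtain ⟨hE𝒜, γ, hγ, rfl⟩ := hE
    have key : ∀ {X : Set Ω} {l t : ℝ≥0}, X ∈ F → X ⊆ E → 0 < l → level Q F α X = l • Q X →
        s * l + baseLevel Q β A X ≤ t * (baseLevel Q β A X + l) →
        t • level Q (insert A F) (addCoeff F α β A) X ≤ γ • Q E →
        ∃ δ : ℝ≥0, 0 < δ ∧ δ • Q E ≤ P ∧ s • level Q F α X ≤ δ • Q E := by
      intro X l t hX hXE hl hlX hst hle
      have hX𝒜 := h.rep.1.subset hX
      rw [level_add_base hb hA hβ hFA h.rep hX, hlX, ← add_smul, smul_smul] at hle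
      have h4 := hle X
      simp only [Measure.smul_apply, ENNReal.smul_def, smul_eq_mul, hb.apply_self hX𝒜,
        mul_one] at h4
      have h5 := (ENNReal.coe_le_coe.2 hst).trans h4
      rcases base_le_add_cases hb hA hE𝒜 hEA hbP with h3 | ⟨δ, hδ, he, hd⟩
      · exfalso
        -- A base measure without excess has at most the mass `baseLevel Q β A X` on `X`, too little
        -- by `s * l > 0`.
        have h6 : (γ : ℝ≥0∞) * Q E X ≤ baseLevel Q β A X := by
          rw [← coe_baseLevel_mul hb hA hE𝒜 hEA hXE]
          exact mul_le_mul_left (ENNReal.coe_le_coe.2 h3) _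
        have h7 := ENNReal.coe_le_coe.1 (h5.trans h6)
        have h8 : 0 < s * l := mul_pos hs0 hl
        exact h8.not_ge (by simpa using h7)
      · refine ⟨δ, hδ, hd, ?_⟩
        rw [hlX, smul_smul]
        refine nnreal_smul_le_of_subset hb hX𝒜 hE𝒜 hXE ?_
        rw [he, ENNReal.coe_add, ENNReal.coe_add, add_mul, coe_baseLevel_mul hb hA hE𝒜 hEA hXE,
          add_comm ((s * l : ℝ≥0) : ℝ≥0∞)] at h5
        exact (ENNReal.add_le_add_iff_left ENNReal.coe_ne_top).1 h5
    rcases hor with hor | hor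
    · obtain ⟨δ, hδ, hd, hle⟩ := key hs.1 (subset_union_left.trans hAE) hl₁ hle₁
        (hmt₁ _ ((le_max_left _ _).trans (le_max_right _ _))) hor
      exact hm _ ⟨E, hE𝒜, δ, hδ, rfl⟩ (Or.inl hle) ⟨hd, E, ⟨hE𝒜, δ, hδ, rfl⟩, hAE⟩
    · obtain ⟨δ, hδ, hd, hle⟩ := key hs.2.1 (subset_union_right.trans hAE) hl₂ hle₂
        (hmt₂ _ ((le_max_right _ _).trans (le_max_right _ _))) hor
      exact hm _ ⟨E, hE𝒜, δ, hδ, rfl⟩ (Or.inr hle) ⟨hd, E, ⟨hE𝒜, δ, hδ, rfl⟩, hAE⟩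

variable {R : ℕ → Measure Ω} {F : ℕ → Set (Set Ω)}

theorem AdaptedSeq.node_subset (hb : IsClusteringBase 𝒜 Q perp)
    (h : AdaptedSeq 𝒜 Q perp R F P) (n : ℕ) : ∀ B ∈ F n, B ⊆ P.support := by
  obtain ⟨α, hα⟩ := h.1.simple n
  exact hα.node_subset hb (h.1.conv.2.1 n)

theorem AdaptedSeq.add_base (hb : IsClusteringBase 𝒜 Q perp) (hA : A ∈ 𝒜) (hβ : 0 < β)
    (hP : P.support ⊆ A) (h : AdaptedSeq 𝒜 Q perp R F P) :
    AdaptedSeq 𝒜 Q perp (fun n => β • Q A + R n) (fun n => insert A (F n)) (β • Q A + P) := by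
  have hFA : ∀ n, ∀ B ∈ F n, B ⊆ A := fun n B hB => (h.node_subset hb n B hB).trans hP
  have hlam := h.1.isLaminar hb
  refine ⟨⟨fun n => ?_, ⟨?_, ?_, ?_⟩, fun n => ?_⟩, fun n => ?_⟩
  · obtain ⟨α, hα⟩ := h.1.simple n
    exact ⟨_, hα.add_base hA hβ (hFA n)⟩
  · exact fun n m hnm => add_le_add le_rfl (h.1.conv.1 hnm)
  · exact fun n => add_le_add le_rfl (h.1.conv.2.1 n)
  · intro B hB
    simp only [Measure.add_apply]
    exact tendsto_const_nhds.add (h.1.conv.2.2 B hB)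
  · obtain ⟨ζ, hζ⟩ := h.1.mono n
    exact ⟨_, hζ.insert (hlam n) (hlam (n + 1)) (hFA n) (hFA (n + 1))⟩
  · obtain ⟨α, hα⟩ := isAdapted_iff.1 (h.2 n)
    exact isAdapted_iff.2 ⟨_, hα.add_base hb hA hβ hP (h.1.conv.2.1 n)⟩

theorem AdaptedSeq.limForest_insert (hs : IsStableClusteringBase 𝒜 Q perp) (hA : A ∈ 𝒜)
    (hβ : 0 < β) (hP : P.support ⊆ A) (h : AdaptedSeq 𝒜 Q perp R F P) :
    limForest (fun n => insert A (F n)) = insert A (lower (limForest F)) := by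
  classical
  have hb := hs.base
  have hFA : ∀ n, ∀ B ∈ F n, B ⊆ A := fun n B hB => (h.node_subset hb n B hB).trans hP
  have hlam := h.1.isLaminar hb
  obtain ⟨Z, hZ, -, hlim, -⟩ := h.1.exists_chain hs
  rw [limForest_eq (fun n => (h.add_base hb hA hβ hP).1.isLaminar hb n)
    fun n => (hZ n).insert (hlam 0) (hlam n) (hFA 0) (hFA n)]
  rw [struct_insert (hFA 0), image_insert_eq, ← hlim.bijOn_lower.image_eq, lower_struct (hlam 0)]
  congr 1
  · simp [iUnion_const]
  · refine image_congr fun B hB => ?_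
    have : B ≠ A := fun he => notMem_lower (hFA 0) (he ▸ hB)
    simp only [if_neg this]

theorem finMeasures.add {P P' : Measure Ω} (h : P ∈ finMeasures Ω) (h' : P' ∈ finMeasures Ω) :
    P + P' ∈ finMeasures Ω := by
  obtain ⟨h1, h2, h3⟩ := h
  obtain ⟨h1', h2', h3'⟩ := h'
  refine ⟨inferInstance, fun h0 => h2 ?_, inferInstance⟩
  refine le_antisymm ?_ (Measure.zero_le P)
  rw [← h0]
  exact Measure.le_add_right le_rfl

theorem adaptedLimits.add_base (hb : IsClusteringBase 𝒜 Q perp) (hA : A ∈ 𝒜) (hβ : 0 < β)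
    (hP : P.support ⊆ A) (h : P ∈ adaptedLimits 𝒜 Q perp) :
    β • Q A + P ∈ adaptedLimits 𝒜 Q perp := by
  rw [mem_adaptedLimits_iff] at h ⊢
  obtain ⟨h1, h2, R, F, h3⟩ := h
  exact ⟨finMeasures.add (finMeasures.smul (hb.mem_finMeasures A hA) hβ) h1,
    h2.add_base hb hA hβ hP, _, _, h3.add_base hb hA hβ hP⟩

end AddBase

end Closure

/-! ### Forests assembled from disjoint pieces. -/

section Unions

variable {Ω : Type*} {ι : Type*} {S : ι → Set Ω} {G G' : ι → Set (Set Ω)} {A B : Set Ω} {i j : ι}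

/-- Families of non-empty sets living on disjoint pieces. -/
structure IsPieces (S : ι → Set Ω) (G : ι → Set (Set Ω)) : Prop where
  disjoint : ∀ i j, i ≠ j → Disjoint (S i) (S j)
  nonempty : ∀ i, ∀ A ∈ G i, A.Nonempty
  subset : ∀ i, ∀ A ∈ G i, A ⊆ S i

namespace IsPieces

theorem eq_of_subset (h : IsPieces S G) (hA : A ∈ G i) (hB : B ⊆ S j) (hAB : A ⊆ B) : i = j := by
  by_contra hne
  exact (h.nonempty i A hA).ne_empty
    (disjoint_self.1 ((h.disjoint i j hne).mono (h.subset i A hA) (hAB.trans hB)))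

theorem mem_of_subset (h : IsPieces S G) (hA : A ∈ G i) (hB : B ∈ ⋃ i, G i) (hAB : A ⊆ B) :
    B ∈ G i := by
  obtain ⟨j, hj⟩ := mem_iUnion.1 hB
  rwa [h.eq_of_subset hA (h.subset j B hj) hAB]

theorem ancestors_eq (h : IsPieces S G) (hA : A ∈ G i) :
    ancestors (⋃ i, G i) A = ancestors (G i) A := by
  ext B
  exact ⟨fun hB => ⟨h.mem_of_subset hA hB.1 hB.2.subset, hB.2⟩,
    fun hB => ⟨mem_iUnion.2 ⟨i, hB.1⟩, hB.2⟩⟩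

theorem directSiblings_iff (h : IsPieces S G) (hA : A ∈ G i) (hB : B ∈ G i) :
    DirectSiblings (⋃ i, G i) A B ↔ DirectSiblings (G i) A B := by
  simp only [DirectSiblings, h.ancestors_eq hA, h.ancestors_eq hB, hA, hB, true_and,
    mem_iUnion_of_mem i hA, mem_iUnion_of_mem i hB]

theorem isRoot_iff (h : IsPieces S G) (hA : A ∈ G i) :
    IsRoot (⋃ i, G i) A ↔ IsRoot (G i) A := by
  rw [Clustering.isRoot_iff, Clustering.isRoot_iff, h.ancestors_eq hA]
  simp only [hA, mem_iUnion_of_mem i hA]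

/-- Ancestors stay within one piece. Nodes of different pieces can be siblings only if they are
roots, and roots belong to the structure of their piece anyway. -/
theorem struct_iUnion (h : IsPieces S G) : struct (⋃ i, G i) = ⋃ i, struct (G i) := by
  ext A
  constructor
  · intro hA
    obtain ⟨i, hi⟩ := mem_iUnion.1 hA.1
    refine mem_iUnion.2 ⟨i, ?_⟩
    rw [mem_struct_iff] at hA
    rcases hA with hA | ⟨-, B, hB⟩
    · exact ((h.isRoot_iff hi).1 hA).mem_struct
    · obtain ⟨j, hj⟩ := mem_iUnion.1 hB.2.1
      by_cases hij : i = j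
      · subst hij
        exact lower_subset_struct ((h.directSiblings_iff hi hj).1 hB).mem_lower
      · refine IsRoot.mem_struct ⟨hi, ?_⟩
        rintro ⟨C, hC, hAC⟩
        exact hij (h.eq_of_subset hj (h.subset i C hC)
          (hB.ssubset_of_ssubset (mem_iUnion_of_mem i hC) hAC).subset).symm
  · intro hA
    obtain ⟨i, hi⟩ := mem_iUnion.1 hA
    have hi' := hi
    rw [mem_struct_iff] at hi
    rcases hi with hi | ⟨-, B, hB⟩
    · exact ((h.isRoot_iff hi'.1).2 hi).mem_struct
    · exact lower_subset_struct ((h.directSiblings_iff hB.1 hB.2.1).2 hB).mem_lower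

theorem mono (h : IsPieces S G) (hG : ∀ i, G' i ⊆ G i) : IsPieces S G' :=
  ⟨h.disjoint, fun i A hA => h.nonempty i A (hG i hA), fun i A hA => h.subset i A (hG i hA)⟩

theorem mem_iff (h : IsPieces S G) : A ∈ G i ↔ A ∈ ⋃ i, G i ∧ A ⊆ S i := by
  constructor
  · exact fun hA => ⟨mem_iUnion_of_mem i hA, h.subset i A hA⟩
  · rintro ⟨hA, hAS⟩
    obtain ⟨j, hj⟩ := mem_iUnion.1 hA
    rwa [← h.eq_of_subset hj hAS Subset.rfl]

/-- Forest relating maps of pieces glue. -/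
theorem exists_isFRM (h : IsPieces S G) (h' : IsPieces S G') {ζ : ι → Set Ω → Set Ω}
    (hζ : ∀ i, IsFRM (ζ i) (G i) (G' i)) :
    ∃ ξ, IsFRM ξ (⋃ i, G i) (⋃ i, G' i) ∧ ∀ i, ∀ A ∈ G i, ξ A = ζ i A := by
  classical
  let ξ : Set Ω → Set Ω := fun A => if hA : ∃ i, A ∈ G i then ζ hA.choose A else A
  have hξ : ∀ i, ∀ A ∈ G i, ξ A = ζ i A := by
    intro i A hA
    have hex : ∃ i, A ∈ G i := ⟨i, hA⟩
    simp only [ξ, dif_pos hex]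
    rw [h.eq_of_subset hex.choose_spec (h.subset i A hA) Subset.rfl]
  have hmem : ∀ i, ∀ A ∈ G i, ξ A ∈ G' i := fun i A hA => hξ i A hA ▸ (hζ i).1.1.mapsTo hA
  refine ⟨ξ, ⟨⟨⟨?_, ?_, ?_⟩, ?_⟩, ?_⟩, hξ⟩
  · intro A hA
    obtain ⟨i, hi⟩ := mem_iUnion.1 hA
    exact mem_iUnion_of_mem i (hmem i A hi)
  · intro A hA B hB hAB
    obtain ⟨i, hi⟩ := mem_iUnion.1 hA
    obtain ⟨j, hj⟩ := mem_iUnion.1 hB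
    obtain rfl := h'.eq_of_subset (hmem i A hi) (h'.subset j _ (hmem j B hj)) hAB.le
    rw [hξ i A hi, hξ i B hj] at hAB
    exact (hζ i).1.1.injOn hi hj hAB
  · intro B hB
    obtain ⟨i, hi⟩ := mem_iUnion.1 hB
    obtain ⟨A, hA, rfl⟩ := (hζ i).1.1.surjOn hi
    exact ⟨A, mem_iUnion_of_mem i hA, hξ i A hA⟩
  · intro A hA B hB
    obtain ⟨i, hi⟩ := mem_iUnion.1 hA
    obtain ⟨j, hj⟩ := mem_iUnion.1 hB
    by_cases hij : i = j
    · subst hij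
      rw [hξ i A hi, hξ i B hj]
      exact (hζ i).1.2 A hi B hj
    · exact ⟨fun hAB => absurd (h.eq_of_subset hi (h.subset j B hj) hAB) hij, fun hAB =>
        absurd (h'.eq_of_subset (hmem i A hi) (h'.subset j _ (hmem j B hj)) hAB) hij⟩
  · intro A hA
    obtain ⟨i, hi⟩ := mem_iUnion.1 hA
    rw [hξ i A hi]
    exact (hζ i).2 A hi

/-- A forest relating map restricts to pieces. -/
theorem isFRM_restrict (h : IsPieces S G) (h' : IsPieces S G') {ζ : Set Ω → Set Ω}
    (hζ : IsFRM ζ (⋃ i, G i) (⋃ i, G' i)) (i : ι) : IsFRM ζ (G i) (G' i) := by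
  have hmem : ∀ A ∈ G i, ζ A ∈ G' i := by
    intro A hA
    obtain ⟨j, hj⟩ := mem_iUnion.1 (hζ.1.1.mapsTo (mem_iUnion_of_mem i hA))
    rwa [h.eq_of_subset hA (h'.subset j _ hj) (hζ.2 A (mem_iUnion_of_mem i hA))]
  refine ⟨⟨⟨hmem, hζ.1.1.injOn.mono (subset_iUnion G i), ?_⟩, fun A hA B hB =>
    hζ.1.2 A (mem_iUnion_of_mem i hA) B (mem_iUnion_of_mem i hB)⟩,
    fun A hA => hζ.2 A (mem_iUnion_of_mem i hA)⟩
  intro B hB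
  obtain ⟨A, hA, rfl⟩ := hζ.1.1.surjOn (mem_iUnion_of_mem i hB)
  exact ⟨A, h.mem_iff.2 ⟨hA, (hζ.2 A hA).trans (h'.subset i _ hB)⟩, rfl⟩

end IsPieces

end Unions

/-! ### Gluing and restricting adapted sequences along separated closed covers. -/

section Pieces

variable {Ω : Type*} [TopologicalSpace Ω] [MeasurableSpace Ω] [OpensMeasurableSpace Ω]
  {𝒜 : Set (Set Ω)} {Q : Set Ω → Measure Ω} {perp : Set Ω → Set Ω → Prop}
  {P R a b : Measure Ω} {A B E : Set Ω} {F : Set (Set Ω)} {α : Set Ω → ℝ≥0}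
  {ι : Type*} [Fintype ι] {S : ι → Set Ω} {i j : ι}

/-- A finite cover of the support of `P` by separated closed sets. -/
structure IsPerpCover (perp : Set Ω → Set Ω → Prop) (P : Measure Ω) (S : ι → Set Ω) : Prop where
  isClosed : ∀ i, IsClosed (S i)
  perp : ∀ i j, i ≠ j → perp (S i) (S j)
  cover : P.support ⊆ ⋃ i, S i

theorem IsSeparation.exists_subset (h : IsSeparation 𝒜 perp) (hA : A ∈ 𝒜)
    (hS : ∀ i, IsClosed (S i)) (hp : ∀ i j, i ≠ j → perp (S i) (S j)) (hAS : A ⊆ ⋃ i, S i) :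
    ∃ i, A ⊆ S i := by
  let e := Fintype.equivFin ι
  obtain ⟨k, hk⟩ := h.connectedness A hA (Fintype.card ι) (fun k => S (e.symm k))
    (fun k => hS _) (fun k l hkl => hp _ _ fun he => hkl (e.symm.injective he))
    (hAS.trans (iUnion_subset fun i => by
      have := subset_iUnion (fun k => S (e.symm k)) (e i)
      simpa using this))
  exact ⟨_, hk⟩

namespace IsPerpCover

theorem disjoint (hb : IsClusteringBase 𝒜 Q perp) (hS : IsPerpCover perp P S) (hij : i ≠ j) :
    Disjoint (S i) (S j) :=
  hb.separation.disjoint (hS.isClosed i).measurableSet (hS.isClosed j).measurableSet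
    (hS.perp i j hij)

theorem exists_subset (hb : IsClusteringBase 𝒜 Q perp) (hS : IsPerpCover perp P S)
    (ha : IsBaseMeasureOn 𝒜 Q a A) (haP : a ≤ P) : ∃ i, A ⊆ S i :=
  hb.separation.exists_subset ha.1 hS.isClosed hS.perp
    ((hb.base_subset_support ha haP).trans hS.cover)

theorem base_subset (hb : IsClusteringBase 𝒜 Q perp) (hS : IsPerpCover perp P S)
    (ha : IsBaseMeasureOn 𝒜 Q a A) (haP : a ≤ P) (hB : B.Nonempty) (hBA : B ⊆ A)
    (hBS : B ⊆ S i) : A ⊆ S i := by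
  obtain ⟨j, hj⟩ := hS.exists_subset hb ha haP
  by_cases hij : i = j
  · rwa [hij]
  · exact absurd (disjoint_self.1 ((hS.disjoint hb hij).mono hBS (hBA.trans hj))) hB.ne_empty

theorem base_le_restrict (hb : IsClusteringBase 𝒜 Q perp) {T : Set Ω}
    (ha : IsBaseMeasureOn 𝒜 Q a A) (haP : a ≤ P) (hA : A ⊆ T) : a ≤ P.restrict T := by
  have : a = a.restrict A := by
    obtain ⟨hA, s, hs, rfl⟩ := ha
    rw [Measure.restrict_smul, hb.restrict_eq hA hA Subset.rfl, hb.apply_self hA, one_smul]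
  rw [this]
  exact Measure.restrict_mono hA haP

/-- A base set is connected, so one that contains a non-empty part of `S i` lies in `S i`. Hence all
conditions stated through `baseBelow` are local to the pieces. -/
theorem baseBelow_restrict (hb : IsClusteringBase 𝒜 Q perp) (hS : IsPerpCover perp P S)
    (hB : B.Nonempty) (hBS : B ⊆ S i) :
    baseBelow 𝒜 Q (P.restrict (S i)) B = baseBelow 𝒜 Q P B := by
  ext b
  constructor
  · rintro ⟨hbP, E, hE, hBE⟩
    exact ⟨hbP.trans Measure.restrict_le_self, E, hE, hBE⟩
  · rintro ⟨hbP, E, hE, hBE⟩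
    exact ⟨base_le_restrict hb hE hbP (hS.base_subset hb hE hbP hB hBE hBS), E, hE, hBE⟩

theorem support_restrict_subset_closed {T : Set Ω} (hT : IsClosed T) :
    (P.restrict T).support ⊆ T := by
  refine Measure.support_subset_of_isClosed hT ?_
  rw [mem_ae_iff, Measure.restrict_apply hT.measurableSet.compl, compl_inter_self, measure_empty]

theorem isSubadditive_restrict (hb : IsClusteringBase 𝒜 Q perp) (hS : IsPerpCover perp P S)
    (h : IsSubadditive 𝒜 Q P) (i : ι) : IsSubadditive 𝒜 Q (P.restrict (S i)) := by
  intro a a' A A' ha ha' hle hle' hpos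
  have hA := (hb.base_subset_support ha hle).trans (support_restrict_subset_closed (hS.isClosed i))
  have hA' := (hb.base_subset_support ha' hle').trans
    (support_restrict_subset_closed (hS.isClosed i))
  rw [hS.baseBelow_restrict hb ((hb.separation.nonempty A ha.1).mono subset_union_left)
    (union_subset hA hA')]
  exact h a a' A A' ha ha' (hle.trans Measure.restrict_le_self)
    (hle'.trans Measure.restrict_le_self) (hpos.trans_le (Measure.restrict_le_self _))

theorem isSubadditive_of_restrict (hb : IsClusteringBase 𝒜 Q perp) (hS : IsPerpCover perp P S)
    (h : ∀ i, IsSubadditive 𝒜 Q (P.restrict (S i))) : IsSubadditive 𝒜 Q P := by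
  intro a a' A A' ha ha' hle hle' hpos
  obtain ⟨i, hi⟩ := hS.exists_subset hb ha hle
  have hne : (A ∩ A').Nonempty := nonempty_of_measure_ne_zero hpos.ne'
  have hi' : A' ⊆ S i := hS.base_subset hb ha' hle' hne inter_subset_right
    (inter_subset_left.trans hi)
  rw [← hS.baseBelow_restrict hb ((hb.separation.nonempty A ha.1).mono subset_union_left)
    (union_subset hi hi')]
  refine h i a a' A A' ha ha' (base_le_restrict hb ha hle hi) (base_le_restrict hb ha' hle' hi') ?_
  rwa [Measure.restrict_apply' (hS.isClosed i).measurableSet,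
    inter_eq_left.2 (inter_subset_left.trans hi)]

theorem eq_sum_restrict (hb : IsClusteringBase 𝒜 Q perp) (hS : IsPerpCover perp P S)
    (hP : P ∈ finMeasures Ω) : P = ∑ i, P.restrict (S i) := by
  obtain ⟨h1, h2, h3⟩ := hP
  have h0 : P (⋃ i, S i)ᶜ = 0 := measure_mono_null (compl_subset_compl.2 hS.cover)
    Measure.measure_compl_support_of_innerRegular
  have h4 : P = P.restrict (⋃ i, S i) := by
    symm
    rw [Measure.restrict_eq_self_of_ae_mem]
    rw [ae_iff]
    exact h0
  rw [← Measure.sum_fintype, ← Measure.restrict_iUnion (fun i j hij => hS.disjoint hb hij)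
    fun i => (hS.isClosed i).measurableSet]
  exact h4

end IsPerpCover

/-! ### Gluing adapted sequences -/

section Sum

variable {G : ι → Set (Set Ω)} {α : ι → Set Ω → ℝ≥0} {R : ι → Measure Ω}

open Classical in
/-- Coefficients on a union of forests. -/
noncomputable def glueCoeff (G : ι → Set (Set Ω)) (α : ι → Set Ω → ℝ≥0) (X : Set Ω) : ℝ≥0 :=
  ∑ i, if X ∈ G i then α i X else 0

theorem glueCoeff_eq (h : IsPieces S G) (hA : A ∈ G i) : glueCoeff G α A = α i A := by
  classical
  rw [glueCoeff, Finset.sum_eq_single i]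
  · rw [if_pos hA]
  · intro j _ hj
    exact if_neg fun hA' => hj (h.eq_of_subset hA' (h.subset i A hA) Subset.rfl)
  · exact fun h => absurd (Finset.mem_univ i) h

theorem Represents.sum [Nonempty ι] (h : IsPieces S G) (hb : IsClusteringBase 𝒜 Q perp)
    (hS : IsPerpCover perp P S) (hR : ∀ i, Represents 𝒜 Q perp (G i) (α i) (R i)) :
    Represents 𝒜 Q perp (⋃ i, G i) (glueCoeff G α) (∑ i, R i) := by
  refine ⟨⟨finite_iUnion fun i => (hR i).1.finite, ?_, iUnion_subset fun i => (hR i).1.subset,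
    ?_⟩, ?_, ?_⟩
  · obtain ⟨A, hA⟩ := (hR (Classical.arbitrary ι)).1.nonempty
    exact ⟨A, mem_iUnion_of_mem _ hA⟩
  · intro A hA B hB
    obtain ⟨i, hi⟩ := mem_iUnion.1 hA
    obtain ⟨j, hj⟩ := mem_iUnion.1 hB
    by_cases hij : i = j
    · subst hij
      exact (hR i).1.forest A hi B hj
    · exact Or.inl (hb.separation.perp_mono (hb.measurableSet ((hR i).1.subset hi))
        (hb.measurableSet ((hR j).1.subset hj)) (hS.isClosed i).measurableSet
        (hS.isClosed j).measurableSet (h.subset i A hi) (h.subset j B hj) (hS.perp i j hij))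
  · intro A hA
    obtain ⟨i, hi⟩ := mem_iUnion.1 hA
    rw [glueCoeff_eq h hi]
    exact (hR i).2.1 A hi
  · rw [finsum_mem_iUnion, finsum_eq_sum_of_fintype]
    · refine Finset.sum_congr rfl fun i _ => ?_
      rw [(hR i).2.2]
      exact finsum_mem_congr rfl fun A hA => by rw [glueCoeff_eq h hA]
    · intro i j hij
      refine disjoint_left.2 fun A hA hA' => hij ?_
      exact h.eq_of_subset hA (h.subset j A hA') Subset.rfl
    · exact fun i => (hR i).1.finite

theorem level_glue (h : IsPieces S G) (hA : A ∈ G i) :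
    level Q (⋃ i, G i) (glueCoeff G α) A = level Q (G i) (α i) A := by
  have he : {E ∈ ⋃ i, G i | A ⊆ E} = {E ∈ G i | A ⊆ E} := by
    ext E
    exact ⟨fun hE => ⟨h.mem_of_subset hA hE.1 hE.2, hE.2⟩,
      fun hE => ⟨mem_iUnion_of_mem i hE.1, hE.2⟩⟩
  rw [level, level, he]
  congr 1
  exact finsum_mem_congr rfl fun E hE => by rw [glueCoeff_eq h hE.1]

/-- Roots of different pieces become new siblings. No base measure below `P` surrounds nodes of two
pieces, so the conditions on these siblings are vacuous. -/
theorem IsAdaptedRep.sum [Nonempty ι] (hb : IsClusteringBase 𝒜 Q perp)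
    (hS : IsPerpCover perp P S) (h : IsPieces S G)
    (hR : ∀ i, IsAdaptedRep 𝒜 Q perp (P.restrict (S i)) (R i) (G i) (α i)) :
    IsAdaptedRep 𝒜 Q perp P (∑ i, R i) (⋃ i, G i) (glueCoeff G α) := by
  have key : ∀ {A₁ A₂ : Set Ω}, DirectSiblings (⋃ i, G i) A₁ A₂ → ∀ b ∈ baseBelow 𝒜 Q P (A₁ ∪ A₂),
      ∃ i, DirectSiblings (G i) A₁ A₂ ∧ b ∈ baseBelow 𝒜 Q (P.restrict (S i)) (A₁ ∪ A₂) := by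
    rintro A₁ A₂ hs b ⟨hbP, E, hE, hAE⟩
    obtain ⟨i, hi⟩ := hS.exists_subset hb hE hbP
    have h1 : A₁ ∈ G i := h.mem_iff.2 ⟨hs.1, (subset_union_left.trans hAE).trans hi⟩
    have h2 : A₂ ∈ G i := h.mem_iff.2 ⟨hs.2.1, (subset_union_right.trans hAE).trans hi⟩
    exact ⟨i, (h.directSiblings_iff h1 h2).1 hs, IsPerpCover.base_le_restrict hb hE hbP hi,
      E, hE, hAE⟩
  refine ⟨Represents.sum h hb hS fun i => (hR i).rep, ?_, ?_, ?_⟩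
  · rintro A₁ A₂ hs ⟨b, hbb⟩
    obtain ⟨i, hsi, hbi⟩ := key hs b hbb
    obtain ⟨A', h1, h2⟩ := (hR i).grounded A₁ A₂ hsi ⟨b, hbi⟩
    refine ⟨A', ?_⟩
    simp only [IsDirectParent, h.ancestors_eq hsi.1, h.ancestors_eq hsi.2.1]
    exact ⟨h1, h2⟩
  · intro A₁ A₂ hs b hbb
    obtain ⟨i, hsi, hbi⟩ := key hs b hbb
    -- The parent keeps all siblings in piece `i`. Without it they would include the roots of the
    -- other pieces, which no base measure could surround.
    obtain ⟨A', h1, -⟩ := (hR i).grounded A₁ A₂ hsi ⟨b, hbi⟩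
    obtain ⟨b', ⟨hb'P, E, hE, hUE⟩, hle⟩ := (hR i).fine A₁ A₂ hsi b hbi
    refine ⟨b', ⟨hb'P.trans Measure.restrict_le_self, E, hE,
      (sUnion_subset_sUnion ?_).trans hUE⟩, hle⟩
    rintro X ⟨hX, hXe⟩
    obtain ⟨j, hj⟩ := mem_iUnion.1 hX
    rw [h.ancestors_eq hsi.1] at hXe
    have h3 : A' ∈ ancestors (⋃ i, G i) X := hXe ▸ h1.1
    have hij := h.eq_of_subset hj (h.subset i A' h1.1.1) h3.2.subset
    subst hij
    exact ⟨hj, by rw [← hXe, h.ancestors_eq hj]⟩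
  · intro A₁ A₂ hs
    by_cases hex : ∃ i, DirectSiblings (G i) A₁ A₂
    · obtain ⟨i, hsi⟩ := hex
      obtain ⟨t, ht0, ht1, hm⟩ := (hR i).motivated A₁ A₂ hsi
      refine ⟨t, ht0, ht1, fun b hbm hor hmem => hm b hbm ?_ ?_⟩
      · rwa [level_glue h hsi.1, level_glue h hsi.2.1] at hor
      · rwa [hS.baseBelow_restrict hb ((h.nonempty i A₁ hsi.1).mono subset_union_left)
          (union_subset (h.subset i A₁ hsi.1) (h.subset i A₂ hsi.2.1))]
    · refine ⟨1 / 2, by positivity, ?_, fun b _ _ hmem => ?_⟩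
      · rw [div_lt_one (by norm_num)]; norm_num
      · obtain ⟨i, hsi, -⟩ := key hs b hmem
        exact hex ⟨i, hsi⟩

end Sum

section SumSeq

variable {R : ι → ℕ → Measure Ω} {F : ι → ℕ → Set (Set Ω)}

theorem AdaptedSeq.isPieces (hb : IsClusteringBase 𝒜 Q perp) (hS : IsPerpCover perp P S)
    (hR : ∀ i, AdaptedSeq 𝒜 Q perp (R i) (F i) (P.restrict (S i))) (n : ℕ) :
    IsPieces S fun i => F i n :=
  ⟨fun _ _ hij => hS.disjoint hb hij, fun i => ((hR i).1.isLaminar hb n).nonempty,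
    fun i A hA => ((hR i).node_subset hb n A hA).trans
      (IsPerpCover.support_restrict_subset_closed (hS.isClosed i))⟩

theorem AdaptedSeq.sum [Nonempty ι] (hb : IsClusteringBase 𝒜 Q perp) (hS : IsPerpCover perp P S)
    (hP : P ∈ finMeasures Ω)
    (hR : ∀ i, AdaptedSeq 𝒜 Q perp (R i) (F i) (P.restrict (S i))) :
    AdaptedSeq 𝒜 Q perp (fun n => ∑ i, R i n) (fun n => ⋃ i, F i n) P := by
  have hpc := AdaptedSeq.isPieces hb hS hR
  have hPs := hS.eq_sum_restrict hb hP
  refine ⟨⟨fun n => ?_, ⟨?_, ?_, ?_⟩, fun n => ?_⟩, fun n => ?_⟩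
  · choose α hα using fun i => (hR i).1.simple n
    exact ⟨_, Represents.sum (hpc n) hb hS hα⟩
  · exact fun n m hnm => Finset.sum_le_sum fun i _ => (hR i).1.conv.1 hnm
  · intro n
    refine (Finset.sum_le_sum fun i _ => (hR i).1.conv.2.1 n).trans ?_
    exact hPs.symm.le
  · intro B hB
    have : P B = ∑ i, P.restrict (S i) B := by
      conv_lhs => rw [hPs]
      rw [Measure.finsetSum_apply]
    rw [this]
    simp only [Measure.finsetSum_apply]
    exact tendsto_finsetSum _ fun i _ => (hR i).1.conv.2.2 B hB
  · choose ζ hζ using fun i => (hR i).1.mono n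
    rw [(hpc n).struct_iUnion, (hpc (n + 1)).struct_iUnion]
    obtain ⟨ξ, hξ, -⟩ := ((hpc n).mono fun i => struct_subset).exists_isFRM
      ((hpc (n + 1)).mono fun i => struct_subset) hζ
    exact ⟨ξ, hξ⟩
  · choose α hα using fun i => isAdapted_iff.1 ((hR i).2 n)
    exact isAdapted_iff.2 ⟨_, IsAdaptedRep.sum hb hS (hpc n) hα⟩

theorem AdaptedSeq.limForest_iUnion [Nonempty ι] (hs : IsStableClusteringBase 𝒜 Q perp)
    (hS : IsPerpCover perp P S) (hP : P ∈ finMeasures Ω)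
    (hR : ∀ i, AdaptedSeq 𝒜 Q perp (R i) (F i) (P.restrict (S i))) :
    limForest (fun n => ⋃ i, F i n) = ⋃ i, limForest (F i) := by
  have hb := hs.base
  have hpc := AdaptedSeq.isPieces hb hS hR
  choose Z hZ _ _ _ using fun i => (hR i).1.exists_chain hs
  choose ξ hξ hξe using fun n => ((hpc 0).mono fun i => struct_subset).exists_isFRM
      ((hpc n).mono fun i => struct_subset) fun i => hZ i n
  rw [limForest_eq (Z := ξ) (fun n => (AdaptedSeq.sum hb hS hP hR).1.isLaminar hb n) fun n => by
    rw [(hpc 0).struct_iUnion, (hpc n).struct_iUnion]; exact hξ n]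
  rw [(hpc 0).struct_iUnion, image_iUnion]
  refine iUnion_congr fun i => ?_
  rw [limForest_eq (fun n => (hR i).1.isLaminar hb n) (hZ i)]
  exact image_congr fun A hA => iUnion_congr fun n => hξe n i A hA

end SumSeq

/-! ### Restricting adapted sequences -/

section Restrict

/-- The nodes inside each piece. -/
def inside (F : Set (Set Ω)) (T : Set Ω) : Set (Set Ω) := {A ∈ F | A ⊆ T}

theorem IsPerpCover.isPieces_inside (hb : IsClusteringBase 𝒜 Q perp)
    (hS : IsPerpCover perp P S) (hF : IsForest perp 𝒜 F) :
    IsPieces S fun i => inside F (S i) :=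
  ⟨fun _ _ hij => hS.disjoint hb hij, fun _ A hA => hb.separation.nonempty A (hF.subset hA.1),
    fun _ _ hA => hA.2⟩

theorem IsPerpCover.iUnion_inside (hb : IsClusteringBase 𝒜 Q perp)
    (hS : IsPerpCover perp P S) (hR : Represents 𝒜 Q perp F α R) (hRP : R ≤ P) :
    ⋃ i, inside F (S i) = F := by
  refine (iUnion_subset fun i => sep_subset _ _).antisymm fun A hA => ?_
  obtain ⟨i, hi⟩ := hb.separation.exists_subset (hR.1.subset hA) hS.isClosed hS.perp
    ((hR.node_subset hb hRP A hA).trans hS.cover)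
  exact mem_iUnion.2 ⟨i, hA, hi⟩

theorem Represents.restrict (hb : IsClusteringBase 𝒜 Q perp) (hS : IsPerpCover perp P S)
    (hR : Represents 𝒜 Q perp F α R) (hRP : R ≤ P) (hne : (inside F (S i)).Nonempty) :
    Represents 𝒜 Q perp (inside F (S i)) α (R.restrict (S i)) := by
  have hU := hS.iUnion_inside hb hR hRP
  have hpc := hS.isPieces_inside hb hR.1
  have hfin : (inside F (S i)).Finite := hR.1.finite.subset (sep_subset _ _)
  refine ⟨⟨hfin, hne, fun A hA => hR.1.subset hA.1,
    fun A hA B hB => hR.1.forest A hA.1 B hB.1⟩, fun A hA => hR.2.1 A hA.1, ?_⟩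
  have hSm := (hS.isClosed i).measurableSet
  refine Measure.ext fun B _ => ?_
  rw [Measure.restrict_apply' hSm, hR.apply, finsum_mem_eq_finite_toFinset_sum _ hfin,
    Measure.finsetSum_apply]
  have hsub : hfin.toFinset ⊆ hR.1.finite.toFinset := by
    intro X hX
    have hX : X ∈ inside F (S i) := by simpa using hX
    simpa using hX.1
  rw [← Finset.sum_subset hsub]
  · refine Finset.sum_congr rfl fun A hA => ?_
    have hA : A ∈ inside F (S i) := by simpa using hA
    have hA𝒜 := hR.1.subset hA.1
    rw [Measure.smul_apply, ENNReal.smul_def, smul_eq_mul, ← hb.apply_inter_self hA𝒜 (B ∩ S i),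
      inter_assoc, inter_eq_right.2 hA.2, hb.apply_inter_self hA𝒜]
  · intro A hA hA'
    have hA : A ∈ F := by simpa using hA
    have hA' : A ∉ inside F (S i) := by simpa using hA'
    rw [← hU] at hA
    obtain ⟨j, hj⟩ := mem_iUnion.1 hA
    have hij : j ≠ i := fun he => hA' (he ▸ hj)
    have h0 : B ∩ S i ⊆ Aᶜ := fun x hx hxA =>
      disjoint_left.1 (hS.disjoint hb hij) (hj.2 hxA) hx.2
    rw [measure_mono_null h0 (hb.apply_compl (hR.1.subset hj.1)), mul_zero]

/-- Every node above a node of the piece is in the piece, so ancestors, siblings and levels are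
unchanged. -/
theorem IsAdaptedRep.restrict (hb : IsClusteringBase 𝒜 Q perp) (hS : IsPerpCover perp P S)
    (hR : IsAdaptedRep 𝒜 Q perp P R F α) (hRP : R ≤ P) (hne : (inside F (S i)).Nonempty) :
    IsAdaptedRep 𝒜 Q perp (P.restrict (S i)) (R.restrict (S i)) (inside F (S i)) α := by
  have hU := hS.iUnion_inside hb hR.rep hRP
  have hpc := hS.isPieces_inside hb hR.rep.1
  have hanc : ∀ {A}, A ∈ inside F (S i) → ancestors (inside F (S i)) A = ancestors F A := by
    intro A hA
    have := hpc.ancestors_eq hA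
    rw [hU] at this
    exact this.symm
  have hsib : ∀ {A₁ A₂}, DirectSiblings (inside F (S i)) A₁ A₂ → DirectSiblings F A₁ A₂ := by
    intro A₁ A₂ h
    have := (hpc.directSiblings_iff h.1 h.2.1).2 h
    rwa [hU] at this
  have hbase : ∀ {A₁ A₂}, DirectSiblings (inside F (S i)) A₁ A₂ →
      baseBelow 𝒜 Q (P.restrict (S i)) (A₁ ∪ A₂) = baseBelow 𝒜 Q P (A₁ ∪ A₂) := by
    intro A₁ A₂ h
    exact hS.baseBelow_restrict hb ((hpc.nonempty i A₁ h.1).mono subset_union_left)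
      (union_subset h.1.2 h.2.1.2)
  have hlev : ∀ {A}, A ∈ inside F (S i) → level Q (inside F (S i)) α A = level Q F α A := by
    intro A hA
    have he : {E ∈ inside F (S i) | A ⊆ E} = {E ∈ F | A ⊆ E} := by
      ext E
      refine ⟨fun hE => ⟨hE.1.1, hE.2⟩, fun hE => ⟨?_, hE.2⟩⟩
      exact hpc.mem_of_subset hA (hU.symm ▸ hE.1) hE.2
    rw [level, level, he]
  refine ⟨hR.rep.restrict hb hS hRP hne, fun A₁ A₂ hs hn => ?_, fun A₁ A₂ hs b hbb => ?_,
    fun A₁ A₂ hs => ?_⟩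
  · rw [hbase hs] at hn
    simp only [IsDirectParent, hanc hs.1, hanc hs.2.1]
    exact hR.grounded A₁ A₂ (hsib hs) hn
  · rw [hbase hs] at hbb
    obtain ⟨b', ⟨hb'P, E, hE, hUE⟩, hle⟩ := hR.fine A₁ A₂ (hsib hs) b hbb
    refine ⟨b', ⟨IsPerpCover.base_le_restrict hb hE hb'P (hS.base_subset hb hE hb'P
      (hpc.nonempty i A₁ hs.1) (?_ : A₁ ⊆ E) hs.1.2), E, hE,
      (sUnion_subset_sUnion ?_).trans hUE⟩, hle⟩
    · exact (subset_sUnion_of_mem (show A₁ ∈ {A ∈ F | ancestors F A = ancestors F A₁} from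
        ⟨hs.1.1, rfl⟩)).trans hUE
    · rintro X ⟨hX, hXe⟩
      exact ⟨hX.1, by rwa [hanc hX, hanc hs.1] at hXe⟩
  · obtain ⟨t, ht0, ht1, hm⟩ := hR.motivated A₁ A₂ (hsib hs)
    refine ⟨t, ht0, ht1, ?_⟩
    rw [hlev hs.1, hlev hs.2.1, hbase hs]
    exact hm

variable {R : ℕ → Measure Ω} {F : ℕ → Set (Set Ω)}

/-- Every piece of positive mass contains nodes of all forests of the sequence. -/
theorem AdaptedSeq.inside_nonempty (hs : IsStableClusteringBase 𝒜 Q perp)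
    (hS : IsPerpCover perp P S) (hR : AdaptedSeq 𝒜 Q perp R F P) (hi : P (S i) ≠ 0) (n : ℕ) :
    (inside (F n) (S i)).Nonempty := by
  have hb := hs.base
  have hSm := (hS.isClosed i).measurableSet
  obtain ⟨m, hm⟩ : ∃ m, R m (S i) ≠ 0 := ((hR.1.conv.2.2 _ hSm).eventually_ne hi).exists
  have hU : ∀ k, ⋃ i, inside (F k) (S i) = F k := by
    intro k
    obtain ⟨α, hα⟩ := hR.1.simple k
    exact hS.iUnion_inside hb hα (hR.1.conv.2.1 k)
  have hpc := fun k => hS.isPieces_inside hb (hR.1.simple k).isForest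
  obtain ⟨A, hA⟩ : (inside (F m) (S i)).Nonempty := by
    obtain ⟨α, hα⟩ := hR.1.simple m
    by_contra hcon
    refine hm ?_
    rw [hα.apply, Finset.sum_eq_zero]
    intro A hA
    have hA : A ∈ F m := by simpa using hA
    have hA' := hA
    rw [← hU m] at hA
    obtain ⟨j, hj⟩ := mem_iUnion.1 hA
    have hij : j ≠ i := fun he => hcon ⟨A, he ▸ hj⟩
    have h0 : S i ⊆ Aᶜ := fun x hx hxA =>
      disjoint_left.1 (hS.disjoint hb hij) (hj.2 hxA) hx
    rw [measure_mono_null h0 (hb.apply_compl (hα.1.subset hA')), mul_zero]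
  obtain ⟨B, hB, hAB⟩ := (hR.1.isLaminar hb m).exists_root hA.1
  have hBi : B ∈ inside (F m) (S i) := (hpc m).mem_of_subset hA ((hU m).symm ▸ hB.1) hAB
  obtain ⟨Z, hZ, -⟩ := Clustering.exists_chain hR.1.mono
  obtain ⟨I, hI, rfl⟩ := (hZ m).1.1.surjOn hB.mem_struct
  -- The first node of the chain lies in its later node, hence in `S i`. All other nodes of the
  -- chain contain it and so lie in the same piece.
  have hI0 : I ∈ inside (F 0) (S i) := ⟨hI.1, ((hZ m).2 I hI).trans hBi.2⟩
  obtain ⟨j, hj⟩ := mem_iUnion.1 ((hU n).symm ▸ ((hZ n).1.1.mapsTo hI).1)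
  have hij := (hpc 0).eq_of_subset hI0 hj.2 ((hZ n).2 I hI)
  subst hij
  exact ⟨_, hj⟩

theorem AdaptedSeq.restrict (hs : IsStableClusteringBase 𝒜 Q perp)
    (hS : IsPerpCover perp P S) (hR : AdaptedSeq 𝒜 Q perp R F P) (hi : P (S i) ≠ 0) :
    AdaptedSeq 𝒜 Q perp (fun n => (R n).restrict (S i)) (fun n => inside (F n) (S i))
      (P.restrict (S i)) := by
  have hb := hs.base
  have hSm := (hS.isClosed i).measurableSet
  have hne := hR.inside_nonempty hs hS hi
  refine ⟨⟨fun n => ?_, ⟨?_, ?_, ?_⟩, fun n => ?_⟩, fun n => ?_⟩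
  · obtain ⟨α, hα⟩ := hR.1.simple n
    exact ⟨α, hα.restrict hb hS (hR.1.conv.2.1 n) (hne n)⟩
  · exact fun n m hnm => Measure.restrict_mono Subset.rfl (hR.1.conv.1 hnm)
  · exact fun n => Measure.restrict_mono Subset.rfl (hR.1.conv.2.1 n)
  · intro B hB
    simp only [Measure.restrict_apply' hSm]
    exact hR.1.conv.2.2 _ (hB.inter hSm)
  · have hst : ∀ k, struct (F k) = ⋃ i, struct (inside (F k) (S i)) := by
      intro k
      obtain ⟨α, hα⟩ := hR.1.simple k
      rw [← (hS.isPieces_inside hb hα.1).struct_iUnion,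
        hS.iUnion_inside hb hα (hR.1.conv.2.1 k)]
    obtain ⟨ζ, hζ⟩ := hR.1.mono n
    rw [hst, hst] at hζ
    have hpc := fun k => (hS.isPieces_inside hb (hR.1.simple k).isForest).mono
      fun i => struct_subset
    exact ⟨ζ, (hpc n).isFRM_restrict (hpc (n + 1)) hζ i⟩
  · obtain ⟨α, hα⟩ := isAdapted_iff.1 (hR.2 n)
    exact isAdapted_iff.2 ⟨α, hα.restrict hb hS (hR.1.conv.2.1 n) (hne n)⟩

theorem adaptedLimits.restrict (hs : IsStableClusteringBase 𝒜 Q perp)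
    (hS : IsPerpCover perp P S) (hP : P ∈ adaptedLimits 𝒜 Q perp) (hi : P (S i) ≠ 0) :
    P.restrict (S i) ∈ adaptedLimits 𝒜 Q perp := by
  rw [mem_adaptedLimits_iff] at hP ⊢
  obtain ⟨⟨h1, -, h2⟩, hsub, R, F, hR⟩ := hP
  refine ⟨⟨inferInstance, ?_, inferInstance⟩, hS.isSubadditive_restrict hs.base hsub i, _, _,
    hR.restrict hs hS hi⟩
  rwa [Ne, Measure.restrict_eq_zero]

end Restrict

theorem adaptedLimits.of_restrict [Nonempty ι] (hb : IsClusteringBase 𝒜 Q perp)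
    (hS : IsPerpCover perp P S) (hP : P ∈ finMeasures Ω)
    (h : ∀ i, P.restrict (S i) ∈ adaptedLimits 𝒜 Q perp) : P ∈ adaptedLimits 𝒜 Q perp := by
  simp only [mem_adaptedLimits_iff] at h ⊢
  choose _ hsub R F hR using h
  exact ⟨hP, hS.isSubadditive_of_restrict hb hsub, _, _, AdaptedSeq.sum hb hS hP hR⟩

end Pieces

/-! ### Admissible values and their behaviour under the operations. -/

section Candidates

variable {Ω : Type*} [TopologicalSpace Ω] [MeasurableSpace Ω] [OpensMeasurableSpace Ω]
  {𝒜 : Set (Set Ω)} {Q : Set Ω → Measure Ω} {perp : Set Ω → Set Ω → Prop}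
  {P P' P'' : Measure Ω} {A A' B B' N : Set Ω} {F F' G : Set (Set Ω)} {s β β' : ℝ≥0}

/-- The admissible values of a continuous clustering at `P`: limit forests that agree almost
everywhere with the limit of an adapted sequence. -/
def IsCandidate (𝒜 : Set (Set Ω)) (Q : Set Ω → Measure Ω) (perp : Set Ω → Set Ω → Prop)
    (P : Measure Ω) (F : Set (Set Ω)) : Prop :=
  IsLimitForest 𝒜 Q perp P F ∧ ∃ R F', AdaptedSeq 𝒜 Q perp R F' P ∧ AEMatch P F (limForest F')

theorem exists_isCandidate (hs : IsStableClusteringBase 𝒜 Q perp)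
    (hP : P ∈ adaptedLimits 𝒜 Q perp) : ∃ F, IsCandidate 𝒜 Q perp P F := by
  obtain ⟨-, -, R, F, hR⟩ := hP
  exact ⟨_, hR.1.isLimitForest hs, R, F, hR, AEMatch.refl _ _⟩

/-- The sequence witnessing admissibility is irrelevant, so any selection of candidates satisfies
the continuity axiom. -/
theorem IsCandidate.forestEqAE_limForest (hs : IsStableClusteringBase 𝒜 Q perp)
    (hP : P ∈ adaptedLimits 𝒜 Q perp) (h : IsCandidate 𝒜 Q perp P F) {R : ℕ → Measure Ω}
    {F' : ℕ → Set (Set Ω)} (hR : AdaptedSeq 𝒜 Q perp R F' P) :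
    ForestEqAE P F (limForest F') := by
  obtain ⟨h1, R', F'', hR', hm⟩ := h
  exact h1.forestEqAE hs.base (hR.1.isLimitForest hs)
    (hm.trans (hR'.aeMatch hs hP.1.1.1 hP.2.1 hR))

theorem IsCandidate.aeMatch (hs : IsStableClusteringBase 𝒜 Q perp)
    (hP : P ∈ adaptedLimits 𝒜 Q perp) (h : IsCandidate 𝒜 Q perp P F)
    (h' : IsCandidate 𝒜 Q perp P F') : AEMatch P F F' := by
  obtain ⟨-, R, F₀, hR, hm⟩ := h'
  exact (h.forestEqAE_limForest hs hP hR).aeMatch.trans hm.symm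

/-- The number of nodes is an invariant of `P`; it later serves as the induction parameter. -/
theorem IsCandidate.ncard_eq (hs : IsStableClusteringBase 𝒜 Q perp)
    (hP : P ∈ adaptedLimits 𝒜 Q perp) (h : IsCandidate 𝒜 Q perp P F)
    (h' : IsCandidate 𝒜 Q perp P F') : F.ncard = F'.ncard := by
  obtain ⟨ζ, hζ, -⟩ := h.1.forestEqAE hs.base h'.1 (h.aeMatch hs hP h')
  rw [← hζ.1.image_eq, hζ.1.injOn.ncard_image]

theorem AEMatch.mono (h : AEMatch P F F') (hP : P' ≪ P) : AEMatch P' F F' :=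
  ⟨fun B hB => let ⟨C, hC, he⟩ := h.1 B hB; ⟨C, hC, hP.ae_eq he⟩,
    fun B hB => let ⟨C, hC, he⟩ := h.2 B hB; ⟨C, hC, hP.ae_eq he⟩⟩

theorem nnreal_smul_absolutelyContinuous (s : ℝ≥0) (μ : Measure Ω) : s • μ ≪ μ :=
  fun S hS => by simp [hS]

theorem absolutelyContinuous_nnreal_smul (hs : 0 < s) (μ : Measure Ω) : μ ≪ s • μ :=
  absolutelyContinuous_of_nnreal_smul_le hs le_rfl

theorem IsCandidate.smul (h : IsCandidate 𝒜 Q perp P F) (hs : 0 < s) :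
    IsCandidate 𝒜 Q perp (s • P) F := by
  obtain ⟨h1, R, F', hR, hm⟩ := h
  exact ⟨⟨h1.isForest, h1.struct_eq, fun B hB =>
    (h1.node B hB).mono (absolutelyContinuous_nnreal_smul hs P)⟩, _, _, hR.smul hs,
    hm.mono (nnreal_smul_absolutelyContinuous s P)⟩

theorem isCandidate_smul_iff (hs : 0 < s) :
    IsCandidate 𝒜 Q perp (s • P) F ↔ IsCandidate 𝒜 Q perp P F := by
  refine ⟨fun h => ?_, fun h => h.smul hs⟩
  have := h.smul (inv_pos.2 hs)
  rwa [inv_smul_smul₀ hs.ne'] at this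

theorem isCandidate_base (hs : IsStableClusteringBase 𝒜 Q perp) (hA : A ∈ 𝒜) :
    IsCandidate 𝒜 Q perp (Q A) {A} := by
  have h := adaptedSeq_base (perp := perp) (Q := Q) hA
  have h1 := h.1.isLimitForest hs
  have h2 := limForest_singleton hs.base hA
  exact ⟨h2 ▸ h1, _, _, h, by rw [h2]; exact AEMatch.refl _ _⟩

/-! ### Separated sums -/

section Sum

variable {ι : Type*} [Fintype ι] [Nonempty ι] {S : ι → Set Ω} {F : ι → Set (Set Ω)}

theorem IsPerpCover.isPieces (hb : IsClusteringBase 𝒜 Q perp) (hS : IsPerpCover perp P S)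
    (h : ∀ i, IsLimitForest 𝒜 Q perp (P.restrict (S i)) (F i)) : IsPieces S F :=
  ⟨fun _ _ hij => hS.disjoint hb hij, fun i => ((h i).isLaminar hb).nonempty,
    fun i A hA => ((h i).subset_support hb A hA).trans
      (IsPerpCover.support_restrict_subset_closed (hS.isClosed i))⟩

theorem IsLimitForest.iUnion (hb : IsClusteringBase 𝒜 Q perp) (hS : IsPerpCover perp P S)
    (h : ∀ i, IsLimitForest 𝒜 Q perp (P.restrict (S i)) (F i)) :
    IsLimitForest 𝒜 Q perp P (⋃ i, F i) := by
  have hpc := hS.isPieces hb h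
  refine ⟨⟨finite_iUnion fun i => (h i).isForest.finite, ?_,
    iUnion_subset fun i => (h i).isForest.subset, ?_⟩, ?_, ?_⟩
  · obtain ⟨A, hA⟩ := (h (Classical.arbitrary ι)).isForest.nonempty
    exact ⟨A, mem_iUnion_of_mem _ hA⟩
  · intro A hA B hB
    obtain ⟨i, hi⟩ := mem_iUnion.1 hA
    obtain ⟨j, hj⟩ := mem_iUnion.1 hB
    by_cases hij : i = j
    · subst hij
      exact (h i).isForest.forest A hi B hj
    · have hm := hb.separation.monotoneClosure_subset
      exact Or.inl (hb.separation.perp_mono (hm ((h i).isForest.subset hi)).1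
        (hm ((h j).isForest.subset hj)).1 (hS.isClosed i).measurableSet
        (hS.isClosed j).measurableSet (hpc.subset i A hi) (hpc.subset j B hj) (hS.perp i j hij))
  · rw [hpc.struct_iUnion]
    exact iUnion_congr fun i => (h i).struct_eq
  · intro B hB
    obtain ⟨i, hi⟩ := mem_iUnion.1 hB
    exact ((h i).node B hi).mono Measure.absolutelyContinuous_restrict

theorem ae_eq_of_restrict {T : Set Ω} (hT : MeasurableSet T) (hB : B ⊆ T) (hB' : B' ⊆ T)
    (h : B =ᵐ[P.restrict T] B') : B =ᵐ[P] B' := by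
  rw [← measure_symmDiff_eq_zero_iff] at h ⊢
  rwa [Measure.restrict_apply' hT, inter_eq_left.2] at h
  exact (symmDiff_le_sup (a := B) (b := B')).trans (union_subset hB hB')

theorem IsCandidate.iUnion (hs : IsStableClusteringBase 𝒜 Q perp) (hS : IsPerpCover perp P S)
    (hP : P ∈ finMeasures Ω) (h : ∀ i, IsCandidate 𝒜 Q perp (P.restrict (S i)) (F i)) :
    IsCandidate 𝒜 Q perp P (⋃ i, F i) := by
  have hb := hs.base
  choose h1 R F' hR hm using h
  refine ⟨IsLimitForest.iUnion hb hS h1, _, _, AdaptedSeq.sum hb hS hP hR, ?_⟩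
  rw [AdaptedSeq.limForest_iUnion hs hS hP hR]
  have hpc := hS.isPieces hb h1
  have hpc' := hS.isPieces hb fun i => (hR i).1.isLimitForest hs
  constructor
  · intro B hB
    obtain ⟨i, hi⟩ := mem_iUnion.1 hB
    obtain ⟨C, hC, he⟩ := (hm i).1 B hi
    exact ⟨C, mem_iUnion_of_mem i hC, ae_eq_of_restrict (hS.isClosed i).measurableSet
      (hpc.subset i B hi) (hpc'.subset i C hC) he⟩
  · intro B hB
    obtain ⟨i, hi⟩ := mem_iUnion.1 hB
    obtain ⟨C, hC, he⟩ := (hm i).2 B hi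
    exact ⟨C, mem_iUnion_of_mem i hC, ae_eq_of_restrict (hS.isClosed i).measurableSet
      (hpc'.subset i B hi) (hpc.subset i C hC) he⟩

end Sum

/-! ### Adding and removing base measures -/

/-- On each base set exhausting `B`, flatness makes `Q A` a multiple of that set's own measure,
which is absolutely continuous with respect to `P`. Adding `Q A` therefore creates no mass on
`P`-null parts of limit nodes. -/
theorem IsLimitNode.base_apply_inter_eq_zero (hb : IsClusteringBase 𝒜 Q perp)
    (h : IsLimitNode 𝒜 Q P B) (hA : A ∈ 𝒜) (hBA : B ⊆ A) (hN : P (B ∩ N) = 0) :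
    Q A (B ∩ N) = 0 := by
  obtain ⟨E, hE, -, rfl, hac⟩ := h
  rw [iUnion_inter, measure_iUnion_null_iff]
  intro n
  have hn : E n ⊆ ⋃ n, E n := subset_iUnion E n
  rw [inter_comm, hb.apply_inter (hE n) hA (hn.trans hBA)]
  have h0 : Q (E n) ((⋃ n, E n) ∩ N) = 0 := hac n hN
  rw [← hb.apply_inter_self (hE n), measure_mono_null _ h0, mul_zero]
  exact fun x hx => ⟨hn hx.2, hx.1⟩

theorem IsLimitNode.ae_eq_add_base (hb : IsClusteringBase 𝒜 Q perp)
    (h : IsLimitNode 𝒜 Q P B) (h' : IsLimitNode 𝒜 Q P B') (hA : A ∈ 𝒜) (hBA : B ⊆ A)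
    (hBA' : B' ⊆ A) (he : B =ᵐ[P] B') : B =ᵐ[β • Q A + P] B' := by
  have aux : ∀ {B B' : Set Ω}, IsLimitNode 𝒜 Q P B → B ⊆ A → P (B \ B') = 0 →
      (β • Q A + P) (B \ B') = 0 := by
    intro B B' h hBA h0
    have h1 := h.base_apply_inter_eq_zero hb hA hBA (N := B'ᶜ) (by rwa [← sdiff_eq])
    rw [← sdiff_eq] at h1
    simp [h0, h1]
  refine (ae_le_set.2 (aux h hBA (ae_le_set.1 he.le))).antisymm
    (ae_le_set.2 (aux h' hBA' (ae_le_set.1 he.symm.le)))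

theorem IsLimitForest.insert (hF : IsLimitForest 𝒜 Q perp P F)
    (hA : A ∈ 𝒜) (hQA : Q A ≪ P') (hFA : ∀ B ∈ lower F, B ⊆ A)
    (hnode : ∀ B ∈ lower F, IsLimitNode 𝒜 Q P' B) :
    IsLimitForest 𝒜 Q perp P' (insert A (lower F)) := by
  have hAn : IsLimitNode 𝒜 Q P' A :=
    ⟨fun _ => A, fun _ => hA, monotone_const, (iUnion_const A).symm, fun _ => hQA⟩
  refine ⟨⟨(hF.isForest.finite.subset lower_subset).insert A, insert_nonempty _ _,
    insert_subset (subset_monotoneClosure hA) (lower_subset.trans hF.isForest.subset), ?_⟩, ?_, ?_⟩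
  · rintro B (rfl | hB) C (rfl | hC)
    · exact Or.inr (Or.inl Subset.rfl)
    · exact Or.inr (Or.inr (hFA C hC))
    · exact Or.inr (Or.inl (hFA B hB))
    · exact hF.isForest.forest B hB.1 C hC.1
  · rw [struct_insert hFA, lower_lower]
  · rintro B (rfl | hB)
    · exact hAn
    · exact hnode B hB

theorem AEMatch.insert (h : AEMatch P F F') (A : Set Ω) : AEMatch P (insert A F) (insert A F') := by
  constructor
  · rintro B (rfl | hB)
    · exact ⟨B, mem_insert _ _, .rfl⟩
    · obtain ⟨C, hC, he⟩ := h.1 B hB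
      exact ⟨C, Or.inr hC, he⟩
  · rintro B (rfl | hB)
    · exact ⟨B, mem_insert _ _, .rfl⟩
    · obtain ⟨C, hC, he⟩ := h.2 B hB
      exact ⟨C, Or.inr hC, he⟩

theorem base_absolutelyContinuous_add (hβ : 0 < β) : Q A ≪ β • Q A + P :=
  absolutelyContinuous_of_nnreal_smul_le hβ (Measure.le_add_right le_rfl)

theorem absolutelyContinuous_add_base : P ≪ β • Q A + P :=
  (Measure.le_add_left le_rfl).absolutelyContinuous

theorem IsCandidate.add_base (hs : IsStableClusteringBase 𝒜 Q perp) (hA : A ∈ 𝒜) (hβ : 0 < β)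
    (hP : P.support ⊆ A) (h : IsCandidate 𝒜 Q perp P F) :
    IsCandidate 𝒜 Q perp (β • Q A + P) (insert A (lower F)) := by
  have hb := hs.base
  obtain ⟨h1, R, F', hR, hm⟩ := h
  have h2 := hR.1.isLimitForest hs
  refine ⟨h1.insert hA (base_absolutelyContinuous_add hβ)
    (fun B hB => (h1.subset_support hb B hB.1).trans hP)
    (fun B hB => (h1.node B hB.1).mono absolutelyContinuous_add_base), _, _,
    hR.add_base hb hA hβ hP, ?_⟩
  rw [hR.limForest_insert hs hA hβ hP]
  refine AEMatch.insert ?_ A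
  have hl := h1.aeMatch_lower hb h2 hm
  constructor
  · intro B hB
    obtain ⟨C, hC, he⟩ := hl.1 B hB
    exact ⟨C, hC, (h1.node B hB.1).ae_eq_add_base hb (h2.node C hC.1) hA
      ((h1.subset_support hb B hB.1).trans hP) ((h2.subset_support hb C hC.1).trans hP) he⟩
  · intro B hB
    obtain ⟨C, hC, he⟩ := hl.2 B hB
    exact ⟨C, hC, (h2.node B hB.1).ae_eq_add_base hb (h1.node C hC.1) hA
      ((h2.subset_support hb B hB.1).trans hP) ((h1.subset_support hb C hC.1).trans hP) he⟩

/-- Limit nodes of `β • Q A + P` that agree with limit nodes of `P` are limit nodes of `P`. -/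
theorem IsLimitNode.of_add_base (hb : IsClusteringBase 𝒜 Q perp) (hA : A ∈ 𝒜)
    (h : IsLimitNode 𝒜 Q (β • Q A + P) B) (h' : IsLimitNode 𝒜 Q P B') (hBA' : B' ⊆ A)
    (he : B =ᵐ[β • Q A + P] B') : IsLimitNode 𝒜 Q P B := by
  obtain ⟨E, hE, hm, rfl, hac⟩ := h
  refine ⟨E, hE, hm, rfl, fun n N hN => ?_⟩
  -- A `P`-null set is split into its part in `B'`, its part in `B` outside `B'` and its part off `E
  -- n`. Each is null for `Q (E n)`, although this measure is only known to be dominated by the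
  -- larger sum.
  have h1 : P (B' ∩ N) = 0 := measure_mono_null inter_subset_right hN
  have h2 : Q A (B' ∩ N) = 0 := h'.base_apply_inter_eq_zero hb hA hBA' h1
  have h3 : Q (E n) (B' ∩ N) = 0 := hac n (by simp [h1, h2])
  have h4 : Q (E n) ((⋃ n, E n) \ B') = 0 := hac n (ae_le_set.1 he.le)
  refine measure_mono_null (?_ : N ⊆ (B' ∩ N) ∪ ((⋃ n, E n) \ B') ∪ (E n)ᶜ)
    (measure_union_null (measure_union_null h3 h4) (hb.apply_compl (hE n)))
  intro x hx
  by_cases h5 : x ∈ B'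
  · exact Or.inl (Or.inl ⟨h5, hx⟩)
  · by_cases h6 : x ∈ E n
    · exact Or.inl (Or.inr ⟨mem_iUnion.2 ⟨n, h6⟩, h5⟩)
    · exact Or.inr h6

/-- A base measure can be removed if the remaining measure contains another. Both `lower F` and the
value obtained from `P''` by adding two roots are seen at the same measure, so their lower nodes
match and can be pulled back. The base measure on `A'` supplies the root, which could not be
recovered from `F`. -/
theorem IsCandidate.of_add_base (hs : IsStableClusteringBase 𝒜 Q perp) (hA : A ∈ 𝒜)
    (hβ : 0 < β) (hA' : A' ∈ 𝒜) (hβ' : 0 < β') (hP'' : P'' ∈ adaptedLimits 𝒜 Q perp)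
    (hPA' : P''.support ⊆ A') (hAA' : A' ⊆ A)
    (h : IsCandidate 𝒜 Q perp (β • Q A + (β' • Q A' + P'')) F) :
    IsCandidate 𝒜 Q perp (β' • Q A' + P'') (insert A' (lower F)) := by
  have hb := hs.base
  have hP' := adaptedLimits.add_base hb hA' hβ' hPA' hP''
  have hsupp := support_add_base hb hA' hβ' hPA'
  have hP := adaptedLimits.add_base hb hA hβ (hsupp.trans_subset hAA') hP'
  obtain ⟨F'', hF''⟩ := exists_isCandidate hs hP''
  have hsub'' : ∀ B ∈ lower F'', B ⊆ A' := fun B hB =>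
    (hF''.1.subset_support hb B hB.1).trans hPA'
  have hF' := hF''.add_base hs hA' hβ' hPA'
  have hFP := hF'.add_base hs hA hβ (hsupp.trans_subset hAA')
  have hl := h.1.aeMatch_lower hb hFP.1 (h.aeMatch hs hP hFP)
  rw [lower_insert hsub'', lower_lower,
    lower_insert fun B hB => (hsub'' B hB).trans hAA', lower_lower] at hl
  have hnode : ∀ B ∈ lower F, IsLimitNode 𝒜 Q (β' • Q A' + P'') B := by
    intro B hB
    obtain ⟨C, hC, he⟩ := hl.1 B hB
    exact (h.1.node B hB.1).of_add_base hb hA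
      ((hF''.1.node C hC.1).mono absolutelyContinuous_add_base) ((hsub'' C hC).trans hAA') he
  refine ⟨h.1.insert hA' (base_absolutelyContinuous_add hβ')
    (fun B hB => hsupp ▸ (hnode B hB).subset_support hb) hnode, ?_⟩
  obtain ⟨-, R, F₀, hR, hm⟩ := hF'
  exact ⟨R, F₀, hR, ((hl.insert A').mono absolutelyContinuous_add_base).trans hm⟩

/-- `P` arises from an adapted limit by adding a base measure. -/
def HasBase (𝒜 : Set (Set Ω)) (Q : Set Ω → Measure Ω) (perp : Set Ω → Set Ω → Prop)
    (P : Measure Ω) : Prop :=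
  ∃ A ∈ 𝒜, ∃ β : ℝ≥0, 0 < β ∧ ∃ P' ∈ adaptedLimits 𝒜 Q perp, P'.support ⊆ A ∧ P = β • Q A + P'

/-- The support of `P`, with the forest `G` below it, is an admissible value at `P`. -/
structure HasCore (𝒜 : Set (Set Ω)) (Q : Set Ω → Measure Ω) (perp : Set Ω → Set Ω → Prop)
    (P : Measure Ω) (G : Set (Set Ω)) : Prop where
  lower_eq : lower G = G
  isCandidate : IsCandidate 𝒜 Q perp P (insert P.support G)

theorem HasCore.subset_support (hb : IsClusteringBase 𝒜 Q perp) (h : HasCore 𝒜 Q perp P G) :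
    ∀ B ∈ G, B ⊆ P.support := fun B hB =>
  h.isCandidate.1.subset_support hb B (mem_insert_of_mem _ hB)

theorem HasCore.add_base (hs : IsStableClusteringBase 𝒜 Q perp) (hA : A ∈ 𝒜) (hβ : 0 < β)
    (hP : P.support ⊆ A) (h : HasCore 𝒜 Q perp P G) : HasCore 𝒜 Q perp (β • Q A + P) G := by
  refine ⟨h.lower_eq, ?_⟩
  have := h.isCandidate.add_base hs hA hβ hP
  rw [support_add_base hs.base hA hβ hP]
  rwa [lower_insert (h.subset_support hs.base), h.lower_eq] at this

theorem IsCandidate.hasCore_add_base (hs : IsStableClusteringBase 𝒜 Q perp) (hA : A ∈ 𝒜)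
    (hβ : 0 < β) (hP : P.support ⊆ A) (h : IsCandidate 𝒜 Q perp P F) :
    HasCore 𝒜 Q perp (β • Q A + P) (lower F) := by
  refine ⟨lower_lower, ?_⟩
  rw [support_add_base hs.base hA hβ hP]
  exact h.add_base hs hA hβ hP

theorem hasCore_smul_iff (hs : 0 < s) : HasCore 𝒜 Q perp (s • P) G ↔ HasCore 𝒜 Q perp P G := by
  constructor
  · rintro ⟨h1, h2⟩
    rw [isCandidate_smul_iff hs, support_nnreal_smul hs] at h2
    exact ⟨h1, h2⟩
  · rintro ⟨h1, h2⟩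
    rw [← isCandidate_smul_iff hs, ← support_nnreal_smul hs] at h2
    exact ⟨h1, h2⟩

theorem HasBase.smul (h : HasBase 𝒜 Q perp P) (hs : 0 < s) : HasBase 𝒜 Q perp (s • P) := by
  obtain ⟨A, hA, β, hβ, P', hP', hPA, rfl⟩ := h
  refine ⟨A, hA, s * β, mul_pos hs hβ, s • P', adaptedLimits.smul hP' hs, ?_, ?_⟩
  · rwa [support_nnreal_smul hs]
  · rw [smul_add, smul_smul]

theorem hasBase_smul_iff (hs : 0 < s) : HasBase 𝒜 Q perp (s • P) ↔ HasBase 𝒜 Q perp P := by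
  refine ⟨fun h => ?_, fun h => h.smul hs⟩
  have := h.smul (inv_pos.2 hs)
  rwa [inv_smul_smul₀ hs.ne'] at this

theorem IsCandidate.hasCore_of_add_base (hs : IsStableClusteringBase 𝒜 Q perp) (hA : A ∈ 𝒜)
    (hβ : 0 < β) (hPA : P.support ⊆ A) (hP : HasBase 𝒜 Q perp P)
    (h : IsCandidate 𝒜 Q perp (β • Q A + P) F) : HasCore 𝒜 Q perp P (lower F) := by
  obtain ⟨A', hA', β', hβ', P', hP', hPA', rfl⟩ := hP
  rw [support_add_base hs.base hA' hβ' hPA'] at hPA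
  refine ⟨lower_lower, ?_⟩
  rw [support_add_base hs.base hA' hβ' hPA']
  exact h.of_add_base hs hA hβ hA' hβ' hP' hPA' hPA

/-- The root of `F` equals the support only up to a null set. Removing half of the base measure and
adding it again replaces that root by the support and leaves `lower F` alone. -/
theorem IsCandidate.hasCore (hs : IsStableClusteringBase 𝒜 Q perp) (hP : HasBase 𝒜 Q perp P)
    (h : IsCandidate 𝒜 Q perp P F) : HasCore 𝒜 Q perp P (lower F) := by
  obtain ⟨A, hA, β, hβ, P', hP', hPA, rfl⟩ := hP
  have hβ2 : 0 < β / 2 := by positivity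
  have he : β • Q A + P' = (β / 2) • Q A + ((β / 2) • Q A + P') := by
    rw [← add_assoc, ← add_smul, add_halves]
  have hb2 : HasBase 𝒜 Q perp ((β / 2) • Q A + P') := ⟨A, hA, _, hβ2, P', hP', hPA, rfl⟩
  have hsupp : ((β / 2) • Q A + P').support ⊆ A := (support_add_base hs.base hA hβ2 hPA).subset
  rw [he] at h ⊢
  exact (h.hasCore_of_add_base hs hA hβ2 hsupp hb2).add_base hs hA hβ2 hsupp

theorem hasCore_add_base_iff (hs : IsStableClusteringBase 𝒜 Q perp) (hA : A ∈ 𝒜)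
    (hβ : 0 < β) (hPA : P.support ⊆ A) (hP : HasBase 𝒜 Q perp P) :
    HasCore 𝒜 Q perp (β • Q A + P) G ↔ HasCore 𝒜 Q perp P G := by
  refine ⟨fun h => ?_, fun h => h.add_base hs hA hβ hPA⟩
  have := h.isCandidate.hasCore_of_add_base hs hA hβ hPA hP
  rwa [lower_insert (h.subset_support hs.base), h.lower_eq] at this

end Candidates

/-! ### Connected components of the support. -/

section Decompositions

variable {Ω : Type*} [TopologicalSpace Ω] [MeasurableSpace Ω] [OpensMeasurableSpace Ω]
  {𝒜 : Set (Set Ω)} {Q : Set Ω → Measure Ω} {perp : Set Ω → Set Ω → Prop}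
  {P : Measure Ω} {A K : Set Ω}

/-- Connectedness with respect to a separation relation. -/
def PerpConnected (perp : Set Ω → Set Ω → Prop) (K : Set Ω) : Prop :=
  ∀ (ι : Type) [Fintype ι] (S : ι → Set Ω), (∀ i, IsClosed (S i)) →
    (∀ i j, i ≠ j → perp (S i) (S j)) → K ⊆ ⋃ i, S i → ∃ i, K ⊆ S i

/-- A partition into separated non-empty closed sets. -/
structure IsPerpPartition {ι : Type*} (perp : Set Ω → Set Ω → Prop) (K : Set Ω) (T : ι → Set Ω) :
    Prop where
  isClosed : ∀ i, IsClosed (T i)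
  separated : ∀ i j, i ≠ j → perp (T i) (T j)
  nonempty : ∀ i, (T i).Nonempty
  eq_iUnion : K = ⋃ i, T i

/-- A partition into separated non-empty closed connected sets. -/
structure IsDecomp {ι : Type*} (perp : Set Ω → Set Ω → Prop) (K : Set Ω) (T : ι → Set Ω) : Prop
    extends IsPerpPartition perp K T where
  connected : ∀ i, PerpConnected perp (T i)

theorem IsSeparation.perpConnected (h : IsSeparation 𝒜 perp) (hA : A ∈ 𝒜) :
    PerpConnected perp A := fun _ _ _ hS hp hAS => h.exists_subset hA hS hp hAS

theorem IsPerpPartition.disjoint {ι : Type*} {T : ι → Set Ω} (h : IsSeparation 𝒜 perp)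
    (hT : IsPerpPartition perp K T) {i j : ι} (hij : i ≠ j) : Disjoint (T i) (T j) :=
  h.disjoint (hT.isClosed i).measurableSet (hT.isClosed j).measurableSet (hT.separated i j hij)

theorem IsPerpPartition.eq_of_nonempty {ι : Type*} {T : ι → Set Ω} (h : IsSeparation 𝒜 perp)
    (hT : IsPerpPartition perp K T) {i j : ι} {B : Set Ω} (hB : B.Nonempty) (hi : B ⊆ T i)
    (hj : B ⊆ T j) : i = j := by
  by_contra hij
  exact hB.ne_empty (disjoint_self.1 ((hT.disjoint h hij).mono hi hj))

theorem IsPerpPartition.isPerpCover {ι : Type*} {T : ι → Set Ω}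
    (hT : IsPerpPartition perp P.support T) :
    IsPerpCover perp P T := ⟨hT.isClosed, hT.separated, hT.eq_iUnion.subset⟩

theorem IsPerpPartition.index_nonempty {ι : Type*} {T : ι → Set Ω} (hT : IsPerpPartition perp K T)
    (hK : K.Nonempty) : Nonempty ι := by
  rw [hT.eq_iUnion] at hK
  exact (nonempty_iUnion.1 hK).nonempty

/-- By connectedness each part lies in a part of the other decomposition, and conversely. Hence
nothing built from the parts depends on the decomposition. -/
theorem IsDecomp.exists_eq {ι κ : Type} [Fintype ι] [Fintype κ] {T : ι → Set Ω} {T' : κ → Set Ω}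
    (h : IsSeparation 𝒜 perp) (hT : IsDecomp perp K T) (hT' : IsDecomp perp K T') (i : ι) :
    ∃ j, T i = T' j := by
  obtain ⟨j, hj⟩ := hT.connected i κ T' hT'.isClosed hT'.separated
    ((subset_iUnion T i).trans (hT.eq_iUnion.symm.trans hT'.eq_iUnion).subset)
  obtain ⟨k, hk⟩ := hT'.connected j ι T hT.isClosed hT.separated
    ((subset_iUnion T' j).trans (hT'.eq_iUnion.symm.trans hT.eq_iUnion).subset)
  obtain rfl := hT.eq_of_nonempty h (hT.nonempty i) Subset.rfl (hj.trans hk)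
  exact ⟨j, hj.antisymm hk⟩

theorem PerpConnected.isDecomp (h : PerpConnected perp K) (hK : IsClosed K) (hne : K.Nonempty) :
    IsDecomp perp K fun _ : Unit => K :=
  ⟨⟨fun _ => hK, fun _ _ hij => absurd rfl hij, fun _ => hne, (iUnion_const K).symm⟩, fun _ => h⟩

theorem IsDecomp.perpConnected_of_subsingleton {ι : Type*} [Subsingleton ι] {T : ι → Set Ω}
    (hT : IsDecomp perp K T) (hK : K.Nonempty) : PerpConnected perp K := by
  obtain ⟨i⟩ := hT.index_nonempty hK
  have : K = T i := by
    rw [hT.eq_iUnion]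
    exact Subset.antisymm (iUnion_subset fun j => by rw [Subsingleton.elim j i]) (subset_iUnion T i)
  rw [this]
  exact hT.connected i

/-- Splitting one part of a partition further. -/
theorem IsPerpPartition.refine {ι κ : Type} [Fintype ι] [Fintype κ] {T : ι → Set Ω} {S : κ → Set Ω}
    (h : IsSeparation 𝒜 perp) (hT : IsPerpPartition perp K T) {i : ι} (hS : ∀ j, IsClosed (S j))
    (hp : ∀ j k, j ≠ k → perp (S j) (S k)) (hi : T i ⊆ ⋃ j, S j) :
    IsPerpPartition perp K (Sum.elim (fun j : {j // j ≠ i} => T j)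
      fun j : {j // (T i ∩ S j).Nonempty} => T i ∩ S j) := by
  have hm : ∀ j, MeasurableSet (T i ∩ S j) := fun j => ((hT.isClosed i).inter (hS j)).measurableSet
  refine ⟨?_, ?_, ?_, ?_⟩
  · rintro (j | j)
    · exact hT.isClosed j
    · exact (hT.isClosed i).inter (hS j)
  · rintro (j | j) (k | k) hjk
    · exact hT.separated _ _ fun he => hjk (congrArg Sum.inl (Subtype.ext he))
    · exact h.perp_mono (hT.isClosed j).measurableSet (hm k) (hT.isClosed j).measurableSet
        (hT.isClosed i).measurableSet Subset.rfl inter_subset_left (hT.separated _ _ j.2)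
    · exact h.perp_mono (hm j) (hT.isClosed k).measurableSet (hT.isClosed i).measurableSet
        (hT.isClosed k).measurableSet inter_subset_left Subset.rfl (hT.separated _ _ k.2.symm)
    · exact h.perp_mono (hm j) (hm k) (hS j).measurableSet (hS k).measurableSet
        inter_subset_right inter_subset_right
        (hp _ _ fun he => hjk (congrArg Sum.inr (Subtype.ext he)))
  · rintro (j | j)
    · exact hT.nonempty j
    · exact j.2
  · rw [hT.eq_iUnion]
    refine Subset.antisymm (fun x hx => ?_) (iUnion_subset ?_)
    · obtain ⟨j, hj⟩ := mem_iUnion.1 hx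
      by_cases hji : j = i
      · subst hji
        obtain ⟨k, hk⟩ := mem_iUnion.1 (hi hj)
        exact mem_iUnion.2 ⟨Sum.inr ⟨k, x, hj, hk⟩, hj, hk⟩
      · exact mem_iUnion.2 ⟨Sum.inl ⟨j, hji⟩, hj⟩
    · rintro (j | j)
      · exact subset_iUnion T j
      · exact inter_subset_left.trans (subset_iUnion T i)

/-- If the number of parts of the partitions is bounded, a maximal partition is a decomposition. -/
theorem exists_isDecomp_of_bounded (h : IsSeparation 𝒜 perp) (hK : IsClosed K) (hne : K.Nonempty)
    {N : ℕ} (hN : ∀ (ι : Type) [Fintype ι] (T : ι → Set Ω), IsPerpPartition perp K T →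
      Fintype.card ι ≤ N) :
    ∃ (ι : Type) (_ : Fintype ι) (T : ι → Set Ω), IsDecomp perp K T := by
  classical
  let D : Set ℕ := {m | ∃ (ι : Type) (_ : Fintype ι) (T : ι → Set Ω),
    IsPerpPartition perp K T ∧ Fintype.card ι = m}
  have hD : BddAbove D := ⟨N, fun m ⟨ι, _, T, hT, hm⟩ => hm ▸ hN ι T hT⟩
  have hD0 : D.Nonempty := ⟨_, Unit, inferInstance, fun _ => K,
    ⟨fun _ => hK, fun _ _ hij => absurd rfl hij, fun _ => hne, (iUnion_const K).symm⟩, rfl⟩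
  obtain ⟨ι, _, T, hT, hm⟩ := Nat.sSup_mem hD0 hD
  refine ⟨ι, inferInstance, T, hT, fun i κ _ S hS hp hi => ?_⟩
  -- A part contained in no single `S j` meets at least two of them. Cutting it produces a partition
  -- with more parts than the maximum.
  by_contra! hno
  have hle := le_csSup hD ⟨_, inferInstance, _, hT.refine h hS hp hi, rfl⟩
  rw [← hm, Fintype.card_sum] at hle
  have h1 : Fintype.card {j // j ≠ i} + 1 = Fintype.card ι := by
    rw [Fintype.card_subtype_compl, Fintype.card_subtype_eq]
    have := Fintype.card_pos_iff.2 ⟨i⟩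
    omega
  have h2 : 1 < Fintype.card {j // (T i ∩ S j).Nonempty} := by
    obtain ⟨x, hx⟩ := hT.nonempty i
    obtain ⟨j, hj⟩ := mem_iUnion.1 (hi hx)
    obtain ⟨y, hy, hyj⟩ := not_subset.1 (hno j)
    obtain ⟨k, hk⟩ := mem_iUnion.1 (hi hy)
    refine Fintype.one_lt_card_iff.2 ⟨⟨j, x, hx, hj⟩, ⟨k, y, hy, hk⟩, fun he => hyj ?_⟩
    obtain rfl : j = k := congrArg Subtype.val he
    exact hk
  omega

/-! ### Restrictions to the parts of a cover of the support -/

theorem restrict_eq_self_of_support_subset (hP : P ∈ finMeasures Ω) (hK : P.support ⊆ K) :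
    P.restrict K = P := by
  obtain ⟨-, -, h⟩ := hP
  rw [Measure.restrict_eq_self_of_ae_mem]
  exact mem_of_superset Measure.support_mem_ae_of_innerRegular hK

theorem finMeasures.support_nonempty (hP : P ∈ finMeasures Ω) : P.support.Nonempty := by
  obtain ⟨-, h0, h⟩ := hP
  rw [nonempty_iff_ne_empty]
  intro he
  have := Measure.measure_compl_support_of_innerRegular (μ := P)
  rw [he, compl_empty, Measure.measure_univ_eq_zero] at this
  exact h0 this

theorem IsPerpCover.support_restrict {ι : Type*} [Fintype ι] {S : ι → Set Ω}
    (hb : IsClusteringBase 𝒜 Q perp) (hS : IsPerpCover perp P S) (hP : P ∈ finMeasures Ω) (i : ι) :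
    (P.restrict (S i)).support = P.support ∩ S i := by
  obtain ⟨-, -, h⟩ := hP
  refine Subset.antisymm (subset_inter (Measure.support_mono Measure.restrict_le_self)
    (support_restrict_subset_closed (hS.isClosed i))) fun x hx => ?_
  rw [Measure.mem_support_iff_forall]
  intro U hU
  -- There are finitely many other pieces and they are closed, so `x` has a neighbourhood missing
  -- them, in which `P` charges only `S i`.
  have hC : IsClosed (⋃ j : {j // j ≠ i}, S j) := isClosed_iUnion_of_finite fun j => hS.isClosed j
  have hx' : x ∈ (⋃ j : {j // j ≠ i}, S j)ᶜ := by
    intro hxj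
    obtain ⟨j, hj⟩ := mem_iUnion.1 hxj
    exact disjoint_left.1 (hS.disjoint hb j.2) hj hx.2
  have hpos := (Measure.mem_support_iff_forall x).1 hx.1 _
    (inter_mem hU (hC.isOpen_compl.mem_nhds hx'))
  rw [Measure.restrict_apply' (hS.isClosed i).measurableSet, pos_iff_ne_zero]
  intro h0
  refine hpos.ne' (measure_mono_null (?_ : _ ⊆ (U ∩ S i) ∪ P.supportᶜ)
    (measure_union_null h0 Measure.measure_compl_support_of_innerRegular))
  rintro y ⟨hyU, hy⟩
  by_cases hyP : y ∈ P.support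
  · obtain ⟨j, hj⟩ := mem_iUnion.1 (hS.cover hyP)
    by_cases hji : j = i
    · exact Or.inl ⟨hyU, hji ▸ hj⟩
    · exact absurd (mem_iUnion.2 ⟨⟨j, hji⟩, hj⟩) hy
  · exact Or.inr hyP

theorem IsPerpPartition.support_restrict {ι : Type*} [Fintype ι] {T : ι → Set Ω}
    (hb : IsClusteringBase 𝒜 Q perp) (hT : IsPerpPartition perp P.support T)
    (hP : P ∈ finMeasures Ω) (i : ι) : (P.restrict (T i)).support = T i := by
  rw [hT.isPerpCover.support_restrict hb hP, inter_eq_right]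
  exact (subset_iUnion T i).trans hT.eq_iUnion.symm.subset

theorem IsPerpPartition.measure_ne_zero {ι : Type*} [Fintype ι] {T : ι → Set Ω}
    (hb : IsClusteringBase 𝒜 Q perp) (hT : IsPerpPartition perp P.support T)
    (hP : P ∈ finMeasures Ω) (i : ι) : P (T i) ≠ 0 := by
  intro h0
  have h1 := hT.support_restrict hb hP i
  rw [Measure.restrict_eq_zero.2 h0, Measure.support_zero] at h1
  exact (hT.nonempty i).ne_empty h1.symm

theorem IsPerpPartition.restrict_mem {ι : Type*} [Fintype ι] {T : ι → Set Ω}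
    (hs : IsStableClusteringBase 𝒜 Q perp) (hT : IsPerpPartition perp P.support T)
    (hP : P ∈ adaptedLimits 𝒜 Q perp) (i : ι) : P.restrict (T i) ∈ adaptedLimits 𝒜 Q perp :=
  adaptedLimits.restrict hs hT.isPerpCover hP (hT.measure_ne_zero hs.base hP.1.1 i)

theorem exists_isDecomp (hs : IsStableClusteringBase 𝒜 Q perp)
    (hP : P ∈ adaptedLimits 𝒜 Q perp) :
    ∃ (ι : Type) (_ : Fintype ι) (T : ι → Set Ω), IsDecomp perp P.support T := by
  have hb := hs.base
  obtain ⟨R, F, hR⟩ := hP.2.2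
  have hfin := (hR.1.isLaminar hb 0).finite
  refine exists_isDecomp_of_bounded hb.separation Measure.isClosed_support
    (finMeasures.support_nonempty hP.1.1) (N := (F 0).ncard) fun ι _ T hT => ?_
  -- Each part contains a node of `F 0`, and different parts contain different nodes. This bounds
  -- the number of parts.
  choose H hH using fun i => hR.inside_nonempty hs hT.isPerpCover
    (hT.measure_ne_zero hb hP.1.1 i) 0
  have hinj : Function.Injective H := fun i j hij => hT.eq_of_nonempty hb.separation
    ((hR.1.isLaminar hb 0).nonempty _ (hH i).1) (hH i).2 (hij ▸ (hH j).2)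
  rw [← Nat.card_eq_fintype_card, ← ncard_range_of_injective hinj]
  exact ncard_le_ncard (range_subset_iff.2 fun i => (hH i).1) hfin

theorem exists_nontrivial_isDecomp (hs : IsStableClusteringBase 𝒜 Q perp)
    (hP : P ∈ adaptedLimits 𝒜 Q perp) (hc : ¬ PerpConnected perp P.support) :
    ∃ (ι : Type) (_ : Fintype ι) (_ : Nontrivial ι) (T : ι → Set Ω),
      IsDecomp perp P.support T := by
  obtain ⟨ι, _, T, hT⟩ := exists_isDecomp hs hP
  refine ⟨ι, inferInstance, ?_, T, hT⟩
  rw [← not_subsingleton_iff_nontrivial]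
  exact fun _ => hc (hT.perpConnected_of_subsingleton (finMeasures.support_nonempty hP.1.1))

end Decompositions

/-! ### Classes of measures modulo scaling and adding base measures. -/

section Representatives

variable {Ω : Type*} [TopologicalSpace Ω] [MeasurableSpace Ω] [OpensMeasurableSpace Ω]
  {𝒜 : Set (Set Ω)} {Q : Set Ω → Measure Ω} {perp : Set Ω → Set Ω → Prop}
  {P P' P₁ P₂ T D : Measure Ω} {A : Set Ω} {F G : Set (Set Ω)} {s β : ℝ≥0}

/-- `P` is obtained from `P'` by scaling and possibly adding a base measure around it. -/
def Step (𝒜 : Set (Set Ω)) (Q : Set Ω → Measure Ω) (perp : Set Ω → Set Ω → Prop)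
    (P P' : Measure Ω) : Prop :=
  P ∈ adaptedLimits 𝒜 Q perp ∧ P' ∈ adaptedLimits 𝒜 Q perp ∧
    ((∃ s : ℝ≥0, 0 < s ∧ P = s • P') ∨
      ∃ A ∈ 𝒜, ∃ β s : ℝ≥0, 0 < β ∧ 0 < s ∧ P'.support ⊆ A ∧ P = β • Q A + s • P')

theorem step_smul (hP : P ∈ adaptedLimits 𝒜 Q perp) (hs : 0 < s) : Step 𝒜 Q perp (s • P) P :=
  ⟨adaptedLimits.smul hP hs, hP, Or.inl ⟨s, hs, rfl⟩⟩

theorem step_add_base (hb : IsClusteringBase 𝒜 Q perp) (hA : A ∈ 𝒜) (hβ : 0 < β)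
    (hPA : P.support ⊆ A) (hP : P ∈ adaptedLimits 𝒜 Q perp) :
    Step 𝒜 Q perp (β • Q A + P) P :=
  ⟨adaptedLimits.add_base hb hA hβ hPA hP, hP,
    Or.inr ⟨A, hA, β, 1, hβ, one_pos, hPA, by rw [one_smul]⟩⟩

theorem Step.smul_left (h : Step 𝒜 Q perp P P') (hs : 0 < s) : Step 𝒜 Q perp (s • P) P' := by
  obtain ⟨hP, hP', ⟨t, ht, rfl⟩ | ⟨A, hA, β, t, hβ, ht, hPA, rfl⟩⟩ := h
  · exact ⟨adaptedLimits.smul hP hs, hP', Or.inl ⟨s * t, mul_pos hs ht, smul_smul s t P'⟩⟩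
  · refine ⟨adaptedLimits.smul hP hs, hP', Or.inr
      ⟨A, hA, s * β, s * t, mul_pos hs hβ, mul_pos hs ht, hPA, ?_⟩⟩
    rw [smul_add, smul_smul, smul_smul]

theorem Step.of_smul_left (hs : 0 < s) (h : Step 𝒜 Q perp (s • P) P') : Step 𝒜 Q perp P P' := by
  have := h.smul_left (inv_pos.2 hs)
  rwa [inv_smul_smul₀ hs.ne'] at this

/-- Two decompositions of one measure use the same base set, namely its support. Cancelling the
smaller of the two coefficients shows that one remainder is obtained from the other by a step. This
is the confluence behind the equivalence relation. -/
theorem step_or_step (hb : IsClusteringBase 𝒜 Q perp) (h₁ : Step 𝒜 Q perp P P₁)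
    (h₂ : Step 𝒜 Q perp P P₂) : Step 𝒜 Q perp P₁ P₂ ∨ Step 𝒜 Q perp P₂ P₁ := by
  obtain ⟨-, hP₁, ⟨s, hs, he⟩ | ⟨A, hA, β, s, hβ, hs, hPA, he⟩⟩ := id h₁
  · exact Or.inl (Step.of_smul_left hs (he ▸ h₂))
  obtain ⟨-, hP₂, ⟨t, ht, he'⟩ | ⟨A', hA', γ, t, hγ, ht, hPA', he'⟩⟩ := id h₂
  · exact Or.inr (Step.of_smul_left ht (he' ▸ h₁))
  obtain rfl : A = A' := by
    rw [← support_add_base hb hA hβ ((support_nnreal_smul hs P₁).trans_subset hPA), ← he, he',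
      support_add_base hb hA' hγ ((support_nnreal_smul ht P₂).trans_subset hPA')]
  have key : ∀ {P₁ P₂ : Measure Ω} {β γ s t : ℝ≥0}, P₁ ∈ adaptedLimits 𝒜 Q perp →
      P₂ ∈ adaptedLimits 𝒜 Q perp → 0 < s → 0 < t → P₂.support ⊆ A →
      β • Q A + s • P₁ = γ • Q A + t • P₂ → β ≤ γ → Step 𝒜 Q perp P₁ P₂ := by
    intro P₁ P₂ β γ s t hP₁ hP₂ hs ht hPA he hle
    have := hb.prob A hA
    obtain ⟨δ, rfl⟩ := exists_add_of_le hle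
    rw [add_smul, add_assoc, Measure.add_right_inj] at he
    refine Step.of_smul_left hs ⟨adaptedLimits.smul hP₁ hs, hP₂, ?_⟩
    rcases eq_or_lt_of_le (zero_le (a := δ)) with rfl | hδ
    · exact Or.inl ⟨t, ht, by simpa using he⟩
    · exact Or.inr ⟨A, hA, δ, t, hδ, ht, hPA, he⟩
  rcases le_total β γ with h | h
  · exact Or.inl (key hP₁ hP₂ hs ht hPA' (he.symm.trans he') h)
  · exact Or.inr (key hP₂ hP₁ ht hs hPA (he'.symm.trans he) h)

/-- The equivalence relation generated by `Step`. -/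
abbrev Related (𝒜 : Set (Set Ω)) (Q : Set Ω → Measure Ω) (perp : Set Ω → Set Ω → Prop) :
    Measure Ω → Measure Ω → Prop :=
  Relation.Join (Relation.ReflTransGen (Step 𝒜 Q perp))

theorem related_equivalence (hb : IsClusteringBase 𝒜 Q perp) : Equivalence (Related 𝒜 Q perp) := by
  refine Relation.equivalence_join_reflTransGen fun P P₁ P₂ h₁ h₂ => ?_
  rcases step_or_step hb h₁ h₂ with h | h
  · exact ⟨P₂, .single h, .refl⟩
  · exact ⟨P₁, .refl, .single h⟩

theorem Step.related (h : Step 𝒜 Q perp P P') : Related 𝒜 Q perp P P' := ⟨P', .single h, .refl⟩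

theorem mem_adaptedLimits_of_reflTransGen (hP : P ∈ adaptedLimits 𝒜 Q perp)
    (h : Relation.ReflTransGen (Step 𝒜 Q perp) P P') : P' ∈ adaptedLimits 𝒜 Q perp := by
  rcases Relation.ReflTransGen.cases_tail h with rfl | ⟨_, _, h⟩
  · exact hP
  · exact h.2.1

/-- A step adding a base measure exhibits a removable one in its source. A measure without one can
only be rescaled. -/
theorem exists_eq_smul_of_reflTransGen (h0 : ¬ HasBase 𝒜 Q perp P)
    (h : Relation.ReflTransGen (Step 𝒜 Q perp) P P') : ∃ s : ℝ≥0, 0 < s ∧ P = s • P' := by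
  induction h with
  | refl => exact ⟨1, one_pos, (one_smul _ _).symm⟩
  | tail _ h ih =>
    obtain ⟨s, hs, rfl⟩ := ih
    obtain ⟨-, hP', ⟨t, ht, rfl⟩ | ⟨A, hA, β, t, hβ, ht, hPA, rfl⟩⟩ := h
    · exact ⟨s * t, mul_pos hs ht, smul_smul _ _ _⟩
    · rw [hasBase_smul_iff hs] at h0
      exact absurd ⟨A, hA, β, hβ, _, adaptedLimits.smul hP' ht,
        (support_nnreal_smul ht _).trans_subset hPA, rfl⟩ h0

theorem Step.hasCore_iff (hs : IsStableClusteringBase 𝒜 Q perp) (h : Step 𝒜 Q perp P P')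
    (hP' : HasBase 𝒜 Q perp P') :
    HasBase 𝒜 Q perp P ∧ ∀ G, HasCore 𝒜 Q perp P G ↔ HasCore 𝒜 Q perp P' G := by
  obtain ⟨-, hm, ⟨t, ht, rfl⟩ | ⟨A, hA, β, t, hβ, ht, hPA, rfl⟩⟩ := h
  · exact ⟨hP'.smul ht, fun G => hasCore_smul_iff ht⟩
  · have hPA' := (support_nnreal_smul ht P').trans_subset hPA
    refine ⟨⟨A, hA, β, hβ, _, adaptedLimits.smul hm ht, hPA', rfl⟩, fun G => ?_⟩
    rw [hasCore_add_base_iff hs hA hβ hPA' (hP'.smul ht), hasCore_smul_iff ht]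

theorem hasCore_iff_of_reflTransGen (hs : IsStableClusteringBase 𝒜 Q perp)
    (h : Relation.ReflTransGen (Step 𝒜 Q perp) P P') (hP' : HasBase 𝒜 Q perp P') :
    HasBase 𝒜 Q perp P ∧ ∀ G, HasCore 𝒜 Q perp P G ↔ HasCore 𝒜 Q perp P' G := by
  induction h using Relation.ReflTransGen.head_induction_on with
  | refl => exact ⟨hP', fun _ => Iff.rfl⟩
  | head h _ ih =>
    obtain ⟨h1, h2⟩ := h.hasCore_iff hs ih.1
    exact ⟨h1, fun G => (h2 G).trans (ih.2 G)⟩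

/-- A genuine addition of a base measure hides a single root of the target, so only `lower F` is
inherited; later steps keep it unchanged. -/
theorem hasCore_of_reflTransGen (hs : IsStableClusteringBase 𝒜 Q perp)
    (h : Relation.ReflTransGen (Step 𝒜 Q perp) P P') :
    (∃ s : ℝ≥0, 0 < s ∧ P = s • P') ∨
      (HasBase 𝒜 Q perp P ∧ ∀ F, IsCandidate 𝒜 Q perp P' F → HasCore 𝒜 Q perp P (lower F)) := by
  induction h using Relation.ReflTransGen.head_induction_on with
  | refl => exact Or.inl ⟨1, one_pos, (one_smul _ _).symm⟩
  | head h _ ih =>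
    obtain ⟨t, ht, rfl⟩ | ⟨h1, h2⟩ := ih
    · obtain ⟨-, hm, ⟨u, hu, rfl⟩ | ⟨A, hA, β, u, hβ, hu, hPA, rfl⟩⟩ := h
      · exact Or.inl ⟨u * t, mul_pos hu ht, smul_smul _ _ _⟩
      · have hPA' := (support_nnreal_smul hu _).trans_subset hPA
        exact Or.inr ⟨⟨A, hA, β, hβ, _, adaptedLimits.smul hm hu, hPA', rfl⟩,
          fun F hF => ((hF.smul ht).smul hu).hasCore_add_base hs hA hβ hPA'⟩
    · obtain ⟨h3, h4⟩ := h.hasCore_iff hs h1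
      exact Or.inr ⟨h3, fun F hF => (h4 _).2 (h2 F hF)⟩

/-- `T` represents the class of `P`; it contains no removable base measure if this is possible
within the class. -/
def IsRep (𝒜 : Set (Set Ω)) (Q : Set Ω → Measure Ω) (perp : Set Ω → Set Ω → Prop)
    (P T : Measure Ω) : Prop :=
  (Related 𝒜 Q perp P T ∧ T ∈ adaptedLimits 𝒜 Q perp) ∧
    ((∃ D, (Related 𝒜 Q perp P D ∧ D ∈ adaptedLimits 𝒜 Q perp) ∧ ¬ HasBase 𝒜 Q perp D) →
      ¬ HasBase 𝒜 Q perp T)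

/-- The chosen representative of the class of `P`. -/
noncomputable def rep (𝒜 : Set (Set Ω)) (Q : Set Ω → Measure Ω) (perp : Set Ω → Set Ω → Prop)
    (P : Measure Ω) : Measure Ω := Classical.epsilon (IsRep 𝒜 Q perp P)

theorem isRep_rep (hb : IsClusteringBase 𝒜 Q perp) (hP : P ∈ adaptedLimits 𝒜 Q perp) :
    IsRep 𝒜 Q perp P (rep 𝒜 Q perp P) := by
  refine Classical.epsilon_spec ?_
  by_cases h : ∃ D, (Related 𝒜 Q perp P D ∧ D ∈ adaptedLimits 𝒜 Q perp) ∧ ¬ HasBase 𝒜 Q perp D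
  · obtain ⟨D, hD, hD'⟩ := h
    exact ⟨D, hD, fun _ => hD'⟩
  · exact ⟨P, ⟨(related_equivalence hb).refl P, hP⟩, fun h' => absurd h' h⟩

theorem rep_mem (hb : IsClusteringBase 𝒜 Q perp) (hP : P ∈ adaptedLimits 𝒜 Q perp) :
    rep 𝒜 Q perp P ∈ adaptedLimits 𝒜 Q perp := (isRep_rep hb hP).1.2

theorem Step.rep_eq (hb : IsClusteringBase 𝒜 Q perp) (h : Step 𝒜 Q perp P P') :
    rep 𝒜 Q perp P = rep 𝒜 Q perp P' := by
  have he := related_equivalence hb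
  have hD : ∀ D, Related 𝒜 Q perp P D ↔ Related 𝒜 Q perp P' D := fun D =>
    ⟨fun hD => he.trans (he.symm h.related) hD, fun hD => he.trans h.related hD⟩
  have : IsRep 𝒜 Q perp P = IsRep 𝒜 Q perp P' := by
    funext T
    simp only [IsRep, hD]
  rw [rep, rep, this]

/-- A measure without removable base measure forces its representative to have none either. From
both, only scalings lead to the common descendant. -/
theorem rep_eq_smul (hb : IsClusteringBase 𝒜 Q perp) (hP : P ∈ adaptedLimits 𝒜 Q perp)
    (h0 : ¬ HasBase 𝒜 Q perp P) : ∃ s : ℝ≥0, 0 < s ∧ rep 𝒜 Q perp P = s • P := by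
  obtain ⟨⟨⟨D, hPD, hTD⟩, -⟩, hT⟩ := isRep_rep hb hP
  have hT0 := hT ⟨P, ⟨(related_equivalence hb).refl P, hP⟩, h0⟩
  obtain ⟨s, hs, rfl⟩ := exists_eq_smul_of_reflTransGen h0 hPD
  obtain ⟨t, ht, he⟩ := exists_eq_smul_of_reflTransGen hT0 hTD
  refine ⟨t * s⁻¹, mul_pos ht (inv_pos.2 hs), ?_⟩
  rw [he, smul_smul, inv_mul_cancel_right₀ hs.ne']

/-- `P` and its representative have a common descendant `D`. If `D` has a removable base measure,
all three share the admissible forests below their supports. Otherwise the representative is a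
multiple of `D`, and its candidates are inherited by `P` through the steps from `P` to `D`. -/
theorem hasCore_of_isCandidate_rep (hs : IsStableClusteringBase 𝒜 Q perp)
    (hP : P ∈ adaptedLimits 𝒜 Q perp) (hB : HasBase 𝒜 Q perp P)
    (hF : IsCandidate 𝒜 Q perp (rep 𝒜 Q perp P) F) : HasCore 𝒜 Q perp P (lower F) := by
  obtain ⟨⟨⟨D, hPD, hTD⟩, -⟩, hT⟩ := isRep_rep hs.base hP
  by_cases hD : HasBase 𝒜 Q perp D
  · obtain ⟨h1, h2⟩ := hasCore_iff_of_reflTransGen hs hTD hD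
    exact ((hasCore_iff_of_reflTransGen hs hPD hD).2 _).2 ((h2 _).1 (hF.hasCore hs h1))
  · have hT0 := hT ⟨D, ⟨⟨D, hPD, .refl⟩, mem_adaptedLimits_of_reflTransGen hP hPD⟩, hD⟩
    obtain ⟨t, ht, he⟩ := exists_eq_smul_of_reflTransGen hT0 hTD
    rw [he, isCandidate_smul_iff ht] at hF
    rcases hasCore_of_reflTransGen hs hPD with ⟨u, hu, rfl⟩ | ⟨-, h⟩
    · exact absurd ((hasBase_smul_iff hu).1 hB) hD
    · exact h F hF

/-- The support is a base set. Hence splitting into parts and removing base measures never compete.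
-/
theorem HasBase.perpConnected (hb : IsClusteringBase 𝒜 Q perp) (h : HasBase 𝒜 Q perp P) :
    PerpConnected perp P.support := by
  obtain ⟨A, hA, β, hβ, P', -, hPA, rfl⟩ := h
  rw [support_add_base hb hA hβ hPA]
  exact hb.separation.perpConnected hA

end Representatives

/-! ### The coherent choice of clusters and the axioms. -/

section Selection

variable {Ω : Type*} [TopologicalSpace Ω] [MeasurableSpace Ω] [OpensMeasurableSpace Ω]
  {𝒜 : Set (Set Ω)} {Q : Set Ω → Measure Ω} {perp : Set Ω → Set Ω → Prop}
  {P P' : Measure Ω} {A B : Set Ω} {F G : Set (Set Ω)} {s β : ℝ≥0}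

/-- A chosen candidate. -/
noncomputable def chosen (𝒜 : Set (Set Ω)) (Q : Set Ω → Measure Ω) (perp : Set Ω → Set Ω → Prop)
    (P : Measure Ω) : Set (Set Ω) := Classical.epsilon (IsCandidate 𝒜 Q perp P)

theorem isCandidate_chosen (hs : IsStableClusteringBase 𝒜 Q perp)
    (hP : P ∈ adaptedLimits 𝒜 Q perp) : IsCandidate 𝒜 Q perp P (chosen 𝒜 Q perp P) :=
  Classical.epsilon_spec (exists_isCandidate hs hP)

/-- The clusters of `P`. They are chosen on the representatives with connected support, and
propagated from there by additivity. -/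
inductive IsCluster (𝒜 : Set (Set Ω)) (Q : Set Ω → Measure Ω) (perp : Set Ω → Set Ω → Prop) :
    Measure Ω → Set Ω → Prop
  | part {P : Measure Ω} {B : Set Ω} (hP : ¬ PerpConnected perp P.support) (ι : Type) [Fintype ι]
      (T : ι → Set Ω) (hT : IsDecomp perp P.support T) (i : ι)
      (hB : IsCluster 𝒜 Q perp (P.restrict (T i)) B) : IsCluster 𝒜 Q perp P B
  | choice {P : Measure Ω} {B : Set Ω} (hP : PerpConnected perp P.support)
      (h0 : ¬ HasBase 𝒜 Q perp P) (hB : B ∈ chosen 𝒜 Q perp (rep 𝒜 Q perp P)) :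
      IsCluster 𝒜 Q perp P B
  | root {P : Measure Ω} (hP : HasBase 𝒜 Q perp P) : IsCluster 𝒜 Q perp P P.support
  | inner {P : Measure Ω} {B : Set Ω} (hP : HasBase 𝒜 Q perp P)
      (hT : PerpConnected perp (rep 𝒜 Q perp P).support)
      (hB : B ∈ lower (chosen 𝒜 Q perp (rep 𝒜 Q perp P))) : IsCluster 𝒜 Q perp P B
  | descend {P : Measure Ω} {B : Set Ω} (hP : HasBase 𝒜 Q perp P)
      (hT : ¬ PerpConnected perp (rep 𝒜 Q perp P).support)
      (hB : IsCluster 𝒜 Q perp (rep 𝒜 Q perp P) B) : IsCluster 𝒜 Q perp P B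

/-- The set of clusters of `P`. -/
def clusters (𝒜 : Set (Set Ω)) (Q : Set Ω → Measure Ω) (perp : Set Ω → Set Ω → Prop)
    (P : Measure Ω) : Set (Set Ω) := {B | IsCluster 𝒜 Q perp P B}

theorem clusters_of_not_hasBase (hP : PerpConnected perp P.support) (h0 : ¬ HasBase 𝒜 Q perp P) :
    clusters 𝒜 Q perp P = chosen 𝒜 Q perp (rep 𝒜 Q perp P) := by
  ext B
  refine ⟨fun h => ?_, fun h => .choice hP h0 h⟩
  cases h with
  | part h => exact absurd hP h
  | choice _ _ h => exact h
  | root h => exact absurd h h0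
  | inner h => exact absurd h h0
  | descend h => exact absurd h h0

theorem clusters_of_hasBase (hb : IsClusteringBase 𝒜 Q perp) (hP : HasBase 𝒜 Q perp P)
    (hT : PerpConnected perp (rep 𝒜 Q perp P).support) :
    clusters 𝒜 Q perp P = insert P.support (lower (chosen 𝒜 Q perp (rep 𝒜 Q perp P))) := by
  ext B
  constructor
  · intro h
    cases h with
    | part h => exact absurd (hP.perpConnected hb) h
    | choice _ h => exact absurd hP h
    | root => exact mem_insert _ _
    | inner _ _ h => exact mem_insert_of_mem _ h
    | descend _ h => exact absurd hT h
  · rintro (rfl | h)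
    · exact .root hP
    · exact .inner hP hT h

/-- Additivity already fixes the value of a disconnected representative, so a free choice there
could conflict with it. All clusters of the representative survive below the new root. -/
theorem clusters_of_hasBase' (hb : IsClusteringBase 𝒜 Q perp) (hP : HasBase 𝒜 Q perp P)
    (hT : ¬ PerpConnected perp (rep 𝒜 Q perp P).support) :
    clusters 𝒜 Q perp P = insert P.support (clusters 𝒜 Q perp (rep 𝒜 Q perp P)) := by
  ext B
  constructor
  · intro h
    cases h with
    | part h => exact absurd (hP.perpConnected hb) h
    | choice _ h => exact absurd hP h
    | root => exact mem_insert _ _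
    | inner _ h => exact absurd h hT
    | descend _ _ h => exact mem_insert_of_mem _ h
  · rintro (rfl | h)
    · exact .root hP
    · exact .descend hP hT h

/-- For a connected support every decomposition has just the support as its part. Otherwise
uniqueness of the parts makes the decomposition in `IsCluster.part` immaterial. -/
theorem clusters_eq_iUnion (hb : IsClusteringBase 𝒜 Q perp) (hP : P ∈ finMeasures Ω) {ι : Type}
    [Fintype ι] {T : ι → Set Ω} (hT : IsDecomp perp P.support T) :
    clusters 𝒜 Q perp P = ⋃ i, clusters 𝒜 Q perp (P.restrict (T i)) := by
  by_cases hc : PerpConnected perp P.support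
  · have hne := finMeasures.support_nonempty hP
    have := hT.index_nonempty hne
    have hTi : ∀ i, P.restrict (T i) = P := by
      intro i
      obtain ⟨-, hi⟩ := hT.exists_eq hb.separation
        (hc.isDecomp Measure.isClosed_support hne) i
      rw [hi, restrict_eq_self_of_support_subset hP Subset.rfl]
    simp only [hTi, iUnion_const]
  · ext B
    rw [mem_iUnion]
    refine ⟨fun h => ?_, fun ⟨i, h⟩ => .part hc ι T hT i h⟩
    cases h with
    | part _ κ T' hT' i hB =>
      obtain ⟨j, hj⟩ := hT'.exists_eq hb.separation hT i
      exact ⟨j, hj ▸ hB⟩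
    | choice h => exact absurd h hc
    | root h => exact absurd (h.perpConnected hb) hc
    | inner h => exact absurd (h.perpConnected hb) hc
    | descend h => exact absurd (h.perpConnected hb) hc

theorem clusters_smul (hs : IsStableClusteringBase 𝒜 Q perp) (hP : P ∈ adaptedLimits 𝒜 Q perp)
    (ht : 0 < s) : clusters 𝒜 Q perp (s • P) = clusters 𝒜 Q perp P := by
  have hb := hs.base
  have key : ∀ {P : Measure Ω}, P ∈ adaptedLimits 𝒜 Q perp → PerpConnected perp P.support →
      clusters 𝒜 Q perp (s • P) = clusters 𝒜 Q perp P := by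
    intro P hP hc
    have hr := (step_smul hP ht).rep_eq hb
    have hsupp := support_nnreal_smul ht P
    by_cases h0 : HasBase 𝒜 Q perp P
    · by_cases hT : PerpConnected perp (rep 𝒜 Q perp P).support
      · rw [clusters_of_hasBase hb h0 hT, clusters_of_hasBase hb (h0.smul ht) (hr ▸ hT), hr, hsupp]
      · rw [clusters_of_hasBase' hb h0 hT, clusters_of_hasBase' hb (h0.smul ht) (hr ▸ hT), hr,
          hsupp]
    · rw [clusters_of_not_hasBase hc h0, clusters_of_not_hasBase (hsupp ▸ hc)
        (mt (hasBase_smul_iff ht).1 h0), hr]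
  obtain ⟨ι, _, T, hT⟩ := exists_isDecomp hs hP
  rw [clusters_eq_iUnion hb hP.1.1 hT, clusters_eq_iUnion hb (finMeasures.smul hP.1.1 ht)
    ((support_nnreal_smul ht P).symm ▸ hT)]
  refine iUnion_congr fun i => ?_
  rw [Measure.restrict_smul]
  refine key (hT.restrict_mem hs hP i) ?_
  rw [hT.support_restrict hb hP.1.1]
  exact hT.connected i

/-! ### The clusters form a candidate -/

section Parts

variable {ι : Type} [Fintype ι] [Nontrivial ι] {T : ι → Set Ω} {F : ι → Set (Set Ω)}

/-- There are at least two parts, so every root has a sibling root in another part. -/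
theorem lower_iUnion_eq (hs : IsStableClusteringBase 𝒜 Q perp) (hP : P ∈ adaptedLimits 𝒜 Q perp)
    (hT : IsDecomp perp P.support T) (hF : ∀ i, IsCandidate 𝒜 Q perp (P.restrict (T i)) (F i)) :
    lower (⋃ i, F i) = ⋃ i, F i := by
  have hb := hs.base
  have hpc := hT.isPerpCover.isPieces hb fun i => (hF i).1
  have hU := IsCandidate.iUnion hs hT.isPerpCover hP.1.1 hF
  refine Subset.antisymm lower_subset fun B hB => ?_
  rcases mem_struct_iff.1 (hU.1.struct_eq.symm ▸ hB) with hroot | h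
  · obtain ⟨i, hi⟩ := mem_iUnion.1 hB
    obtain ⟨j, hij⟩ := exists_ne i
    obtain ⟨C, hC⟩ := (hF j).1.isForest.nonempty
    obtain ⟨D, hD, -⟩ := ((hF j).1.isLaminar hb).exists_root hC
    refine ⟨hB, D, hroot.directSiblings ((hpc.isRoot_iff hD.1).2 hD) ?_⟩
    rintro rfl
    exact hij (hpc.eq_of_subset hD.1 (hpc.subset i B hi) Subset.rfl)
  · exact h

theorem ncard_chosen_restrict_lt (hs : IsStableClusteringBase 𝒜 Q perp)
    (hP : P ∈ adaptedLimits 𝒜 Q perp) (hT : IsDecomp perp P.support T) (i : ι) :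
    (chosen 𝒜 Q perp (P.restrict (T i))).ncard < (chosen 𝒜 Q perp P).ncard := by
  have hb := hs.base
  have hF := fun i => isCandidate_chosen hs (hT.restrict_mem hs hP i)
  have hpc := hT.isPerpCover.isPieces hb fun i => (hF i).1
  have hU := IsCandidate.iUnion hs hT.isPerpCover hP.1.1 hF
  rw [(isCandidate_chosen hs hP).ncard_eq hs hP hU]
  refine ncard_lt_ncard (ssubset_of_subset_of_ne
    (subset_iUnion (fun i => chosen 𝒜 Q perp (P.restrict (T i))) i) fun he => ?_)
    hU.1.isForest.finite
  obtain ⟨j, hij⟩ := exists_ne i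
  obtain ⟨C, hC⟩ := (hF j).1.isForest.nonempty
  exact hij (hpc.eq_of_subset hC (hpc.subset i C (he.symm ▸ mem_iUnion_of_mem j hC)) Subset.rfl)

end Parts

/-- All nodes of a disconnected representative lie in `lower`, so they reappear below the root of
`P`. Passing next to the parts of the representative makes the count strictly smaller than that of
`P`. -/
theorem ncard_chosen_rep_le (hs : IsStableClusteringBase 𝒜 Q perp)
    (hP : P ∈ adaptedLimits 𝒜 Q perp) (h0 : HasBase 𝒜 Q perp P)
    (hc : ¬ PerpConnected perp (rep 𝒜 Q perp P).support) :
    (chosen 𝒜 Q perp (rep 𝒜 Q perp P)).ncard ≤ (chosen 𝒜 Q perp P).ncard := by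
  have hr := rep_mem hs.base hP
  obtain ⟨ι, _, _, T, hT⟩ := exists_nontrivial_isDecomp hs hr hc
  have hF := fun i => isCandidate_chosen hs (hT.restrict_mem hs hr i)
  have hU := IsCandidate.iUnion hs hT.isPerpCover hr.1.1 hF
  have hcore := hasCore_of_isCandidate_rep hs hP h0 hU
  rw [lower_iUnion_eq hs hr hT hF] at hcore
  rw [(isCandidate_chosen hs hr).ncard_eq hs hr hU,
    (isCandidate_chosen hs hP).ncard_eq hs hP hcore.isCandidate]
  exact ncard_le_ncard (subset_insert _ _) hcore.isCandidate.1.isForest.finite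

theorem isCandidate_clusters (hs : IsStableClusteringBase 𝒜 Q perp)
    (hP : P ∈ adaptedLimits 𝒜 Q perp) : IsCandidate 𝒜 Q perp P (clusters 𝒜 Q perp P) := by
  have hb := hs.base
  induction hN : (chosen 𝒜 Q perp P).ncard using Nat.strong_induction_on generalizing P with
  | _ N ih =>
  -- The bound `≤ N` lets this serve both for `P` itself and for its representative; the induction
  -- hypothesis is used only at parts, where the count is strictly smaller.
  have key : ∀ {P : Measure Ω}, P ∈ adaptedLimits 𝒜 Q perp → (chosen 𝒜 Q perp P).ncard ≤ N →
      ¬ PerpConnected perp P.support → IsCandidate 𝒜 Q perp P (clusters 𝒜 Q perp P) ∧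
        lower (clusters 𝒜 Q perp P) = clusters 𝒜 Q perp P := by
    intro P hP hle hc
    obtain ⟨ι, _, _, T, hT⟩ := exists_nontrivial_isDecomp hs hP hc
    have hF := fun i => ih _ ((ncard_chosen_restrict_lt hs hP hT i).trans_le hle)
      (hT.restrict_mem hs hP i) rfl
    rw [clusters_eq_iUnion hb hP.1.1 hT]
    exact ⟨IsCandidate.iUnion hs hT.isPerpCover hP.1.1 hF, lower_iUnion_eq hs hP hT hF⟩
  by_cases h0 : HasBase 𝒜 Q perp P
  · have hr := rep_mem hb hP
    by_cases hT : PerpConnected perp (rep 𝒜 Q perp P).support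
    · rw [clusters_of_hasBase hb h0 hT]
      exact (hasCore_of_isCandidate_rep hs hP h0 (isCandidate_chosen hs hr)).isCandidate
    · obtain ⟨h1, h2⟩ := key hr (hN ▸ ncard_chosen_rep_le hs hP h0 hT) hT
      have := hasCore_of_isCandidate_rep hs hP h0 h1
      rw [h2] at this
      rw [clusters_of_hasBase' hb h0 hT]
      exact this.isCandidate
  · by_cases hc : PerpConnected perp P.support
    · obtain ⟨t, ht, he⟩ := rep_eq_smul hb hP h0
      rw [clusters_of_not_hasBase hc h0, ← isCandidate_smul_iff ht, ← he]
      exact isCandidate_chosen hs (rep_mem hb hP)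
    · exact (key hP hN.le hc).1

theorem lower_clusters (hs : IsStableClusteringBase 𝒜 Q perp) (hP : P ∈ adaptedLimits 𝒜 Q perp)
    (hc : ¬ PerpConnected perp P.support) :
    lower (clusters 𝒜 Q perp P) = clusters 𝒜 Q perp P := by
  obtain ⟨ι, _, _, T, hT⟩ := exists_nontrivial_isDecomp hs hP hc
  rw [clusters_eq_iUnion hs.base hP.1.1 hT]
  exact lower_iUnion_eq hs hP hT fun i => isCandidate_clusters hs (hT.restrict_mem hs hP i)

/-! ### Axioms -/

theorem clusters_base (hs : IsStableClusteringBase 𝒜 Q perp) (hA : A ∈ 𝒜) :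
    clusters 𝒜 Q perp (Q A) = {A} := by
  have hb := hs.base
  have hQ := base_mem_adaptedLimits hb hA
  have hsupp := hb.fitted A hA
  -- One half of `Q A` acts as the added base measure, the other half as the remaining measure.
  have hB : HasBase 𝒜 Q perp (Q A) := by
    have h2 : (0 : ℝ≥0) < 1 / 2 := by positivity
    refine ⟨A, hA, 1 / 2, h2, (1 / 2 : ℝ≥0) • Q A, adaptedLimits.smul hQ h2, ?_, ?_⟩
    · rw [support_nnreal_smul h2, hsupp]
    · rw [← add_smul, add_halves, one_smul]
  have hmem : A ∈ clusters 𝒜 Q perp (Q A) := by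
    have := IsCluster.root hB
    rwa [hsupp] at this
  -- `{A}` is a candidate, so the chosen value has exactly one node, and the support `A` is already
  -- a cluster.
  have hcard := (isCandidate_clusters hs hQ).ncard_eq hs hQ (isCandidate_base hs hA)
  rw [ncard_singleton] at hcard
  obtain ⟨C, hC⟩ := ncard_eq_one.1 hcard
  rw [hC] at hmem ⊢
  rw [mem_singleton_iff.1 hmem]

/-- Adding a base measure keeps the representative. So the clusters below the new root are read from
the same source as those of `P`, and equality is exact. -/
theorem clusters_add_base (hs : IsStableClusteringBase 𝒜 Q perp) (hA : A ∈ 𝒜) (hβ : 0 < β)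
    (hPA : P.support ⊆ A) (hP : P ∈ adaptedLimits 𝒜 Q perp) :
    clusters 𝒜 Q perp (β • Q A + P) = insert A (lower (clusters 𝒜 Q perp P)) := by
  have hb := hs.base
  have hB : HasBase 𝒜 Q perp (β • Q A + P) := ⟨A, hA, β, hβ, P, hP, hPA, rfl⟩
  have hr := (step_add_base hb hA hβ hPA hP).rep_eq hb
  have hsupp := support_add_base hb hA hβ hPA
  have hrm := rep_mem hb hP
  by_cases hT : PerpConnected perp (rep 𝒜 Q perp P).support
  · rw [clusters_of_hasBase hb hB (hr.symm ▸ hT), hr, hsupp]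
    by_cases h0 : HasBase 𝒜 Q perp P
    · have hcore := hasCore_of_isCandidate_rep hs hP h0 (isCandidate_chosen hs hrm)
      rw [clusters_of_hasBase hb h0 hT, lower_insert (hcore.subset_support hb), lower_lower]
    · obtain ⟨t, ht, he⟩ := rep_eq_smul hb hP h0
      rw [clusters_of_not_hasBase _ h0]
      rwa [he, support_nnreal_smul ht] at hT
  · rw [clusters_of_hasBase' hb hB (hr.symm ▸ hT), hr, hsupp]
    have hlow := lower_clusters hs hrm hT
    by_cases h0 : HasBase 𝒜 Q perp P
    · have hcore := hasCore_of_isCandidate_rep hs hP h0 (isCandidate_clusters hs hrm)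
      rw [hlow] at hcore
      rw [clusters_of_hasBase' hb h0 hT, lower_insert (hcore.subset_support hb), hlow]
    · obtain ⟨t, ht, he⟩ := rep_eq_smul hb hP h0
      have hcl : clusters 𝒜 Q perp (rep 𝒜 Q perp P) = clusters 𝒜 Q perp P := by
        rw [he, clusters_smul hs hP ht]
      rw [hcl] at hlow ⊢
      rw [hlow]

theorem support_finsetSum {ι : Type*} (I : Finset ι) (μ : ι → Measure Ω) :
    (∑ i ∈ I, μ i).support = ⋃ i ∈ I, (μ i).support := by
  classical
  induction I using Finset.induction_on with
  | empty => simp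
  | insert i I hi ih =>
    rw [Finset.sum_insert hi, Measure.support_add, ih, Finset.set_biUnion_insert]

theorem finMeasures.sum {ι : Type*} [Fintype ι] [Nonempty ι] {μ : ι → Measure Ω}
    (h : ∀ i, μ i ∈ finMeasures Ω) : ∑ i, μ i ∈ finMeasures Ω := by
  classical
  have key : ∀ I : Finset ι, I.Nonempty → ∑ i ∈ I, μ i ∈ finMeasures Ω := by
    intro I hI
    induction hI using Finset.Nonempty.cons_induction with
    | singleton i => simpa using h i
    | cons i I hi _ ih =>
      rw [Finset.sum_cons]
      exact finMeasures.add (h i) ih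
  exact key _ Finset.univ_nonempty

section Sum

variable {ι : Type} [Fintype ι] [Nonempty ι] {μ : ι → Measure Ω}

theorem isPerpCover_support_sum (hp : ∀ i j, i ≠ j → perp (μ i).support (μ j).support) :
    IsPerpCover perp (∑ i, μ i) fun i => (μ i).support :=
  ⟨fun _ => Measure.isClosed_support, hp, by simp [support_finsetSum]⟩

theorem sum_restrict_support (hb : IsClusteringBase 𝒜 Q perp) (h : ∀ i, μ i ∈ finMeasures Ω)
    (hp : ∀ i j, i ≠ j → perp (μ i).support (μ j).support) (i : ι) :
    (∑ j, μ j).restrict (μ i).support = μ i := by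
  have hS := isPerpCover_support_sum hp
  simp only [← Measure.restrictₗ_apply, map_sum]
  simp only [Measure.restrictₗ_apply]
  rw [Finset.sum_eq_single i]
  · exact restrict_eq_self_of_support_subset (h i) Subset.rfl
  · intro j _ hji
    obtain ⟨-, -, hreg⟩ := h j
    rw [Measure.restrict_eq_zero]
    have hd : Disjoint (μ i).support (μ j).support :=
      hb.separation.disjoint (hS.isClosed i).measurableSet (hS.isClosed j).measurableSet
        (hp i j hji.symm)
    exact measure_mono_null (subset_compl_iff_disjoint_right.2 hd)
      Measure.measure_compl_support_of_innerRegular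
  · exact fun hi => absurd (Finset.mem_univ i) hi

theorem sum_mem_adaptedLimits (hb : IsClusteringBase 𝒜 Q perp)
    (h : ∀ i, μ i ∈ adaptedLimits 𝒜 Q perp)
    (hp : ∀ i j, i ≠ j → perp (μ i).support (μ j).support) :
    ∑ i, μ i ∈ adaptedLimits 𝒜 Q perp := by
  refine adaptedLimits.of_restrict hb (isPerpCover_support_sum hp)
    (finMeasures.sum fun i => (h i).1.1) fun i => ?_
  rw [sum_restrict_support hb (fun i => (h i).1.1) hp]
  exact h i

/-- The decompositions of the summands together decompose the support of the sum, and on each part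
the restriction of the sum is that of a single summand. -/
theorem clusters_sum (hs : IsStableClusteringBase 𝒜 Q perp)
    (h : ∀ i, μ i ∈ adaptedLimits 𝒜 Q perp)
    (hp : ∀ i j, i ≠ j → perp (μ i).support (μ j).support) :
    clusters 𝒜 Q perp (∑ i, μ i) = ⋃ i, clusters 𝒜 Q perp (μ i) := by
  have hb := hs.base
  have hfin := fun i => (h i).1.1
  choose κ _ T hT using fun i => exists_isDecomp hs (h i)
  have hsub : ∀ i k, T i k ⊆ (μ i).support := fun i k =>
    (subset_iUnion (T i) k).trans (hT i).eq_iUnion.symm.subset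
  have hD : IsDecomp perp (∑ i, μ i).support fun x : Σ i, κ i => T x.1 x.2 := by
    refine ⟨⟨fun x => (hT _).isClosed _, ?_, fun x => (hT _).nonempty _, ?_⟩,
      fun x => (hT _).connected _⟩
    · rintro ⟨i, k⟩ ⟨j, l⟩ hne
      by_cases hij : i = j
      · subst hij
        exact (hT i).separated k l fun hkl => hne (by rw [hkl])
      · exact hb.separation.perp_mono ((hT i).isClosed k).measurableSet
          ((hT j).isClosed l).measurableSet Measure.isClosed_support.measurableSet
          Measure.isClosed_support.measurableSet (hsub i k) (hsub j l) (hp i j hij)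
    · rw [support_finsetSum, iUnion_sigma]
      simp only [Finset.mem_univ, iUnion_true]
      exact iUnion_congr fun i => (hT i).eq_iUnion
  rw [clusters_eq_iUnion hb (finMeasures.sum hfin) hD, iUnion_sigma]
  refine iUnion_congr fun i => ?_
  rw [clusters_eq_iUnion hb (hfin i) (hT i)]
  refine iUnion_congr fun k => ?_
  rw [← Measure.restrict_restrict_of_subset (hsub i k), sum_restrict_support hb hfin hp]

end Sum

theorem isContinuousClustering_clusters (hs : IsStableClusteringBase 𝒜 Q perp) :
    IsContinuousClustering 𝒜 Q perp (adaptedLimits 𝒜 Q perp) (clusters 𝒜 Q perp) where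
  domain P hP := hP.1.1
  base_mem A hA := base_mem_adaptedLimits hs.base hA
  isForest P hP :=
    let h := (isCandidate_clusters hs hP).1.isForest
    ⟨h.finite, h.nonempty, h.subset.trans hs.base.separation.monotoneClosure_subset, h.forest⟩
  structured P hP := (isCandidate_clusters hs hP).1.struct_eq.symm
  scaleInvariance P hP t ht := ⟨adaptedLimits.smul hP ht, clusters_smul hs hP ht⟩
  baseMeasureClustering A hA := clusters_base hs hA
  disjointAdditivity k P hP hp :=
    ⟨sum_mem_adaptedLimits hs.base hP hp, clusters_sum hs hP hp⟩
  baseAdditivity P hP a ha hPa := by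
    obtain ⟨A, hA⟩ := ha
    rw [hs.base.support_base hA] at hPa ⊢
    obtain ⟨hA, β, hβ, rfl⟩ := hA
    refine ⟨adaptedLimits.add_base hs.base hA hβ hPa hP, ?_⟩
    rw [clusters_add_base hs hA hβ hPa hP, singleton_union, struct_insert]
    exact fun B hB => ((isCandidate_clusters hs hP).1.subset_support hs.base B hB).trans hPa
  continuity P hP R F hR := (isCandidate_clusters hs hP).forestEqAE_limForest hs hP hR

end Selection

end Clustering

/-- For a stable clustering base there is a continuous clustering on `𝒫_𝒜` with values in the
forests over the monotone closure of `𝒜`, and every continuous clustering, on whatever domain,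
agrees with it on `𝒫_𝒜` up to null sets. -/
theorem mainTheorem2 {Ω : Type*} [TopologicalSpace Ω] [T2Space Ω]
    [MeasurableSpace Ω] [OpensMeasurableSpace Ω]
    (𝒜 : Set (Set Ω)) (Q : Set Ω → Measure Ω) (perp : Set Ω → Set Ω → Prop)
    (hbase : Clustering.IsStableClusteringBase 𝒜 Q perp) :
    ∃ c𝒜 : Measure Ω → Set (Set Ω),
      Clustering.IsContinuousClustering 𝒜 Q perp (Clustering.adaptedLimits 𝒜 Q perp) c𝒜 ∧
      (∀ P ∈ Clustering.adaptedLimits 𝒜 Q perp,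
        Clustering.IsForest perp (Clustering.monotoneClosure 𝒜) (c𝒜 P)) ∧
      ∀ (D : Set (Measure Ω)) (c : Measure Ω → Set (Set Ω)),
        Clustering.IsContinuousClustering 𝒜 Q perp D c →
        ∀ P ∈ Clustering.adaptedLimits 𝒜 Q perp, P ∈ D →
          Clustering.ForestEqAE P (c𝒜 P) (c P) := by
  have h := Clustering.isContinuousClustering_clusters hbase
  refine ⟨Clustering.clusters 𝒜 Q perp, h,
    fun P hP => (Clustering.isCandidate_clusters hbase hP).1.isForest, fun D c hc P hP hD => ?_⟩
  obtain ⟨R, F, hR⟩ := hP.2.2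
  exact (h.continuity P hP R F hR).trans (hc.continuity P hD R F hR).symm
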